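/- Let $M$ be a Turing machine with states $Q=\{0,\dots,n-1\}$ ($n\ge 1$), tape alphabet $\Sigma=\{0,1\}$ with blank symbol $0$, and transition function $\delta:\Sigma\times Q\to\Sigma\times Q\times\{\text{left},\text{right}\}$. A configuration $\langle S,T,q\rangle$ consists of $S,T\in\Sigma^*$ and $q\in Q$: $S$ is the content of the tape to the left of the head, including the scanned square (its last symbol), $T$ is the reversed content of the tape to the right of the head, and $q$ is the state. If $\delta(\sigma,q)=(\sigma',q',d)$, then one step of $M$ sends $\langle S\sigma,T\tau,q\rangle$ to $\langle S,T\tau\sigma',q'\rangle$ if $d$ is left, and to $\langle S\sigma'\tau,T,q'\rangle$ if $d$ is right; if one of the two strings of a configuration is empty, its missing last symbol is read as the blank $0$ (and the string without its last symbol is again empty). Work in intuitionistic linear logic without quantifiers, with connectives $\otimes,\&,\multimap,{!}$, presented as a sequent calculus with explicit exchange, contraction, weakening, dereliction and promotion. Proofs with the same conclusion are called equivalent under cut-elimination if they are related by the smallest congruence containing the cut-elimination transformations (cut against axiom, $\eta$-expansion of axioms, commutation of cut with cut, with exchange and with the rules not acting on the cut formula, and the principal cases for $\otimes,\&,\multimap$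 and for promotion against dereliction, contraction, weakening and promotion), the usual identities between composites of exchanges, and the identities stating that contraction is associative and commutative with weakening as unit. For a formula $A$ let $A^m=A\,\&\cdots\&\,A$ ($m$ copies), $E=A\multimap A$, ${}_n\mathbf{bool}_A=A^n\multimap A$, $\mathbf{bint}_A={!}E\multimap({!}E\multimap E)$ and $$\mathbf{Tur}_A={!}\mathbf{bint}_A\otimes{!}\mathbf{bint}_A\otimes{!}\,{}_n\mathbf{bool}_A .$$ For $q\in Q$ let $\underline q_A$ be the proof of $\vdash{}_n\mathbf{bool}_A$ given by the projection $A^n\vdash A$ onto the copy at position $q$. For $S=s_1\cdots s_l\in\{0,1\}^*$ let $\underline S_A$ be the proof of $\vdash\mathbf{bint}_A$ obtained from the proof of $A,E,\dots,E\vdash A$ that applies $l$ copies of $E$ one after the other, by introducing $E$ on the right, dereliction of all $l$ copies, contraction to a single ${!}E$ of the copies at the places $i$ with $s_i=0$, and likewise of those with $s_i=1$ (a weakening if there are none), and two right introductions of $\multimap$, the first argument being the ${!}E$ for the digit $0$. The configuration $\langle S,T,q\rangle$ is encoded by the proof $\operatorname{prom}(\underline S_A)\otimes\operatorname{prom}(\underline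 T_A)\otimes\operatorname{prom}(\underline q_A)$ of $\vdash\mathbf{Tur}_A$, where $\operatorname{prom}$ is promotion. **Theorem.** For every $n\ge1$, every such transition function $\delta$ and every formula $A$ there is a proof ${}_\delta\underline{\mathrm{step}}_A$ of $\mathbf{Tur}_{A^3}\vdash\mathbf{Tur}_A$ which encodes a single transition step of $M$: for every configuration $c$, cutting the encoding of $c$ as a proof of $\vdash\mathbf{Tur}_{A^3}$ against ${}_\delta\underline{\mathrm{step}}_A$ gives a proof of $\vdash\mathbf{Tur}_A$ that is equivalent under cut-elimination to the encoding on $A$ of the configuration that $M$ reaches from $c$ in one step. -/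

import Mathlib

universe u

namespace ILL

/-! ## Formulas, proofs and cut-elimination in intuitionistic linear logic -/

/-- Formulas of (quantifier-free) intuitionistic linear logic over a type `α` of atoms:
`A ⊗ B`, `A & B`, `A ⊸ B` and `!A`. -/
inductive Formula (α : Type u) : Type u
  | atom (x : α) : Formula α
  | tens (A B : Formula α) : Formula α
  | amp (A B : Formula α) : Formula α
  | lolli (A B : Formula α) : Formula α
  | bang (A : Formula α) : Formula α

open Formula

variable {α : Type u}

/-- The one-premise rules acting on the left of the turnstile. `LeftRule P Q` replaces a segment `P`
of the context of the premise by the segment `Q` in the context of the conclusion. The exchange rule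
swaps two adjacent blocks; the usual rule is the case of two blocks of one formula each. -/
inductive LeftRule : List (Formula α) → List (Formula α) → Type u
  | exch (Γ Δ : List (Formula α)) : LeftRule (Γ ++ Δ) (Δ ++ Γ)
  | tens (A B : Formula α) : LeftRule [A, B] [tens A B]
  | amp₀ (A B : Formula α) : LeftRule [A] [amp A B]
  | amp₁ (A B : Formula α) : LeftRule [B] [amp A B]
  | der (A : Formula α) : LeftRule [A] [bang A]
  | ctr (A : Formula α) : LeftRule [bang A, bang A] [bang A]
  | wk (A : Formula α) : LeftRule [] [bang A]

/-- `Proof Γ C` is the type of proofs (derivation trees) of the sequent `Γ ⊢ C`. The contexts of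
premises and conclusions are given up to a propositional equality of lists (`hp` for a premise, `hc`
for the conclusion); the decomposition of a context is recorded by explicit arguments. -/
inductive Proof : List (Formula α) → Formula α → Type u
  /-- `A ⊢ A` -/
  | ax (A : Formula α) : Proof [A] A
  /-- from `Γ ⊢ A` and `Δ₁, A, Δ₂ ⊢ B` infer `Δ₁, Γ, Δ₂ ⊢ B` -/
  | cut {Γ Θ Ξ : List (Formula α)} {A B : Formula α} (Δ₁ Δ₂ : List (Formula α))
      (hp : Θ = Δ₁ ++ A :: Δ₂) (hc : Ξ = Δ₁ ++ Γ ++ Δ₂)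
      (π : Proof Γ A) (ρ : Proof Θ B) : Proof Ξ B
  /-- from `Δ₁, P, Δ₂ ⊢ C` infer `Δ₁, Q, Δ₂ ⊢ C` -/
  | left {P Q Θ Ξ : List (Formula α)} {C : Formula α} (Δ₁ Δ₂ : List (Formula α))
      (r : LeftRule P Q) (hp : Θ = Δ₁ ++ P ++ Δ₂) (hc : Ξ = Δ₁ ++ Q ++ Δ₂)
      (π : Proof Θ C) : Proof Ξ C
  /-- from `Γ ⊢ A` and `Δ ⊢ B` infer `Γ, Δ ⊢ A ⊗ B` -/
  | tensR {Γ Δ Ξ : List (Formula α)} {A B : Formula α} (hc : Ξ = Γ ++ Δ)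
      (π : Proof Γ A) (ρ : Proof Δ B) : Proof Ξ (tens A B)
  /-- from `Γ ⊢ A` and `Γ ⊢ B` infer `Γ ⊢ A & B` -/
  | ampR {Γ : List (Formula α)} {A B : Formula α}
      (π : Proof Γ A) (ρ : Proof Γ B) : Proof Γ (amp A B)
  /-- from `A, Γ ⊢ B` infer `Γ ⊢ A ⊸ B` -/
  | lolliR {Γ Θ : List (Formula α)} {A B : Formula α} (hp : Θ = A :: Γ)
      (π : Proof Θ B) : Proof Γ (lolli A B)
  /-- from `Γ ⊢ A` and `Δ₁, B, Δ₂ ⊢ C` infer `Δ₁, Γ, A ⊸ B, Δ₂ ⊢ C` -/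
  | lolliL {Γ Θ Ξ : List (Formula α)} {A B C : Formula α} (Δ₁ Δ₂ : List (Formula α))
      (hp : Θ = Δ₁ ++ B :: Δ₂) (hc : Ξ = Δ₁ ++ Γ ++ lolli A B :: Δ₂)
      (π : Proof Γ A) (ρ : Proof Θ C) : Proof Ξ C
  /-- from `!Γ ⊢ A` infer `!Γ ⊢ !A` -/
  | prom {Θ : List (Formula α)} {A : Formula α} (Γ : List (Formula α))
      (hc : Θ = Γ.map bang) (π : Proof Θ A) : Proof Θ (bang A)

namespace Proof

/-- Transport of a proof along an equality of contexts. -/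
def castCtx {Θ Ξ : List (Formula α)} {C : Formula α} (h : Θ = Ξ) (π : Proof Θ C) : Proof Ξ C :=
  h ▸ π

/-- Iterated contraction: from `Δ₁, !Γ, !Γ, Δ₂ ⊢ C` to `Δ₁, !Γ, Δ₂ ⊢ C`. -/
def ctrs {C : Formula α} : (Γ Δ₁ Δ₂ : List (Formula α)) → {Θ Ξ : List (Formula α)} →
    (hp : Θ = Δ₁ ++ (Γ.map bang ++ Γ.map bang) ++ Δ₂) → (hc : Ξ = Δ₁ ++ Γ.map bang ++ Δ₂) →
    Proof Θ C → Proof Ξ C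
  | [], _, _, _, _, hp, hc, π => castCtx (by simp [hp, hc]) π
  | A :: Γ, Δ₁, Δ₂, _, _, hp, hc, π =>
      ctrs Γ (Δ₁ ++ [bang A]) Δ₂ rfl (by simp [hc])
        (left Δ₁ (Γ.map bang ++ Γ.map bang ++ Δ₂) (.ctr A) rfl (by simp)
          (left (Δ₁ ++ [bang A]) (Γ.map bang ++ Δ₂) (.exch (Γ.map bang) [bang A])
            (by simp [hp]) (by simp) π))

/-- Iterated weakening: from `Δ₁, Δ₂ ⊢ C` to `Δ₁, !Γ, Δ₂ ⊢ C`. -/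
def wks {C : Formula α} : (Γ Δ₁ Δ₂ : List (Formula α)) → {Θ Ξ : List (Formula α)} →
    (hp : Θ = Δ₁ ++ Δ₂) → (hc : Ξ = Δ₁ ++ Γ.map bang ++ Δ₂) → Proof Θ C → Proof Ξ C
  | [], _, _, _, _, hp, hc, π => castCtx (by simp [hp, hc]) π
  | A :: Γ, Δ₁, Δ₂, _, _, hp, hc, π =>
      left Δ₁ (Γ.map bang ++ Δ₂) (.wk A) (by simp) (by simp [hc]) (wks Γ Δ₁ Δ₂ hp rfl π)

end Proof

open Proof

/-- Equivalence of proofs under cut-elimination: the smallest congruence on proofs that contains the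
cut-elimination transformations, the bookkeeping identities for exchange, and the identities making
contraction and weakening a commutative comonoid structure. -/
inductive CutEquiv : {Γ : List (Formula α)} → {C : Formula α} → Proof Γ C → Proof Γ C → Prop
  -- equivalence relation
  | refl {Γ : List (Formula α)} {C : Formula α} (π : Proof Γ C) : CutEquiv π π
  | symm {Γ : List (Formula α)} {C : Formula α} {π ρ : Proof Γ C} :
      CutEquiv π ρ → CutEquiv ρ π
  | trans {Γ : List (Formula α)} {C : Formula α} {π ρ σ : Proof Γ C} :
      CutEquiv π ρ → CutEquiv ρ σ → CutEquiv π σ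
  -- congruence
  | congr_cut {Γ Θ Ξ : List (Formula α)} {A B : Formula α} (Δ₁ Δ₂ : List (Formula α))
      (hp : Θ = Δ₁ ++ A :: Δ₂) (hc : Ξ = Δ₁ ++ Γ ++ Δ₂) {π π' : Proof Γ A} {ρ ρ' : Proof Θ B} :
      CutEquiv π π' → CutEquiv ρ ρ' →
      CutEquiv (cut Δ₁ Δ₂ hp hc π ρ) (cut Δ₁ Δ₂ hp hc π' ρ')
  | congr_left {P Q Θ Ξ : List (Formula α)} {C : Formula α} (Δ₁ Δ₂ : List (Formula α))
      (r : LeftRule P Q) (hp : Θ = Δ₁ ++ P ++ Δ₂) (hc : Ξ = Δ₁ ++ Q ++ Δ₂) {π π' : Proof Θ C} :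
      CutEquiv π π' → CutEquiv (left Δ₁ Δ₂ r hp hc π) (left Δ₁ Δ₂ r hp hc π')
  | congr_tensR {Γ Δ Ξ : List (Formula α)} {A B : Formula α} (hc : Ξ = Γ ++ Δ)
      {π π' : Proof Γ A} {ρ ρ' : Proof Δ B} :
      CutEquiv π π' → CutEquiv ρ ρ' → CutEquiv (tensR hc π ρ) (tensR hc π' ρ')
  | congr_ampR {Γ : List (Formula α)} {A B : Formula α} {π π' : Proof Γ A} {ρ ρ' : Proof Γ B} :
      CutEquiv π π' → CutEquiv ρ ρ' → CutEquiv (ampR π ρ) (ampR π' ρ')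
  | congr_lolliR {Γ Θ : List (Formula α)} {A B : Formula α} (hp : Θ = A :: Γ)
      {π π' : Proof Θ B} : CutEquiv π π' → CutEquiv (lolliR hp π) (lolliR hp π')
  | congr_lolliL {Γ Θ Ξ : List (Formula α)} {A B C : Formula α} (Δ₁ Δ₂ : List (Formula α))
      (hp : Θ = Δ₁ ++ B :: Δ₂) (hc : Ξ = Δ₁ ++ Γ ++ lolli A B :: Δ₂)
      {π π' : Proof Γ A} {ρ ρ' : Proof Θ C} :
      CutEquiv π π' → CutEquiv ρ ρ' →
      CutEquiv (lolliL Δ₁ Δ₂ hp hc π ρ) (lolliL Δ₁ Δ₂ hp hc π' ρ')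
  | congr_prom {Θ : List (Formula α)} {A : Formula α} (Γ : List (Formula α))
      (hc : Θ = Γ.map bang) {π π' : Proof Θ A} :
      CutEquiv π π' → CutEquiv (prom Γ hc π) (prom Γ hc π')
  -- a cut against an axiom
  | ax_cut {Δ₁ Δ₂ : List (Formula α)} {A B : Formula α} (ρ : Proof (Δ₁ ++ A :: Δ₂) B) :
      CutEquiv (cut Δ₁ Δ₂ rfl (by simp) (ax A) ρ) ρ
  | cut_ax {Γ : List (Formula α)} {A : Formula α} (π : Proof Γ A) :
      CutEquiv (cut [] [] rfl (by simp) π (ax A)) π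
  -- expansion of axioms
  | eta_tens (A B : Formula α) :
      CutEquiv (ax (tens A B))
        (left [] [] (.tens A B) rfl rfl (tensR (Γ := [A]) (Δ := [B]) rfl (ax A) (ax B)))
  | eta_amp (A B : Formula α) :
      CutEquiv (ax (amp A B))
        (ampR (left [] [] (.amp₀ A B) rfl rfl (ax A)) (left [] [] (.amp₁ A B) rfl rfl (ax B)))
  | eta_lolli (A B : Formula α) :
      CutEquiv (ax (lolli A B)) (lolliR rfl (lolliL [] [] rfl rfl (ax A) (ax B)))
  | eta_bang (A : Formula α) :
      CutEquiv (ax (bang A)) (prom [A] rfl (left [] [] (.der A) rfl rfl (ax A)))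
  -- cut against cut
  | cut_cut {Γ Υ₁ Υ₂ Δ₁ Δ₂ : List (Formula α)} {A B C : Formula α} (π : Proof Γ A)
      (ρ : Proof (Υ₁ ++ A :: Υ₂) B) (σ : Proof (Δ₁ ++ B :: Δ₂) C) :
      CutEquiv (cut Δ₁ Δ₂ rfl rfl (cut Υ₁ Υ₂ rfl rfl π ρ) σ)
        (cut (Δ₁ ++ Υ₁) (Υ₂ ++ Δ₂) (by simp) (by simp) π (cut Δ₁ Δ₂ rfl rfl ρ σ))
  | cut_cut_comm {Γ Γ' Δ₁ Δ₂ Δ₃ : List (Formula α)} {A B C : Formula α} (π : Proof Γ A)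
      (ρ : Proof Γ' B) (σ : Proof (Δ₁ ++ A :: (Δ₂ ++ B :: Δ₃)) C) :
      CutEquiv
        (cut Δ₁ (Δ₂ ++ Γ' ++ Δ₃) (by simp) rfl π
          (cut (Δ₁ ++ A :: Δ₂) Δ₃ (by simp) rfl ρ σ))
        (cut (Δ₁ ++ Γ ++ Δ₂) Δ₃ (by simp) (by simp) ρ
          (cut Δ₁ (Δ₂ ++ B :: Δ₃) rfl rfl π σ))
  -- principal cuts
  | tens_tens {Γ Γ' Δ₁ Δ₂ : List (Formula α)} {A B C : Formula α} (π : Proof Γ A)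
      (ρ : Proof Γ' B) (σ : Proof (Δ₁ ++ [A, B] ++ Δ₂) C) :
      CutEquiv
        (cut Δ₁ Δ₂ (by simp) rfl (tensR rfl π ρ) (left Δ₁ Δ₂ (.tens A B) rfl rfl σ))
        (cut Δ₁ (Γ' ++ Δ₂) rfl (by simp) π (cut (Δ₁ ++ [A]) Δ₂ (by simp) (by simp) ρ σ))
  | amp_amp₀ {Γ Δ₁ Δ₂ : List (Formula α)} {A B C : Formula α} (π : Proof Γ A)
      (ρ : Proof Γ B) (σ : Proof (Δ₁ ++ [A] ++ Δ₂) C) :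
      CutEquiv
        (cut Δ₁ Δ₂ (by simp) rfl (ampR π ρ) (left Δ₁ Δ₂ (.amp₀ A B) rfl rfl σ))
        (cut Δ₁ Δ₂ (by simp) rfl π σ)
  | amp_amp₁ {Γ Δ₁ Δ₂ : List (Formula α)} {A B C : Formula α} (π : Proof Γ A)
      (ρ : Proof Γ B) (σ : Proof (Δ₁ ++ [B] ++ Δ₂) C) :
      CutEquiv
        (cut Δ₁ Δ₂ (by simp) rfl (ampR π ρ) (left Δ₁ Δ₂ (.amp₁ A B) rfl rfl σ))
        (cut Δ₁ Δ₂ (by simp) rfl ρ σ)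
  | lolli_lolli {Γ Δ Δ₁ Δ₂ : List (Formula α)} {A B C : Formula α} (π : Proof (A :: Γ) B)
      (ρ : Proof Δ A) (σ : Proof (Δ₁ ++ B :: Δ₂) C) :
      CutEquiv
        (cut (Δ₁ ++ Δ) Δ₂ rfl rfl (lolliR rfl π) (lolliL Δ₁ Δ₂ rfl rfl ρ σ))
        (cut Δ₁ Δ₂ rfl (by simp) (cut [] Γ rfl rfl ρ π) σ)
  | prom_der {Γ Δ₁ Δ₂ : List (Formula α)} {A C : Formula α} (π : Proof (Γ.map bang) A)
      (σ : Proof (Δ₁ ++ [A] ++ Δ₂) C) :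
      CutEquiv
        (cut Δ₁ Δ₂ (by simp) rfl (prom Γ rfl π) (left Δ₁ Δ₂ (.der A) rfl rfl σ))
        (cut Δ₁ Δ₂ (by simp) rfl π σ)
  | prom_ctr {Γ Δ₁ Δ₂ : List (Formula α)} {A C : Formula α} (π : Proof (Γ.map bang) A)
      (σ : Proof (Δ₁ ++ [bang A, bang A] ++ Δ₂) C) :
      CutEquiv
        (cut Δ₁ Δ₂ (by simp) rfl (prom Γ rfl π) (left Δ₁ Δ₂ (.ctr A) rfl rfl σ))
        (ctrs Γ Δ₁ Δ₂ (by simp) rfl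
          (cut (Δ₁ ++ Γ.map bang) Δ₂ rfl rfl (prom Γ rfl π)
            (cut Δ₁ (bang A :: Δ₂) (by simp) rfl (prom Γ rfl π) σ)))
  | prom_wk {Γ Δ₁ Δ₂ : List (Formula α)} {A C : Formula α} (π : Proof (Γ.map bang) A)
      (σ : Proof (Δ₁ ++ [] ++ Δ₂) C) :
      CutEquiv
        (cut Δ₁ Δ₂ (by simp) rfl (prom Γ rfl π) (left Δ₁ Δ₂ (.wk A) rfl rfl σ))
        (wks Γ Δ₁ Δ₂ (by simp) rfl σ)
  | prom_prom {Γ Δ₁ Δ₂ : List (Formula α)} {A B : Formula α} (π : Proof (Γ.map bang) A)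
      (σ : Proof (Δ₁.map bang ++ bang A :: Δ₂.map bang) B) :
      CutEquiv
        (cut (Δ₁.map bang) (Δ₂.map bang) rfl rfl (prom Γ rfl π)
          (prom (Δ₁ ++ A :: Δ₂) (by simp) σ))
        (prom (Δ₁ ++ Γ ++ Δ₂) (by simp)
          (cut (Δ₁.map bang) (Δ₂.map bang) rfl rfl (prom Γ rfl π) σ))
  -- the left premise of the cut ends with a left rule
  | left_cut {P Q Υ₁ Υ₂ Δ₁ Δ₂ : List (Formula α)} {A C : Formula α} (r : LeftRule P Q)
      (π : Proof (Υ₁ ++ P ++ Υ₂) A) (σ : Proof (Δ₁ ++ A :: Δ₂) C) :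
      CutEquiv
        (cut Δ₁ Δ₂ rfl rfl (left Υ₁ Υ₂ r rfl rfl π) σ)
        (left (Δ₁ ++ Υ₁) (Υ₂ ++ Δ₂) r (by simp) (by simp) (cut Δ₁ Δ₂ rfl rfl π σ))
  | lolliL_cut {Γ Υ₁ Υ₂ Δ₁ Δ₂ : List (Formula α)} {A B C D : Formula α} (π : Proof Γ A)
      (ρ : Proof (Υ₁ ++ B :: Υ₂) C) (σ : Proof (Δ₁ ++ C :: Δ₂) D) :
      CutEquiv
        (cut Δ₁ Δ₂ rfl rfl (lolliL Υ₁ Υ₂ rfl rfl π ρ) σ)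
        (lolliL (B := B) (Δ₁ ++ Υ₁) (Υ₂ ++ Δ₂) (by simp) (by simp) π (cut Δ₁ Δ₂ rfl rfl ρ σ))
  -- the cut formula is one of the formulas exchanged by the last rule of the right premise
  | cut_exch₁ {Γ Υ₁ Υ₂ Υ Δ₁ Δ₂ : List (Formula α)} {A C : Formula α} (π : Proof Γ A)
      (σ : Proof (Δ₁ ++ ((Υ₁ ++ A :: Υ₂) ++ Υ) ++ Δ₂) C) :
      CutEquiv
        (cut (Δ₁ ++ Υ ++ Υ₁) (Υ₂ ++ Δ₂) (by simp) rfl π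
          (left Δ₁ Δ₂ (.exch (Υ₁ ++ A :: Υ₂) Υ) rfl rfl σ))
        (left Δ₁ Δ₂ (.exch (Υ₁ ++ Γ ++ Υ₂) Υ) rfl (by simp)
          (cut (Δ₁ ++ Υ₁) (Υ₂ ++ Υ ++ Δ₂) (by simp) (by simp) π σ))
  | cut_exch₂ {Γ Υ₁ Υ₂ Υ Δ₁ Δ₂ : List (Formula α)} {A C : Formula α} (π : Proof Γ A)
      (σ : Proof (Δ₁ ++ (Υ ++ (Υ₁ ++ A :: Υ₂)) ++ Δ₂) C) :
      CutEquiv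
        (cut (Δ₁ ++ Υ₁) (Υ₂ ++ Υ ++ Δ₂) (by simp) rfl π
          (left Δ₁ Δ₂ (.exch Υ (Υ₁ ++ A :: Υ₂)) rfl rfl σ))
        (left Δ₁ Δ₂ (.exch Υ (Υ₁ ++ Γ ++ Υ₂)) rfl (by simp)
          (cut (Δ₁ ++ Υ ++ Υ₁) (Υ₂ ++ Δ₂) (by simp) (by simp) π σ))
  -- the cut formula is not touched by the last rule of the right premise
  | cut_left₁ {P Q Γ Δ₁ Δ₂ Δ₃ : List (Formula α)} {A C : Formula α} (r : LeftRule P Q)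
      (π : Proof Γ A) (σ : Proof ((Δ₁ ++ A :: Δ₂) ++ P ++ Δ₃) C) :
      CutEquiv
        (cut Δ₁ (Δ₂ ++ Q ++ Δ₃) (by simp) rfl π (left (Δ₁ ++ A :: Δ₂) Δ₃ r rfl rfl σ))
        (left (Δ₁ ++ Γ ++ Δ₂) Δ₃ r rfl (by simp)
          (cut Δ₁ (Δ₂ ++ P ++ Δ₃) (by simp) (by simp) π σ))
  | cut_left₂ {P Q Γ Δ₁ Δ₂ Δ₃ : List (Formula α)} {A C : Formula α} (r : LeftRule P Q)
      (π : Proof Γ A) (σ : Proof (Δ₁ ++ P ++ (Δ₂ ++ A :: Δ₃)) C) :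
      CutEquiv
        (cut (Δ₁ ++ Q ++ Δ₂) Δ₃ (by simp) rfl π (left Δ₁ (Δ₂ ++ A :: Δ₃) r rfl rfl σ))
        (left Δ₁ (Δ₂ ++ Γ ++ Δ₃) r rfl (by simp)
          (cut (Δ₁ ++ P ++ Δ₂) Δ₃ (by simp) (by simp) π σ))
  | cut_tensR₁ {Γ Δ₁ Δ₂ Υ : List (Formula α)} {A B C : Formula α} (π : Proof Γ A)
      (ρ : Proof (Δ₁ ++ A :: Δ₂) B) (σ : Proof Υ C) :
      CutEquiv
        (cut Δ₁ (Δ₂ ++ Υ) (by simp) rfl π (tensR rfl ρ σ))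
        (tensR (by simp) (cut Δ₁ Δ₂ rfl rfl π ρ) σ)
  | cut_tensR₂ {Γ Δ₁ Δ₂ Υ : List (Formula α)} {A B C : Formula α} (π : Proof Γ A)
      (ρ : Proof Υ B) (σ : Proof (Δ₁ ++ A :: Δ₂) C) :
      CutEquiv
        (cut (Υ ++ Δ₁) Δ₂ (by simp) rfl π (tensR rfl ρ σ))
        (tensR (by simp) ρ (cut Δ₁ Δ₂ rfl rfl π σ))
  | cut_ampR {Γ Δ₁ Δ₂ : List (Formula α)} {A B C : Formula α} (π : Proof Γ A)
      (ρ : Proof (Δ₁ ++ A :: Δ₂) B) (σ : Proof (Δ₁ ++ A :: Δ₂) C) :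
      CutEquiv
        (cut Δ₁ Δ₂ rfl rfl π (ampR ρ σ))
        (ampR (cut Δ₁ Δ₂ rfl rfl π ρ) (cut Δ₁ Δ₂ rfl rfl π σ))
  | cut_lolliR {Γ Δ₁ Δ₂ : List (Formula α)} {A B C : Formula α} (π : Proof Γ A)
      (σ : Proof (B :: (Δ₁ ++ A :: Δ₂)) C) :
      CutEquiv
        (cut Δ₁ Δ₂ rfl rfl π (lolliR rfl σ))
        (lolliR rfl (cut (B :: Δ₁) Δ₂ rfl (by simp) π σ))
  | cut_lolliL₁ {Γ Υ₁ Υ₂ Δ₁ Δ₂ : List (Formula α)} {A B C D : Formula α} (π : Proof Γ A)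
      (ρ : Proof (Υ₁ ++ A :: Υ₂) B) (σ : Proof (Δ₁ ++ C :: Δ₂) D) :
      CutEquiv
        (cut (Δ₁ ++ Υ₁) (Υ₂ ++ lolli B C :: Δ₂) (by simp) rfl π (lolliL Δ₁ Δ₂ rfl rfl ρ σ))
        (lolliL Δ₁ Δ₂ rfl (by simp) (cut Υ₁ Υ₂ rfl rfl π ρ) σ)
  | cut_lolliL₂ {Γ Υ Δ₁ Δ₂ Δ₃ : List (Formula α)} {A B C D : Formula α} (π : Proof Γ A)
      (ρ : Proof Υ B) (σ : Proof ((Δ₁ ++ A :: Δ₂) ++ C :: Δ₃) D) :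
      CutEquiv
        (cut Δ₁ (Δ₂ ++ Υ ++ lolli B C :: Δ₃) (by simp) rfl π
          (lolliL (Δ₁ ++ A :: Δ₂) Δ₃ rfl rfl ρ σ))
        (lolliL (B := C) (Δ₁ ++ Γ ++ Δ₂) Δ₃ rfl (by simp) ρ
          (cut Δ₁ (Δ₂ ++ C :: Δ₃) (by simp) (by simp) π σ))
  | cut_lolliL₃ {Γ Υ Δ₁ Δ₂ Δ₃ : List (Formula α)} {A B C D : Formula α} (π : Proof Γ A)
      (ρ : Proof Υ B) (σ : Proof (Δ₁ ++ C :: (Δ₂ ++ A :: Δ₃)) D) :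
      CutEquiv
        (cut (Δ₁ ++ Υ ++ lolli B C :: Δ₂) Δ₃ (by simp) rfl π
          (lolliL Δ₁ (Δ₂ ++ A :: Δ₃) rfl rfl ρ σ))
        (lolliL (B := C) Δ₁ (Δ₂ ++ Γ ++ Δ₃) rfl (by simp) ρ
          (cut (Δ₁ ++ C :: Δ₂) Δ₃ (by simp) (by simp) π σ))
  -- bookkeeping of exchanges: exchanging with an empty block does nothing, exchanging twice does
  -- nothing, and a block may be exchanged with two consecutive blocks one after the other
  | exch_nil {Γ Δ₁ Δ₂ : List (Formula α)} {C : Formula α} (π : Proof (Δ₁ ++ Γ ++ Δ₂) C) :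
      CutEquiv (left Δ₁ Δ₂ (.exch Γ []) (by simp) (by simp) π) π
  | exch_exch {Γ Γ' Δ₁ Δ₂ : List (Formula α)} {C : Formula α}
      (π : Proof (Δ₁ ++ (Γ ++ Γ') ++ Δ₂) C) :
      CutEquiv
        (left Δ₁ Δ₂ (.exch Γ' Γ) rfl rfl (left Δ₁ Δ₂ (.exch Γ Γ') rfl rfl π)) π
  | exch_append {Γ Υ₁ Υ₂ Δ₁ Δ₂ : List (Formula α)} {C : Formula α}
      (π : Proof (Δ₁ ++ (Γ ++ (Υ₁ ++ Υ₂)) ++ Δ₂) C) :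
      CutEquiv
        (left Δ₁ Δ₂ (.exch Γ (Υ₁ ++ Υ₂)) rfl rfl π)
        (left (Δ₁ ++ Υ₁) Δ₂ (.exch Γ Υ₂) (by simp) (by simp)
          (left Δ₁ (Υ₂ ++ Δ₂) (.exch Γ Υ₁) (by simp) rfl π))
  -- contraction is commutative and associative, with weakening as unit
  | ctr_exch {Δ₁ Δ₂ : List (Formula α)} {A C : Formula α}
      (π : Proof (Δ₁ ++ [bang A, bang A] ++ Δ₂) C) :
      CutEquiv
        (left Δ₁ Δ₂ (.ctr A) rfl rfl (left Δ₁ Δ₂ (.exch [bang A] [bang A]) rfl rfl π))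
        (left Δ₁ Δ₂ (.ctr A) rfl rfl π)
  | ctr_ctr {Δ₁ Δ₂ : List (Formula α)} {A C : Formula α}
      (π : Proof (Δ₁ ++ [bang A, bang A, bang A] ++ Δ₂) C) :
      CutEquiv
        (left Δ₁ Δ₂ (.ctr A) rfl rfl (left Δ₁ (bang A :: Δ₂) (.ctr A) (by simp) (by simp) π))
        (left Δ₁ Δ₂ (.ctr A) rfl rfl (left (Δ₁ ++ [bang A]) Δ₂ (.ctr A) (by simp) (by simp) π))
  | ctr_wk {Δ₁ Δ₂ : List (Formula α)} {A C : Formula α}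
      (π : Proof (Δ₁ ++ [bang A] ++ Δ₂) C) :
      CutEquiv
        (left Δ₁ Δ₂ (.ctr A) rfl rfl (left Δ₁ (bang A :: Δ₂) (.wk A) (by simp) (by simp) π)) π

/-! ## Encoding of data as proofs -/

/-- `A ^ n = A & (A & (⋯ & A))` with `n` copies of `A`; only meaningful for `n ≥ 1`. -/
def Formula.pow (A : Formula α) : ℕ → Formula α
  | 0 => A
  | 1 => A
  | n + 2 => amp A (A.pow (n + 1))

/-- The type `A ^ n ⊸ A` of `n`-booleans on `A`. -/
def nbool (n : ℕ) (A : Formula α) : Formula α := lolli (A.pow n) A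

/-- The type `!(A ⊸ A) ⊸ (!(A ⊸ A) ⊸ (A ⊸ A))` of binary integers on `A`. -/
def bint (A : Formula α) : Formula α :=
  lolli (bang (lolli A A)) (lolli (bang (lolli A A)) (lolli A A))

/-- The type `!bint ⊗ !bint ⊗ !nbool` of Turing configurations on `A`, for machines with `n`
states. -/
def Tur (n : ℕ) (A : Formula α) : Formula α :=
  tens (tens (bang (bint A)) (bang (bint A))) (bang (nbool n A))

/-- The proof of `A ^ n ⊢ A` selecting the copy of `A` at position `i`. -/
def projProof (A : Formula α) : (n : ℕ) → Fin n → Proof [A.pow n] A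
  | 0, i => i.elim0
  | 1, _ => ax A
  | n + 2, i =>
      Fin.cases (motive := fun _ => Proof [A.pow (n + 2)] A)
        (left [] [] (.amp₀ A (A.pow (n + 1))) rfl rfl (ax A))
        (fun j => left [] [] (.amp₁ A (A.pow (n + 1))) rfl rfl (projProof A (n + 1) j)) i

/-- The `n`-boolean `i`, as a proof of `⊢ A ^ n ⊸ A`. -/
def nboolProof (A : Formula α) (n : ℕ) (i : Fin n) : Proof [] (nbool n A) :=
  lolliR rfl (projProof A n i)

/-- For a binary sequence `S = s₁ ⋯ sₗ` with `a` zeros and `b` ones, the proof of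
`A, (A ⊸ A)ᵇ, (A ⊸ A)ᵃ ⊢ A` that applies `l` copies of `A ⊸ A` successively to `A`: the copy applied
in the `i`-th place belongs to the first block if `sᵢ = 1` and to the second block if `sᵢ = 0`. -/
def composeProof (A : Formula α) : (S : List (Fin 2)) →
    Proof (A :: (List.replicate (S.count 1) (lolli A A) ++
      List.replicate (S.count 0) (lolli A A))) A
  | [] => ax A
  | 1 :: S =>
      lolliL [] _ rfl (by simp [List.replicate_succ]) (ax A) (composeProof A S)
  | 0 :: S =>
      left [A] (List.replicate (S.count 0) (lolli A A))
        (.exch [lolli A A] (List.replicate (S.count 1) (lolli A A)))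
        rfl (by simp [List.replicate_succ])
        (lolliL [] (List.replicate (S.count 1) (lolli A A) ++
          List.replicate (S.count 0) (lolli A A)) rfl (by simp) (ax A) (composeProof A S))

/-- Iterated dereliction: from `Δ₁, Γ ⊢ C` to `Δ₁, !Γ ⊢ C`. -/
def derAll {C : Formula α} : (Γ Δ₁ : List (Formula α)) → {Θ Ξ : List (Formula α)} →
    (hp : Θ = Δ₁ ++ Γ) → (hc : Ξ = Δ₁ ++ Γ.map bang) → Proof Θ C → Proof Ξ C
  | [], _, _, _, hp, hc, π => castCtx (by simp [hp, hc]) π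
  | A :: Γ, Δ₁, _, _, hp, hc, π =>
      derAll Γ (Δ₁ ++ [bang A]) rfl (by simp [hc])
        (left Δ₁ Γ (.der A) (by simp [hp]) (by simp) π)

/-- From `Δ₁, (!A)ᵏ, Δ₂ ⊢ C` to `Δ₁, !A, Δ₂ ⊢ C`: a weakening if `k = 0`, and `k - 1` contractions
otherwise. -/
def gather {C : Formula α} (A : Formula α) (Δ₁ Δ₂ : List (Formula α)) : (k : ℕ) →
    {Θ Ξ : List (Formula α)} → (hp : Θ = Δ₁ ++ List.replicate k (bang A) ++ Δ₂) →
    (hc : Ξ = Δ₁ ++ [bang A] ++ Δ₂) → Proof Θ C → Proof Ξ C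
  | 0, _, _, hp, hc, π => left Δ₁ Δ₂ (.wk A) hp hc π
  | 1, _, _, hp, hc, π => castCtx (hp.trans hc.symm) π
  | k + 2, _, _, hp, hc, π =>
      gather A Δ₁ Δ₂ (k + 1) rfl hc
        (left Δ₁ (List.replicate k (bang A) ++ Δ₂) (.ctr A)
          (by simp [hp, List.replicate_succ]) (by simp [List.replicate_succ]) π)

/-- The binary integer `S`, as a proof of `⊢ bint A`. With `E = A ⊸ A` it ends with
`!E, !E ⊢ E`, where the second hypothesis has been contracted from one copy for every digit `0`, and
the first one from one copy for every digit `1`, followed by two right introductions of `⊸`. -/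
def bintProof (A : Formula α) (S : List (Fin 2)) : Proof [] (bint A) :=
  lolliR rfl (lolliR rfl
    (gather (lolli A A) [] [bang (lolli A A)] (S.count 1) rfl rfl
      (gather (lolli A A) (List.replicate (S.count 1) (bang (lolli A A))) [] (S.count 0)
        (by simp) (by simp)
        (derAll
          (List.replicate (S.count 1) (lolli A A) ++ List.replicate (S.count 0) (lolli A A)) []
          rfl rfl (lolliR rfl (composeProof A S))))))

/-! ## Turing machines -/

/-- Directions of movement of the tape head. -/
inductive Dir
  | left
  | right

/-- A transition function `Σ × Q → Σ × Q × {left, right}` with tape alphabet `Σ = {0, 1}`, blank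
symbol `0`, and states `Q = {0, …, n - 1}`. -/
abbrev Transition (n : ℕ) := Fin 2 × Fin n → Fin 2 × Fin n × Dir

/-- A configuration `⟨S, T, q⟩`: `S` is the content of the tape to the left of the head including the
scanned square (the last symbol of `S`), `T` is the reversed content of the tape to the right of the
head, and `q` is the state. All squares not recorded are blank. -/
structure Config (n : ℕ) where
  S : List (Fin 2)
  T : List (Fin 2)
  q : Fin n

/-- One step of the machine: a configuration `⟨Sσ, Tτ, q⟩` with `δ(σ, q) = (σ', q', d)` becomes
`⟨S, Tτσ', q'⟩` if `d` is left and `⟨Sσ'τ, T, q'⟩` if `d` is right. If one of the two strings is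
empty, then the missing symbol is the blank symbol `0`. -/
def Config.step {n : ℕ} (δ : Transition n) (c : Config n) : Config n :=
  let σ := c.S.getLastD 0
  let τ := c.T.getLastD 0
  match δ (σ, c.q) with
  | (σ', q', .left) => ⟨c.S.dropLast, c.T.dropLast ++ [τ, σ'], q'⟩
  | (σ', q', .right) => ⟨c.S.dropLast ++ [σ', τ], c.T.dropLast, q'⟩

/-- The encoding of a configuration `⟨S, T, q⟩` as a proof of `⊢ Tur A`: the tensor product of the
promotions of the proofs encoding `S`, `T` and `q`. -/
def configProof {n : ℕ} (A : Formula α) (c : Config n) : Proof [] (Tur n A) :=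
  tensR rfl
    (tensR rfl (prom [] rfl (bintProof A c.S)) (prom [] rfl (bintProof A c.T)))
    (prom [] rfl (nboolProof A n c.q))

/-- The proof `π` of `A ⊢ B` encodes, up to cut-elimination, one step of the machine with transition
function `δ`: cutting the encoding of any configuration on `A` against it gives the encoding of the
next configuration on `B`. -/
def EncodesStep {n : ℕ} (δ : Transition n) (A B : Formula α) (π : Proof [Tur n A] (Tur n B)) :
    Prop :=
  ∀ c : Config n, CutEquiv (cut [] [] rfl rfl (configProof A c) π) (configProof B (c.step δ))

end ILL

/-!
# One step of a Turing machine as a proof in linear logic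

Proofs of `Γ ⊢ C` are studied modulo equivalence under cut-elimination, in the quotient `Pf Γ C`, so
that the transformations of `CutEquiv` become equations. Write `E = A ⊸ A` and
`A³ = A & (A & A)`.

**Left rules are natural.** `CutEquiv` says how a left rule commutes with cuts, but not that left
rules acting on different parts of a context commute with each other. This follows because every
block `P` of a context may be replaced by a single formula, by a cut against some `P ⊢ Z`
(`exists_factor`). A `BlockMap` is an operation on proofs that changes a block of the context and
passes through cuts against the conclusion; all commutations are proved for block maps. They bring
the binary integers of the statement into the form `λ λ λ body A S`, where `body A S`, a proof of
`A, !E, !E ⊢ A`, satisfies a recursion over the digits of `S` (`mk_bintProof`, `body_one`,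
`body_zero`).

**Binary integers are words.** Proofs of `X, !H ⊢ X` are composed by contracting `!H` (`comp`), and
a binary sequence `S` spells a composite `word f S` of two such proofs `f 0`, `f 1`. Cutting the
promotions of `f 0` and `f 1` into `body X S` gives `word f S` (`iterate_body`). In the other
direction, for `H = E & E` and the proofs `letter A 1` and `letter A 0` that apply the first and the
second component of `H`, the cut of `!E, !E ⊢ !(E & E)` into `word (letter A) S` gives `body A S`
(`pairing_word`). Hence a concatenation of binary integers is obtained from the composite of their
words.

**Definable families.** A family of proofs is `Definable` from closed proofs `x i` of `⊢ B` if it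
arises from the promotions of the `x i` by cuts against one proof with the hypothesis `!B`. Such
families are closed under the rules used here, because a closed promotion is duplicated by
contraction and erased by weakening. Take for `x` the triple of the components of a configuration,
encoded on `A³`. The three components of `A³` serve as registers of an automaton that reads the
digits one after the other:

* registers `⟨F 0, F 1, F s⟩`, where `s` is the last digit read, select by the last digit of `S`
  (`Definable.last`), that is, by the scanned symbol, and for `T` by the symbol next to it;
* registers `⟨u, v, v⟩`, where `v` is the word read so far and `u` the word before the last digit,
  produce the word of `S` without its last digit (`Definable.dropLast`).

Selection by the state is projection from a tuple (`Definable.state`). The two strings of the next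
configuration are those of the given one without their last symbols, followed by a word that depends
on these two symbols and the state only, so that the next configuration is definable
(`definable_step`). A proof of `!B ⊢ Tur A` finally becomes a proof of `Tur A³ ⊢ Tur A` by cutting
it against a promotion `!P, !Q, !R ⊢ !B` (`Definable.exists_cut_tensR`). -/

namespace ILL

open Formula

variable {α : Type u}

/-! ### Proofs modulo cut-elimination -/

/-- Equivalence under cut-elimination as a setoid. -/
def cutSetoid (Γ : List (Formula α)) (C : Formula α) : Setoid (Proof Γ C) :=
  ⟨CutEquiv, ⟨CutEquiv.refl, CutEquiv.symm, CutEquiv.trans⟩⟩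

/-- Proofs of `Γ ⊢ C` modulo equivalence under cut-elimination. -/
def Pf (Γ : List (Formula α)) (C : Formula α) : Type u := Quotient (cutSetoid Γ C)

namespace Pf

/-- The class of a proof. -/
def mk {Γ : List (Formula α)} {C : Formula α} (π : Proof Γ C) : Pf Γ C := Quotient.mk _ π

@[elab_as_elim, induction_eliminator]
theorem ind {Γ : List (Formula α)} {C : Formula α} {P : Pf Γ C → Prop} (h : ∀ π, P (mk π))
    (x : Pf Γ C) : P x := Quotient.ind h x

theorem sound {Γ : List (Formula α)} {C : Formula α} {π ρ : Proof Γ C} (h : CutEquiv π ρ) :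
    mk π = mk ρ := Quotient.sound h

theorem exact {Γ : List (Formula α)} {C : Formula α} {π ρ : Proof Γ C} (h : mk π = mk ρ) :
    CutEquiv π ρ := Quotient.exact h

/-- `A ⊢ A` -/
def ax (A : Formula α) : Pf [A] A := mk (.ax A)

/-- The cut rule. As for the other rules, the side conditions on contexts are propositional
equations that are discharged automatically. -/
def cut {Γ Θ Ξ : List (Formula α)} {A B : Formula α} (Δ₁ Δ₂ : List (Formula α))
    (π : Pf Γ A) (ρ : Pf Θ B) (hp : Θ = Δ₁ ++ A :: Δ₂ := by first | rfl | simp)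
    (hc : Ξ = Δ₁ ++ Γ ++ Δ₂ := by first | rfl | simp) : Pf Ξ B :=
  Quotient.map₂ (Proof.cut Δ₁ Δ₂ hp hc) (fun _ _ h _ _ h' => .congr_cut Δ₁ Δ₂ hp hc h h') π ρ

/-- The rules acting on the left of the turnstile. -/
def left {P Q Θ Ξ : List (Formula α)} {C : Formula α} (Δ₁ Δ₂ : List (Formula α))
    (r : LeftRule P Q) (π : Pf Θ C) (hp : Θ = Δ₁ ++ P ++ Δ₂ := by first | rfl | simp)
    (hc : Ξ = Δ₁ ++ Q ++ Δ₂ := by first | rfl | simp) : Pf Ξ C :=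
  Quotient.map (Proof.left Δ₁ Δ₂ r hp hc) (fun _ _ h => .congr_left Δ₁ Δ₂ r hp hc h) π

/-- Right introduction of `⊗`. -/
def tensR {Γ Δ Ξ : List (Formula α)} {A B : Formula α} (π : Pf Γ A) (ρ : Pf Δ B)
    (hc : Ξ = Γ ++ Δ := by first | rfl | simp) : Pf Ξ (tens A B) :=
  Quotient.map₂ (Proof.tensR hc) (fun _ _ h _ _ h' => .congr_tensR hc h h') π ρ

/-- Right introduction of `&`. -/
def ampR {Γ : List (Formula α)} {A B : Formula α} (π : Pf Γ A) (ρ : Pf Γ B) : Pf Γ (amp A B) :=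
  Quotient.map₂ Proof.ampR (fun _ _ h _ _ h' => .congr_ampR h h') π ρ

/-- Right introduction of `⊸`. -/
def lolliR {Γ Θ : List (Formula α)} {A B : Formula α} (π : Pf Θ B)
    (hp : Θ = A :: Γ := by first | rfl | simp) : Pf Γ (lolli A B) :=
  Quotient.map (Proof.lolliR hp) (fun _ _ h => .congr_lolliR hp h) π

/-- Left introduction of `⊸`. -/
def lolliL {Γ Θ Ξ : List (Formula α)} {A B C : Formula α} (Δ₁ Δ₂ : List (Formula α))
    (π : Pf Γ A) (ρ : Pf Θ C) (hp : Θ = Δ₁ ++ B :: Δ₂ := by first | rfl | simp)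
    (hc : Ξ = Δ₁ ++ Γ ++ lolli A B :: Δ₂ := by first | rfl | simp) : Pf Ξ C :=
  Quotient.map₂ (Proof.lolliL Δ₁ Δ₂ hp hc) (fun _ _ h _ _ h' => .congr_lolliL Δ₁ Δ₂ hp hc h h') π ρ

/-- Promotion. -/
def prom {Θ : List (Formula α)} {A : Formula α} (Γ : List (Formula α)) (π : Pf Θ A)
    (hc : Θ = Γ.map bang := by first | rfl | simp) : Pf Θ (bang A) :=
  Quotient.map (Proof.prom Γ hc) (fun _ _ h => .congr_prom Γ hc h) π

/-! ### The cut-elimination rules as equations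

The contexts of all subproofs are variables subject to propositional equations, so that the rules
apply to contexts in any shape. The equations that a proof term carries as side conditions are
implicit; those that relate the contexts on the two sides of a rule are discharged by `simp`. -/

section Rules

variable {P Q Γ Γ' Δ Δ₁ Δ₂ Δ₃ Υ Υ₁ Υ₂ Υ' Υ'' Λ Λ' Λ₁ Λ₂ Λ₃ Λ₄ Θ Θ'
  Θ₁ Θ₂ Θ₃ Θ₄ Ξ : List (Formula α)}
  {A B C D : Formula α}

theorem ax_cut (ρ : Pf Θ B) {hp : Θ = Δ₁ ++ A :: Δ₂} {hc : Θ = Δ₁ ++ [A] ++ Δ₂} :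
    cut Δ₁ Δ₂ (ax A) ρ hp hc = ρ := by
  subst hp; induction ρ; exact sound (.ax_cut _)

theorem cut_ax (π : Pf Γ A) {hp : [A] = [] ++ A :: []} {hc : Γ = [] ++ Γ ++ []} :
    cut [] [] π (ax A) hp hc = π := by
  induction π; exact sound (.cut_ax _)

theorem eta_amp : ax (amp A B) = ampR (left [] [] (.amp₀ A B) (ax A))
    (left [] [] (.amp₁ A B) (ax B)) := sound (.eta_amp A B)

theorem cut_cut (π : Pf Γ A) (ρ : Pf Θ B) (σ : Pf Θ' C) {hp : Θ = Υ₁ ++ A :: Υ₂}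
    {hc : Θ₁ = Υ₁ ++ Γ ++ Υ₂} {hp' : Θ' = Δ₁ ++ B :: Δ₂} {hc' : Ξ = Δ₁ ++ Θ₁ ++ Δ₂}
    {hp₁ : Θ₂ = Λ₁ ++ A :: Λ₂} {hc₁ : Ξ = Λ₁ ++ Γ ++ Λ₂} {hc₂ : Θ₂ = Δ₁ ++ Θ ++ Δ₂}
    (h₁ : Λ₁ = Δ₁ ++ Υ₁ := by simp) (h₂ : Λ₂ = Υ₂ ++ Δ₂ := by simp) :
    cut Δ₁ Δ₂ (cut Υ₁ Υ₂ π ρ hp hc) σ hp' hc' = cut Λ₁ Λ₂ π (cut Δ₁ Δ₂ ρ σ hp' hc₂) hp₁ hc₁ := by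
  subst hp hc hp' hc' h₁ h₂ hc₂
  induction π; induction ρ; induction σ; exact sound (.cut_cut _ _ _)

theorem cut_cut_comm (π : Pf Γ A) (ρ : Pf Γ' B) (σ : Pf Θ C)
    {hp : Θ = Λ₁ ++ B :: Δ₃} {hc : Θ₁ = Λ₁ ++ Γ' ++ Δ₃}
    {hp' : Θ₁ = Δ₁ ++ A :: Λ₂} {hc' : Ξ = Δ₁ ++ Γ ++ Λ₂}
    {hq : Θ = Δ₁ ++ A :: Λ₃} {hd : Θ₂ = Δ₁ ++ Γ ++ Λ₃}
    {hq' : Θ₂ = Λ₄ ++ B :: Δ₃} {hd' : Ξ = Λ₄ ++ Γ' ++ Δ₃}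
    (Δ₂ : List (Formula α)) (h₁ : Λ₁ = Δ₁ ++ A :: Δ₂ := by simp)
    (h₂ : Λ₂ = Δ₂ ++ Γ' ++ Δ₃ := by simp)
    (h₃ : Λ₃ = Δ₂ ++ B :: Δ₃ := by simp) (h₄ : Λ₄ = Δ₁ ++ Γ ++ Δ₂ := by simp) :
    cut Δ₁ Λ₂ π (cut Λ₁ Δ₃ ρ σ hp hc) hp' hc' = cut Λ₄ Δ₃ ρ (cut Δ₁ Λ₃ π σ hq hd) hq' hd' := by
  subst h₁ h₂ h₃ h₄ hq hc hc' hd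
  induction π; induction ρ; induction σ; exact sound (.cut_cut_comm _ _ _)

theorem tens_tens (π : Pf Γ A) (ρ : Pf Γ' B) (σ : Pf Θ C)
    {ht : Υ = Γ ++ Γ'} {hp : Θ = Δ₁ ++ [A, B] ++ Δ₂} {hc : Θ₁ = Δ₁ ++ [tens A B] ++ Δ₂}
    {hp' : Θ₁ = Δ₁ ++ tens A B :: Δ₂} {hc' : Ξ = Δ₁ ++ Υ ++ Δ₂}
    {hq : Θ = Λ₁ ++ B :: Δ₂} {hd : Θ₂ = Λ₁ ++ Γ' ++ Δ₂} {hq' : Θ₂ = Δ₁ ++ A :: Λ₂}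
    {hd' : Ξ = Δ₁ ++ Γ ++ Λ₂}
    (h₁ : Λ₁ = Δ₁ ++ [A] := by simp) (h₂ : Λ₂ = Γ' ++ Δ₂ := by simp) :
    cut Δ₁ Δ₂ (tensR π ρ ht) (left Δ₁ Δ₂ (.tens A B) σ hp hc) hp' hc' =
      cut Δ₁ Λ₂ π (cut Λ₁ Δ₂ ρ σ hq hd) hq' hd' := by
  subst ht hp hc hc' h₁ h₂ hq'
  induction π; induction ρ; induction σ; exact sound (.tens_tens _ _ _)

theorem amp_amp₀ (π : Pf Γ A) (ρ : Pf Γ B) (σ : Pf Θ C)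
    {hp : Θ = Δ₁ ++ [A] ++ Δ₂} {hc : Θ₁ = Δ₁ ++ [amp A B] ++ Δ₂}
    {hp' : Θ₁ = Δ₁ ++ amp A B :: Δ₂} {hc' : Ξ = Δ₁ ++ Γ ++ Δ₂} {hq : Θ = Δ₁ ++ A :: Δ₂} :
    cut Δ₁ Δ₂ (ampR π ρ) (left Δ₁ Δ₂ (.amp₀ A B) σ hp hc) hp' hc' = cut Δ₁ Δ₂ π σ hq hc' := by
  subst hp hc hc'
  induction π; induction ρ; induction σ; exact sound (.amp_amp₀ _ _ _)

theorem amp_amp₁ (π : Pf Γ A) (ρ : Pf Γ B) (σ : Pf Θ C)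
    {hp : Θ = Δ₁ ++ [B] ++ Δ₂} {hc : Θ₁ = Δ₁ ++ [amp A B] ++ Δ₂}
    {hp' : Θ₁ = Δ₁ ++ amp A B :: Δ₂} {hc' : Ξ = Δ₁ ++ Γ ++ Δ₂} {hq : Θ = Δ₁ ++ B :: Δ₂} :
    cut Δ₁ Δ₂ (ampR π ρ) (left Δ₁ Δ₂ (.amp₁ A B) σ hp hc) hp' hc' = cut Δ₁ Δ₂ ρ σ hq hc' := by
  subst hp hc hc'
  induction π; induction ρ; induction σ; exact sound (.amp_amp₁ _ _ _)

theorem lolli_lolli (π : Pf Θ B) (ρ : Pf Δ A) (σ : Pf Θ' C)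
    {hp : Θ = A :: Γ} {hp' : Θ' = Δ₁ ++ B :: Δ₂} {hc : Θ₁ = Δ₁ ++ Δ ++ lolli A B :: Δ₂}
    {hq : Θ₁ = Λ₁ ++ lolli A B :: Δ₂} {hd : Ξ = Λ₁ ++ Γ ++ Δ₂}
    {he : Θ = [] ++ A :: Γ} {hf : Θ₂ = [] ++ Δ ++ Γ} {hg : Ξ = Δ₁ ++ Θ₂ ++ Δ₂}
    (h₁ : Λ₁ = Δ₁ ++ Δ := by simp) :
    cut Λ₁ Δ₂ (lolliR π hp) (lolliL Δ₁ Δ₂ ρ σ hp' hc) hq hd =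
      cut Δ₁ Δ₂ (cut [] Γ ρ π he hf) σ hp' hg := by
  subst hp hp' hc h₁ hd hf
  induction π; induction ρ; induction σ; exact sound (.lolli_lolli _ _ _)

theorem prom_der (π : Pf Υ A) (σ : Pf Θ C) {hΥ : Υ = Γ.map bang}
    {hp : Θ = Δ₁ ++ [A] ++ Δ₂} {hc : Θ₁ = Δ₁ ++ [bang A] ++ Δ₂}
    {hp' : Θ₁ = Δ₁ ++ bang A :: Δ₂} {hc' : Ξ = Δ₁ ++ Υ ++ Δ₂} {hq : Θ = Δ₁ ++ A :: Δ₂} :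
    cut Δ₁ Δ₂ (prom Γ π hΥ) (left Δ₁ Δ₂ (.der A) σ hp hc) hp' hc' = cut Δ₁ Δ₂ π σ hq hc' := by
  subst hΥ hp hc hc'
  induction π; induction σ; exact sound (.prom_der _ _)

theorem prom_prom (π : Pf Υ A) (σ : Pf Θ B) {hΥ : Υ = Γ.map bang}
    {hσ : Θ = Λ.map bang} {hp : Θ = Λ₁ ++ bang A :: Λ₂} {hc : Ξ = Λ₁ ++ Υ ++ Λ₂}
    {hq : Ξ = Λ'.map bang}
    (Δ₁ Δ₂ : List (Formula α)) (h : Λ = Δ₁ ++ A :: Δ₂ := by simp)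
    (h' : Λ' = Δ₁ ++ Γ ++ Δ₂ := by simp) (h₁ : Λ₁ = Δ₁.map bang := by simp)
    (h₂ : Λ₂ = Δ₂.map bang := by simp) :
    cut Λ₁ Λ₂ (prom Γ π hΥ) (prom Λ σ hσ) hp hc = prom Λ' (cut Λ₁ Λ₂ (prom Γ π hΥ) σ hp hc) hq := by
  subst hΥ h h' h₁ h₂ hp hc
  induction π; induction σ; exact sound (.prom_prom _ _)

/-- A closed promotion cut against a weakening is erased. -/
theorem prom_wk_nil (π : Pf [] A) (σ : Pf Θ C) {hΥ : [] = ([] : List (Formula α)).map bang}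
    {hp : Θ = Δ₁ ++ [] ++ Δ₂} {hc : Θ₁ = Δ₁ ++ [bang A] ++ Δ₂}
    {hp' : Θ₁ = Δ₁ ++ bang A :: Δ₂} {hc' : Θ = Δ₁ ++ [] ++ Δ₂} :
    cut Δ₁ Δ₂ (prom [] π hΥ) (left Δ₁ Δ₂ (.wk A) σ hp hc) hp' hc' = σ := by
  subst hp hc
  induction π; induction σ; exact sound (.prom_wk (Γ := []) _ _)

/-- A promotion over one formula cut against a weakening becomes a weakening of its hypothesis. -/
theorem prom_wk_singleton {H : Formula α} (π : Pf [bang H] A) (σ : Pf Θ C)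
    {hΥ : [bang H] = ([H] : List (Formula α)).map bang}
    {hp : Θ = Δ₁ ++ [] ++ Δ₂} {hc : Θ₁ = Δ₁ ++ [bang A] ++ Δ₂}
    {hp' : Θ₁ = Δ₁ ++ bang A :: Δ₂} {hc' : Ξ = Δ₁ ++ [bang H] ++ Δ₂} :
    cut Δ₁ Δ₂ (prom [H] π hΥ) (left Δ₁ Δ₂ (.wk A) σ hp hc) hp' hc' =
      left Δ₁ Δ₂ (.wk H) σ hp hc' := by
  subst hp hc hc'
  induction π; induction σ; exact sound (.prom_wk (Γ := [H]) _ _)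

/-- A promotion over two formulas cut against a weakening becomes weakenings of its hypotheses. -/
theorem prom_wk_pair {H K : Formula α} (π : Pf [bang H, bang K] A) (σ : Pf Θ C)
    {hΥ : [bang H, bang K] = ([H, K] : List (Formula α)).map bang}
    {hp : Θ = Δ₁ ++ [] ++ Δ₂} {hc : Θ₁ = Δ₁ ++ [bang A] ++ Δ₂}
    {hp' : Θ₁ = Δ₁ ++ bang A :: Δ₂} {hc' : Ξ = Δ₁ ++ [bang H, bang K] ++ Δ₂} :
    cut Δ₁ Δ₂ (prom [H, K] π hΥ) (left Δ₁ Δ₂ (.wk A) σ hp hc) hp' hc' =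
      left Δ₁ (bang K :: Δ₂) (.wk H) (left Δ₁ Δ₂ (.wk K) σ hp rfl) (by simp) (by simp [hc']) := by
  subst hp hc hc'
  induction π; induction σ; exact sound (.prom_wk (Γ := [H, K]) _ _)

theorem left_cut (r : LeftRule P Q) (π : Pf Θ A) (σ : Pf Θ' C)
    {hp : Θ = Υ₁ ++ P ++ Υ₂} {hc : Θ₁ = Υ₁ ++ Q ++ Υ₂} {hp' : Θ' = Δ₁ ++ A :: Δ₂}
    {hc' : Ξ = Δ₁ ++ Θ₁ ++ Δ₂} {hd : Θ₂ = Δ₁ ++ Θ ++ Δ₂} {hq : Θ₂ = Λ₁ ++ P ++ Λ₂}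
    {hd' : Ξ = Λ₁ ++ Q ++ Λ₂} (h₁ : Λ₁ = Δ₁ ++ Υ₁ := by simp) (h₂ : Λ₂ = Υ₂ ++ Δ₂ := by simp) :
    cut Δ₁ Δ₂ (left Υ₁ Υ₂ r π hp hc) σ hp' hc' =
      left Λ₁ Λ₂ r (cut Δ₁ Δ₂ π σ hp' hd) hq hd' := by
  subst hp hc hp' hc' h₁ h₂ hd
  induction π; induction σ; exact sound (.left_cut _ _ _)

theorem lolliL_cut (π : Pf Γ A) (ρ : Pf Θ C) (σ : Pf Θ' D)
    {hp : Θ = Υ₁ ++ B :: Υ₂} {hc : Θ₁ = Υ₁ ++ Γ ++ lolli A B :: Υ₂} {hp' : Θ' = Δ₁ ++ C :: Δ₂}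
    {hc' : Ξ = Δ₁ ++ Θ₁ ++ Δ₂} {hd : Θ₂ = Δ₁ ++ Θ ++ Δ₂} {hq : Θ₂ = Λ₁ ++ B :: Λ₂}
    {hd' : Ξ = Λ₁ ++ Γ ++ lolli A B :: Λ₂}
    (h₁ : Λ₁ = Δ₁ ++ Υ₁ := by simp) (h₂ : Λ₂ = Υ₂ ++ Δ₂ := by simp) :
    cut Δ₁ Δ₂ (lolliL Υ₁ Υ₂ π ρ hp hc) σ hp' hc' =
      lolliL Λ₁ Λ₂ π (cut Δ₁ Δ₂ ρ σ hp' hd) hq hd' := by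
  subst hp hc hp' hc' h₁ h₂ hd
  induction π; induction ρ; induction σ; exact sound (.lolliL_cut _ _ _)

/-- The cut formula belongs to the first block of the premise of the exchange. -/
theorem cut_exch₁ (π : Pf Γ A) (σ : Pf Θ C) (Υ₁ Υ₂ : List (Formula α))
    {hp : Θ = Δ₁ ++ (Υ' ++ Υ) ++ Δ₂} {hc : Θ₁ = Δ₁ ++ (Υ ++ Υ') ++ Δ₂}
    {hp' : Θ₁ = Λ₁ ++ A :: Λ₂} {hc' : Ξ = Λ₁ ++ Γ ++ Λ₂}
    {hq : Θ = Λ₃ ++ A :: Λ₄} {hd : Θ₂ = Λ₃ ++ Γ ++ Λ₄}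
    {hq' : Θ₂ = Δ₁ ++ (Υ'' ++ Υ) ++ Δ₂} {hd' : Ξ = Δ₁ ++ (Υ ++ Υ'') ++ Δ₂}
    (h₁ : Υ' = Υ₁ ++ A :: Υ₂ := by simp) (h₂ : Υ'' = Υ₁ ++ Γ ++ Υ₂ := by simp)
    (h₃ : Λ₁ = Δ₁ ++ Υ ++ Υ₁ := by simp) (h₄ : Λ₂ = Υ₂ ++ Δ₂ := by simp)
    (h₅ : Λ₃ = Δ₁ ++ Υ₁ := by simp) (h₆ : Λ₄ = Υ₂ ++ Υ ++ Δ₂ := by simp) :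
    cut Λ₁ Λ₂ π (left Δ₁ Δ₂ (.exch Υ' Υ) σ hp hc) hp' hc' =
      left Δ₁ Δ₂ (.exch Υ'' Υ) (cut Λ₃ Λ₄ π σ hq hd) hq' hd' := by
  subst h₁ h₂ h₃ h₄ h₅ h₆ hp hc hc' hq'
  induction π; induction σ; exact sound (.cut_exch₁ _ _)

/-- The cut formula belongs to the second block of the premise of the exchange. -/
theorem cut_exch₂ (π : Pf Γ A) (σ : Pf Θ C) (Υ₁ Υ₂ : List (Formula α))
    {hp : Θ = Δ₁ ++ (Υ ++ Υ') ++ Δ₂} {hc : Θ₁ = Δ₁ ++ (Υ' ++ Υ) ++ Δ₂}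
    {hp' : Θ₁ = Λ₁ ++ A :: Λ₂} {hc' : Ξ = Λ₁ ++ Γ ++ Λ₂}
    {hq : Θ = Λ₃ ++ A :: Λ₄} {hd : Θ₂ = Λ₃ ++ Γ ++ Λ₄}
    {hq' : Θ₂ = Δ₁ ++ (Υ ++ Υ'') ++ Δ₂} {hd' : Ξ = Δ₁ ++ (Υ'' ++ Υ) ++ Δ₂}
    (h₁ : Υ' = Υ₁ ++ A :: Υ₂ := by simp) (h₂ : Υ'' = Υ₁ ++ Γ ++ Υ₂ := by simp)
    (h₃ : Λ₁ = Δ₁ ++ Υ₁ := by simp) (h₄ : Λ₂ = Υ₂ ++ Υ ++ Δ₂ := by simp)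
    (h₅ : Λ₃ = Δ₁ ++ Υ ++ Υ₁ := by simp) (h₆ : Λ₄ = Υ₂ ++ Δ₂ := by simp) :
    cut Λ₁ Λ₂ π (left Δ₁ Δ₂ (.exch Υ Υ') σ hp hc) hp' hc' =
      left Δ₁ Δ₂ (.exch Υ Υ'') (cut Λ₃ Λ₄ π σ hq hd) hq' hd' := by
  subst h₁ h₂ h₃ h₄ h₅ h₆ hp hc hc' hq'
  induction π; induction σ; exact sound (.cut_exch₂ _ _)

/-- The rule acts to the right of the cut formula. -/
theorem cut_left₁ (r : LeftRule P Q) (π : Pf Γ A) (σ : Pf Θ C) (Δ₂ : List (Formula α))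
    {hp : Θ = Λ₁ ++ P ++ Δ₃} {hc : Θ₁ = Λ₁ ++ Q ++ Δ₃} {hp' : Θ₁ = Δ₁ ++ A :: Λ₂}
    {hc' : Ξ = Δ₁ ++ Γ ++ Λ₂} {hq : Θ = Δ₁ ++ A :: Λ₃} {hd : Θ₂ = Δ₁ ++ Γ ++ Λ₃}
    {hq' : Θ₂ = Λ₄ ++ P ++ Δ₃} {hd' : Ξ = Λ₄ ++ Q ++ Δ₃}
    (h₁ : Λ₁ = Δ₁ ++ A :: Δ₂ := by simp) (h₂ : Λ₂ = Δ₂ ++ Q ++ Δ₃ := by simp)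
    (h₃ : Λ₃ = Δ₂ ++ P ++ Δ₃ := by simp) (h₄ : Λ₄ = Δ₁ ++ Γ ++ Δ₂ := by simp) :
    cut Δ₁ Λ₂ π (left Λ₁ Δ₃ r σ hp hc) hp' hc' =
      left Λ₄ Δ₃ r (cut Δ₁ Λ₃ π σ hq hd) hq' hd' := by
  subst h₁ h₂ h₃ h₄ hp hc hc' hq'
  induction π; induction σ; exact sound (.cut_left₁ _ _ _)

/-- The rule acts to the left of the cut formula. -/
theorem cut_left₂ (r : LeftRule P Q) (π : Pf Γ A) (σ : Pf Θ C) (Δ₂ : List (Formula α))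
    {hp : Θ = Δ₁ ++ P ++ Λ₁} {hc : Θ₁ = Δ₁ ++ Q ++ Λ₁} {hp' : Θ₁ = Λ₂ ++ A :: Δ₃}
    {hc' : Ξ = Λ₂ ++ Γ ++ Δ₃} {hq : Θ = Λ₃ ++ A :: Δ₃} {hd : Θ₂ = Λ₃ ++ Γ ++ Δ₃}
    {hq' : Θ₂ = Δ₁ ++ P ++ Λ₄} {hd' : Ξ = Δ₁ ++ Q ++ Λ₄}
    (h₁ : Λ₁ = Δ₂ ++ A :: Δ₃ := by simp) (h₂ : Λ₂ = Δ₁ ++ Q ++ Δ₂ := by simp)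
    (h₃ : Λ₃ = Δ₁ ++ P ++ Δ₂ := by simp) (h₄ : Λ₄ = Δ₂ ++ Γ ++ Δ₃ := by simp) :
    cut Λ₂ Δ₃ π (left Δ₁ Λ₁ r σ hp hc) hp' hc' =
      left Δ₁ Λ₄ r (cut Λ₃ Δ₃ π σ hq hd) hq' hd' := by
  subst h₁ h₂ h₃ h₄ hp hc hc' hq'
  induction π; induction σ; exact sound (.cut_left₂ _ _ _)

theorem cut_tensR₁ (π : Pf Γ A) (ρ : Pf Θ B) (σ : Pf Υ C)
    {ht : Θ₁ = Θ ++ Υ} {hp : Θ₁ = Δ₁ ++ A :: Λ} {hc : Ξ = Δ₁ ++ Γ ++ Λ}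
    {hq : Θ = Δ₁ ++ A :: Δ₂} {hd : Θ₂ = Δ₁ ++ Γ ++ Δ₂} {ht' : Ξ = Θ₂ ++ Υ}
    (h : Λ = Δ₂ ++ Υ := by simp) :
    cut Δ₁ Λ π (tensR ρ σ ht) hp hc = tensR (cut Δ₁ Δ₂ π ρ hq hd) σ ht' := by
  subst h ht hq hd hc
  induction π; induction ρ; induction σ; exact sound (.cut_tensR₁ _ _ _)

theorem cut_tensR₂ (π : Pf Γ A) (ρ : Pf Υ B) (σ : Pf Θ C)
    {ht : Θ₁ = Υ ++ Θ} {hp : Θ₁ = Λ ++ A :: Δ₂} {hc : Ξ = Λ ++ Γ ++ Δ₂}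
    {hq : Θ = Δ₁ ++ A :: Δ₂} {hd : Θ₂ = Δ₁ ++ Γ ++ Δ₂} {ht' : Ξ = Υ ++ Θ₂}
    (h : Λ = Υ ++ Δ₁ := by simp) :
    cut Λ Δ₂ π (tensR ρ σ ht) hp hc = tensR ρ (cut Δ₁ Δ₂ π σ hq hd) ht' := by
  subst h ht hq hd hc
  induction π; induction ρ; induction σ; exact sound (.cut_tensR₂ _ _ _)

theorem cut_ampR (π : Pf Γ A) (ρ : Pf Θ B) (σ : Pf Θ C) {hp : Θ = Δ₁ ++ A :: Δ₂}
    {hc : Ξ = Δ₁ ++ Γ ++ Δ₂} :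
    cut Δ₁ Δ₂ π (ampR ρ σ) hp hc = ampR (cut Δ₁ Δ₂ π ρ hp hc) (cut Δ₁ Δ₂ π σ hp hc) := by
  subst hp hc
  induction π; induction ρ; induction σ; exact sound (.cut_ampR _ _ _)

theorem cut_lolliR (π : Pf Γ A) (σ : Pf Θ C) {hl : Θ = B :: Θ₁} {hp : Θ₁ = Δ₁ ++ A :: Δ₂}
    {hc : Ξ = Δ₁ ++ Γ ++ Δ₂} {hq : Θ = (B :: Δ₁) ++ A :: Δ₂} {hd : Θ₂ = (B :: Δ₁) ++ Γ ++ Δ₂}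
    {hl' : Θ₂ = B :: Ξ} :
    cut Δ₁ Δ₂ π (lolliR σ hl) hp hc = lolliR (cut (B :: Δ₁) Δ₂ π σ hq hd) hl' := by
  subst hp hc hl hl'
  induction π; induction σ; exact sound (.cut_lolliR _ _)

theorem exch_nil (π : Pf Θ C) {hp : Θ = Δ₁ ++ (Γ ++ []) ++ Δ₂} {hc : Θ = Δ₁ ++ ([] ++ Γ) ++ Δ₂} :
    left Δ₁ Δ₂ (.exch Γ []) π hp hc = π := by
  have h : Θ = Δ₁ ++ Γ ++ Δ₂ := by simpa using hp
  subst h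
  induction π; exact sound (.exch_nil _)

theorem exch_exch (π : Pf Θ C) {hp : Θ = Δ₁ ++ (Γ ++ Γ') ++ Δ₂} {hc : Θ₁ = Δ₁ ++ (Γ' ++ Γ) ++ Δ₂}
    {hp' : Θ₁ = Δ₁ ++ (Γ' ++ Γ) ++ Δ₂} {hc' : Θ = Δ₁ ++ (Γ ++ Γ') ++ Δ₂} :
    left Δ₁ Δ₂ (.exch Γ' Γ) (left Δ₁ Δ₂ (.exch Γ Γ') π hp hc) hp' hc' = π := by
  subst hp hc
  induction π; exact sound (.exch_exch _)

theorem nil_exch (π : Pf Θ C) {hp : Θ = Δ₁ ++ ([] ++ Γ) ++ Δ₂} {hc : Θ = Δ₁ ++ (Γ ++ []) ++ Δ₂} :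
    left Δ₁ Δ₂ (.exch [] Γ) π hp hc = π :=
  (exch_nil (hp := hc) (hc := hp) _).symm.trans (exch_exch (hc := hc) (hp' := hc) (hc' := hp) π)

theorem left_nil_exch (r : LeftRule P Q) (π : Pf Θ C)
    {hp : Θ = Λ₁ ++ ([] ++ Γ) ++ Λ₂} {hc : Θ₁ = Λ₁ ++ (Γ ++ []) ++ Λ₂}
    {hp' : Θ₁ = Δ₁ ++ P ++ Δ₂} {hc' : Ξ = Δ₁ ++ Q ++ Δ₂} {hq : Θ = Δ₁ ++ P ++ Δ₂} :
    left Δ₁ Δ₂ r (left Λ₁ Λ₂ (.exch [] Γ) π hp hc) hp' hc' = left Δ₁ Δ₂ r π hq hc' := by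
  obtain rfl : Θ = Θ₁ := by simp [hp, hc]
  rw [nil_exch]

theorem ctr_exch (π : Pf Θ C) {hp : Θ = Δ₁ ++ ([bang A] ++ [bang A]) ++ Δ₂}
    {hc : Θ₁ = Δ₁ ++ ([bang A] ++ [bang A]) ++ Δ₂} {hp₁ : Θ₁ = Δ₁ ++ [bang A, bang A] ++ Δ₂}
    {hc₁ : Ξ = Δ₁ ++ [bang A] ++ Δ₂} {hq : Θ = Δ₁ ++ [bang A, bang A] ++ Δ₂} :
    left Δ₁ Δ₂ (.ctr A) (left Δ₁ Δ₂ (.exch [bang A] [bang A]) π hp hc) hp₁ hc₁ =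
      left Δ₁ Δ₂ (.ctr A) π hq hc₁ := by
  subst hp hc hc₁
  induction π; exact sound (.ctr_exch _)

theorem ctr_ctr (π : Pf Θ C) {hp : Θ = Δ₁ ++ [bang A, bang A] ++ Λ₂}
    {hc : Θ₁ = Δ₁ ++ [bang A] ++ Λ₂} {hp₁ : Θ₁ = Δ₁ ++ [bang A, bang A] ++ Δ₂}
    {hc₁ : Ξ = Δ₁ ++ [bang A] ++ Δ₂} {hq : Θ = Λ₁ ++ [bang A, bang A] ++ Δ₂}
    {hd : Θ₂ = Λ₁ ++ [bang A] ++ Δ₂} {hq₁ : Θ₂ = Δ₁ ++ [bang A, bang A] ++ Δ₂}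
    (h₁ : Λ₁ = Δ₁ ++ [bang A] := by simp) (h₂ : Λ₂ = bang A :: Δ₂ := by simp) :
    left Δ₁ Δ₂ (.ctr A) (left Δ₁ Λ₂ (.ctr A) π hp hc) hp₁ hc₁ =
      left Δ₁ Δ₂ (.ctr A) (left Λ₁ Δ₂ (.ctr A) π hq hd) hq₁ hc₁ := by
  subst hp₁ hq₁ hc₁ h₁ h₂
  have h : Θ = Δ₁ ++ [bang A, bang A, bang A] ++ Δ₂ := by simp [hp]
  subst h
  induction π; exact sound (.ctr_ctr _)

theorem ctr_wk (π : Pf Θ C) {hp : Θ = Δ₁ ++ [] ++ Λ₂} {hc : Θ₁ = Δ₁ ++ [bang A] ++ Λ₂}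
    {hp₁ : Θ₁ = Δ₁ ++ [bang A, bang A] ++ Δ₂} {hc₁ : Θ = Δ₁ ++ [bang A] ++ Δ₂}
    (h : Λ₂ = bang A :: Δ₂ := by simp) :
    left Δ₁ Δ₂ (.ctr A) (left Δ₁ Λ₂ (.wk A) π hp hc) hp₁ hc₁ = π := by
  subst hp₁ hc₁ h
  induction π; exact sound (.ctr_wk _)

/-- Transport along an equality of contexts. -/
def castCtx (h : Θ = Ξ) (π : Pf Θ C) : Pf Ξ C := h ▸ π

theorem mk_castCtx (h : Θ = Ξ) (π : Proof Θ C) : mk (Proof.castCtx h π) = castCtx h (mk π) := by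
  subst h; rfl

theorem castCtx_left (h : Ξ = Θ') {r : LeftRule P Q} (π : Pf Θ C) {hp : Θ = Δ₁ ++ P ++ Δ₂}
    {hc : Ξ = Δ₁ ++ Q ++ Δ₂} {hc' : Θ' = Δ₁ ++ Q ++ Δ₂} :
    castCtx h (left Δ₁ Δ₂ r π hp hc) = left Δ₁ Δ₂ r π hp hc' := by
  subst h; rfl

/-- Iterated contraction, see `Proof.ctrs`. -/
def ctrs : (Γ Δ₁ Δ₂ : List (Formula α)) → {Θ Ξ : List (Formula α)} →
    (hp : Θ = Δ₁ ++ (Γ.map bang ++ Γ.map bang) ++ Δ₂) → (hc : Ξ = Δ₁ ++ Γ.map bang ++ Δ₂) →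
    Pf Θ C → Pf Ξ C
  | [], _, _, _, _, hp, hc, π => castCtx (by simp [hp, hc]) π
  | A :: Γ, Δ₁, Δ₂, _, _, hp, hc, π =>
      ctrs Γ (Δ₁ ++ [bang A]) Δ₂ rfl (by simp [hc])
        (left Δ₁ (Γ.map bang ++ Γ.map bang ++ Δ₂) (.ctr A)
          (left (Δ₁ ++ [bang A]) (Γ.map bang ++ Δ₂) (.exch (Γ.map bang) [bang A]) π
            (by simp [hp]) (by simp)) rfl (by simp))

theorem mk_ctrs (Γ : List (Formula α)) : ∀ (Δ₁ Δ₂ : List (Formula α)) {Θ Ξ : List (Formula α)}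
    (hp : Θ = Δ₁ ++ (Γ.map bang ++ Γ.map bang) ++ Δ₂) (hc : Ξ = Δ₁ ++ Γ.map bang ++ Δ₂)
    (π : Proof Θ C), mk (Proof.ctrs Γ Δ₁ Δ₂ hp hc π) = ctrs Γ Δ₁ Δ₂ hp hc (mk π) := by
  induction Γ with
  | nil => intros; exact mk_castCtx _ _
  | cons A Γ ih => intros; rw [Proof.ctrs, ctrs]; refine (ih _ _ _ _ _).trans ?_; rfl

theorem prom_ctr (π : Pf Υ A) (σ : Pf Θ C) {hΥ : Υ = Γ.map bang}
    {hp : Θ = Δ₁ ++ [bang A, bang A] ++ Δ₂} {hc : Θ₁ = Δ₁ ++ [bang A] ++ Δ₂}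
    {hp' : Θ₁ = Δ₁ ++ bang A :: Δ₂} {hc' : Ξ = Δ₁ ++ Υ ++ Δ₂}
    {hq : Θ = Δ₁ ++ bang A :: Λ₂} {hd : Θ₂ = Δ₁ ++ Υ ++ Λ₂} {hq' : Θ₂ = Λ₁ ++ bang A :: Δ₂}
    {hd' : Θ₃ = Λ₁ ++ Υ ++ Δ₂} {hr : Θ₃ = Δ₁ ++ (Γ.map bang ++ Γ.map bang) ++ Δ₂}
    {hs : Ξ = Δ₁ ++ Γ.map bang ++ Δ₂}
    (h₁ : Λ₁ = Δ₁ ++ Υ := by simp) (h₂ : Λ₂ = bang A :: Δ₂ := by simp) :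
    cut Δ₁ Δ₂ (prom Γ π hΥ) (left Δ₁ Δ₂ (.ctr A) σ hp hc) hp' hc' =
      ctrs Γ Δ₁ Δ₂ hr hs
        (cut Λ₁ Δ₂ (prom Γ π hΥ) (cut Δ₁ Λ₂ (prom Γ π hΥ) σ hq hd) hq' hd') := by
  subst hΥ hp hc hc' h₁ h₂ hq' hd'
  induction π; induction σ
  exact (sound (.prom_ctr _ _)).trans (mk_ctrs _ _ _ _ _ _)

theorem castCtx_cut (h : Ξ = Θ') (π : Pf Γ A) (σ : Pf Θ C) {hp : Θ = Δ₁ ++ A :: Δ₂}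
    {hc : Ξ = Δ₁ ++ Γ ++ Δ₂} {hp' : Θ = Λ₁ ++ A :: Δ₂} {hc' : Θ' = Λ₁ ++ Γ ++ Δ₂}
    (h₁ : Λ₁ = Δ₁) :
    castCtx h (cut Δ₁ Δ₂ π σ hp hc) = cut Λ₁ Δ₂ π σ hp' hc' := by
  subst h h₁; rfl

/-- A closed promotion cut against a contraction is duplicated. -/
theorem prom_ctr_nil (π : Pf [] A) (σ : Pf Θ C) {hΥ : [] = ([] : List (Formula α)).map bang}
    {hp : Θ = Δ₁ ++ [bang A, bang A] ++ Δ₂} {hc : Θ₁ = Δ₁ ++ [bang A] ++ Δ₂}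
    {hp' : Θ₁ = Δ₁ ++ bang A :: Δ₂} {hc' : Ξ = Δ₁ ++ [] ++ Δ₂}
    {hq : Θ = Δ₁ ++ bang A :: Λ₂} {hd : Θ₂ = Δ₁ ++ [] ++ Λ₂} {hq' : Θ₂ = Δ₁ ++ bang A :: Δ₂}
    (h₂ : Λ₂ = bang A :: Δ₂ := by simp) :
    cut Δ₁ Δ₂ (prom [] π hΥ) (left Δ₁ Δ₂ (.ctr A) σ hp hc) hp' hc' =
      cut Δ₁ Δ₂ (prom [] π hΥ) (cut Δ₁ Λ₂ (prom [] π hΥ) σ hq hd) hq' hc' :=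
  (prom_ctr (Γ := []) (Λ₁ := Δ₁ ++ []) (hq := hq) (hd := hd) (hq' := by simpa using hq')
    (hd' := rfl) (hr := by simp) (hs := hc') π σ rfl h₂).trans
    (castCtx_cut _ _ _ (by simp))

/-- A promotion over one formula cut against a contraction is duplicated, and its hypotheses are
contracted. -/
theorem prom_ctr_singleton {H : Formula α} (π : Pf [bang H] A) (σ : Pf Θ C)
    {hΥ : [bang H] = ([H] : List (Formula α)).map bang}
    {hp : Θ = Δ₁ ++ [bang A, bang A] ++ Δ₂} {hc : Θ₁ = Δ₁ ++ [bang A] ++ Δ₂}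
    {hp' : Θ₁ = Δ₁ ++ bang A :: Δ₂} {hc' : Ξ = Δ₁ ++ [bang H] ++ Δ₂}
    {hq : Θ = Δ₁ ++ bang A :: Λ₂} {hd : Θ₂ = Δ₁ ++ [bang H] ++ Λ₂}
    {hq' : Θ₂ = Λ₁ ++ bang A :: Δ₂} {hd' : Θ₃ = Λ₁ ++ [bang H] ++ Δ₂}
    {hr : Θ₃ = Δ₁ ++ [bang H, bang H] ++ Δ₂}
    (h₁ : Λ₁ = Δ₁ ++ [bang H] := by simp) (h₂ : Λ₂ = bang A :: Δ₂ := by simp) :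
    cut Δ₁ Δ₂ (prom [H] π hΥ) (left Δ₁ Δ₂ (.ctr A) σ hp hc) hp' hc' =
      left Δ₁ Δ₂ (.ctr H)
        (cut Λ₁ Δ₂ (prom [H] π hΥ) (cut Δ₁ Λ₂ (prom [H] π hΥ) σ hq hd) hq' hd') hr hc' := by
  -- the exchange in `ctrs` moves the single hypothesis past an empty block
  refine (prom_ctr (Γ := [H]) (hq := hq) (hd := hd) (hq' := hq') (hd' := hd') (hr := hr)
    (hs := hc') π σ h₁ h₂).trans ((castCtx_left (hc' := hc') _ _).trans ?_)
  exact left_nil_exch _ _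

/-- A promotion over two formulas cut against a contraction is duplicated, and its hypotheses are
contracted. -/
theorem prom_ctr_pair {H K : Formula α} (π : Pf [bang H, bang K] A) (σ : Pf Θ C)
    {hΥ : [bang H, bang K] = ([H, K] : List (Formula α)).map bang}
    {hp : Θ = Δ₁ ++ [bang A, bang A] ++ Δ₂} {hc : Θ₁ = Δ₁ ++ [bang A] ++ Δ₂}
    {hp' : Θ₁ = Δ₁ ++ bang A :: Δ₂} {hc' : Ξ = Δ₁ ++ [bang H, bang K] ++ Δ₂}
    {hq : Θ = Δ₁ ++ bang A :: Λ₂} {hd : Θ₂ = Δ₁ ++ [bang H, bang K] ++ Λ₂}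
    {hq' : Θ₂ = Λ₁ ++ bang A :: Δ₂} {hd' : Θ₃ = Λ₁ ++ [bang H, bang K] ++ Δ₂}
    (h₁ : Λ₁ = Δ₁ ++ [bang H, bang K] := by simp) (h₂ : Λ₂ = bang A :: Δ₂ := by simp) :
    cut Δ₁ Δ₂ (prom [H, K] π hΥ) (left Δ₁ Δ₂ (.ctr A) σ hp hc) hp' hc' =
      left (Δ₁ ++ [bang H]) Δ₂ (.ctr K)
        (left Δ₁ ([bang K, bang K] ++ Δ₂) (.ctr H)
          (left (Δ₁ ++ [bang H]) (bang K :: Δ₂) (.exch [bang K] [bang H])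
            (cut Λ₁ Δ₂ (prom [H, K] π hΥ) (cut Δ₁ Λ₂ (prom [H, K] π hΥ) σ hq hd) hq' hd')
            (by simp [hd', h₁]) (by simp)) rfl (by simp)) rfl (by simp [hc']) := by
  refine (prom_ctr (Γ := [H, K]) (hq := hq) (hd := hd) (hq' := hq') (hd' := hd')
    (hr := by simp [hd', h₁]) (hs := hc') π σ h₁ h₂).trans ((castCtx_left (hc' := ?_) _ _).trans ?_)
  · simp [hc']
  · exact left_nil_exch _ _

end Rules

/-! ### Commutation of left rules -/

section Commute

variable {P Q R P' Q' Γ Δ₁ Δ₂ Δ₃ Υ Υ' Υ'' Λ₁ Λ₂ Λ₃ Λ₄ Θ Θ₁ Θ₂ Ξ : List (Formula α)}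
  {A B C : Formula α}

/-- Every block `P` of a context can be replaced by a single formula `Z` with `P ⊢ Z`. A nonempty
block is tensored together. As there is no tensor unit, an empty block is replaced by `C ⊸ C`, where
`C` is the conclusion, and the formula `C ⊸ C` is applied to the result at the end. -/
theorem exists_factor (P : List (Formula α)) : ∀ (Δ₁ Δ₂ : List (Formula α)) {Θ : List (Formula α)}
    (π : Pf Θ C) (h : Θ = Δ₁ ++ P ++ Δ₂), ∃ (Z : Formula α) (ι : Pf P Z)
      (π' : Pf (Δ₁ ++ Z :: Δ₂) C), cut Δ₁ Δ₂ ι π' rfl h = π := by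
  induction P with
  | nil =>
    intro Δ₁ Δ₂ Θ π h
    have h' : Θ = Δ₁ ++ Δ₂ := by simpa using h
    subst h'
    refine ⟨lolli C C, lolliR (ax C) rfl, left Δ₁ [] (.exch Δ₂ [lolli C C])
      (lolliL [] [] π (ax C) rfl rfl) (by simp) (by simp), ?_⟩
    have h₁ := cut_exch₂ (lolliR (ax C) rfl) (lolliL [] [] π (ax C) rfl rfl) [] []
      (Δ₁ := Δ₁) (Δ₂ := []) (Υ := Δ₂) (Υ' := [lolli C C]) (Υ'' := []) (Λ₁ := Δ₁) (Λ₂ := Δ₂)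
      (Λ₃ := Δ₁ ++ Δ₂) (Λ₄ := []) (Θ₁ := Δ₁ ++ lolli C C :: Δ₂) (Θ₂ := Δ₁ ++ Δ₂)
      (hp := by simp) (hc := by simp) (hp' := rfl)
      (hc' := h) (hq := by simp) (hd := by simp) (hq' := by simp) (hd' := by simp)
    refine h₁.trans ((exch_nil _).trans ?_)
    refine (lolli_lolli (Θ₂ := Δ₁ ++ Δ₂) (ax C) π (ax C) (he := rfl) (hf := by simp)
      (hg := by simp)).trans ?_
    exact (cut_ax _).trans (cut_ax _)
  | cons A P ih =>
    intro Δ₁ Δ₂ Θ π h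
    obtain ⟨Z, ι, π', rfl⟩ := ih (Δ₁ ++ [A]) Δ₂ π (by simp [h])
    refine ⟨tens A Z, tensR (ax A) ι rfl, left Δ₁ Δ₂ (.tens A Z) π' (by simp) (by simp), ?_⟩
    refine (tens_tens (Θ₂ := Θ) (ax A) ι π' (hq := rfl) (hd := by simp [h]) (hq' := by simp [h])
      (hd' := by simp [h]) rfl rfl).trans ?_
    exact ax_cut _

/-- An operation on proofs that replaces a block `P` of the context by `Q` and commutes with cuts
against the conclusion. The left rules and their composites are examples. -/
structure BlockMap (P Q : List (Formula α)) where
  /-- the operation; as for the rules, the contexts are given up to propositional equality -/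
  app : ∀ {Θ Ξ : List (Formula α)} {C : Formula α} (Δ₁ Δ₂ : List (Formula α)) (_ : Pf Θ C)
    (_ : Θ = Δ₁ ++ P ++ Δ₂) (_ : Ξ = Δ₁ ++ Q ++ Δ₂), Pf Ξ C
  app_cut : ∀ {Υ₁ Υ₂ Δ₁ Δ₂ Λ₁ Λ₂ Θ Θ' Θ₁ Θ₂ Ξ : List (Formula α)} {A C : Formula α}
    (π : Pf Θ A) (σ : Pf Θ' C) {hp : Θ = Υ₁ ++ P ++ Υ₂} {hc : Θ₁ = Υ₁ ++ Q ++ Υ₂}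
    {hp' : Θ' = Δ₁ ++ A :: Δ₂} {hc' : Ξ = Δ₁ ++ Θ₁ ++ Δ₂} {hd : Θ₂ = Δ₁ ++ Θ ++ Δ₂}
    {hq : Θ₂ = Λ₁ ++ P ++ Λ₂} {hd' : Ξ = Λ₁ ++ Q ++ Λ₂} (_ : Λ₁ = Δ₁ ++ Υ₁ := by simp)
    (_ : Λ₂ = Υ₂ ++ Δ₂ := by simp),
    cut Δ₁ Δ₂ (app Υ₁ Υ₂ π hp hc) σ hp' hc' = app Λ₁ Λ₂ (cut Δ₁ Δ₂ π σ hp' hd) hq hd'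

/-- A left rule as a block map. -/
def BlockMap.ofRule (r : LeftRule P Q) : BlockMap P Q where
  app Δ₁ Δ₂ π hp hc := left Δ₁ Δ₂ r π hp hc
  app_cut π σ _ _ _ _ _ _ _ h₁ h₂ := left_cut r π σ h₁ h₂

namespace BlockMap

/-- The block is to the right of the cut formula. -/
theorem cut_app (T : BlockMap P Q) (π : Pf Γ A) (σ : Pf Θ C) (Δ₂ : List (Formula α))
    {hp : Θ = Λ₁ ++ P ++ Δ₃} {hc : Θ₁ = Λ₁ ++ Q ++ Δ₃} {hp' : Θ₁ = Δ₁ ++ A :: Λ₂}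
    {hc' : Ξ = Δ₁ ++ Γ ++ Λ₂} {hq : Θ = Δ₁ ++ A :: Λ₃} {hd : Θ₂ = Δ₁ ++ Γ ++ Λ₃}
    {hq' : Θ₂ = Λ₄ ++ P ++ Δ₃} {hd' : Ξ = Λ₄ ++ Q ++ Δ₃}
    (h₁ : Λ₁ = Δ₁ ++ A :: Δ₂ := by simp) (h₂ : Λ₂ = Δ₂ ++ Q ++ Δ₃ := by simp)
    (h₃ : Λ₃ = Δ₂ ++ P ++ Δ₃ := by simp) (h₄ : Λ₄ = Δ₁ ++ Γ ++ Δ₂ := by simp) :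
    cut Δ₁ Λ₂ π (T.app Λ₁ Δ₃ σ hp hc) hp' hc' =
      T.app Λ₄ Δ₃ (cut Δ₁ Λ₃ π σ hq hd) hq' hd' := by
  obtain ⟨Z, ι, σ', rfl⟩ := exists_factor P Λ₁ Δ₃ σ hp
  subst h₁ h₂ h₃ h₄
  calc _ = cut Δ₁ (Δ₂ ++ Q ++ Δ₃) π (cut (Δ₁ ++ A :: Δ₂) Δ₃
          (T.app [] [] ι (by simp) (by simp) : Pf Q Z) σ' rfl hc) hp' hc' :=
        congrArg (fun τ => cut Δ₁ (Δ₂ ++ Q ++ Δ₃) π τ hp' hc') (T.app_cut ι _).symm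
    _ = cut (Δ₁ ++ Γ ++ Δ₂) Δ₃ (T.app [] [] ι (by simp) (by simp) : Pf Q Z)
          (cut Δ₁ (Δ₂ ++ Z :: Δ₃) π σ' (by simp) rfl) (by simp) hd' := cut_cut_comm _ _ _ Δ₂
    _ = T.app (Δ₁ ++ Γ ++ Δ₂) Δ₃ (cut (Δ₁ ++ Γ ++ Δ₂) Δ₃ ι
          (cut Δ₁ (Δ₂ ++ Z :: Δ₃) π σ' (by simp) rfl) (by simp) hq') hq' hd' := T.app_cut ι _
    _ = _ := congrArg (fun τ => T.app _ _ τ hq' hd') (cut_cut_comm _ _ _ Δ₂).symm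

/-- Operations on disjoint blocks commute. -/
theorem app_app (T : BlockMap P Q) (S : BlockMap P' Q') (π : Pf Θ C) (Δ₂ : List (Formula α))
    {hp : Θ = Λ₁ ++ P' ++ Δ₃} {hc : Θ₁ = Λ₁ ++ Q' ++ Δ₃} {hp' : Θ₁ = Δ₁ ++ P ++ Λ₂}
    {hc' : Ξ = Δ₁ ++ Q ++ Λ₂} {hq : Θ = Δ₁ ++ P ++ Λ₃} {hd : Θ₂ = Δ₁ ++ Q ++ Λ₃}
    {hq' : Θ₂ = Λ₄ ++ P' ++ Δ₃} {hd' : Ξ = Λ₄ ++ Q' ++ Δ₃}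
    (h₁ : Λ₁ = Δ₁ ++ P ++ Δ₂ := by simp) (h₂ : Λ₂ = Δ₂ ++ Q' ++ Δ₃ := by simp)
    (h₃ : Λ₃ = Δ₂ ++ P' ++ Δ₃ := by simp) (h₄ : Λ₄ = Δ₁ ++ Q ++ Δ₂ := by simp) :
    T.app Δ₁ Λ₂ (S.app Λ₁ Δ₃ π hp hc) hp' hc' = S.app Λ₄ Δ₃ (T.app Δ₁ Λ₃ π hq hd) hq' hd' := by
  obtain ⟨Z, ι, π', rfl⟩ := exists_factor P Δ₁ Λ₃ π hq
  subst h₁ h₂ h₃ h₄ hd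
  calc _ = T.app Δ₁ (Δ₂ ++ Q' ++ Δ₃) (cut Δ₁ (Δ₂ ++ Q' ++ Δ₃) ι
          (S.app (Δ₁ ++ Z :: Δ₂) Δ₃ π' (by simp) rfl) (by simp) hp') hp' hc' :=
        congrArg (fun τ => T.app _ _ τ hp' hc') (S.cut_app ι π' Δ₂).symm
    _ = cut Δ₁ (Δ₂ ++ Q' ++ Δ₃) (T.app [] [] ι (by simp) (by simp) : Pf Q Z)
          (S.app (Δ₁ ++ Z :: Δ₂) Δ₃ π' (by simp) rfl) (by simp) hc' := (T.app_cut ι _).symm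
    _ = S.app (Δ₁ ++ Q ++ Δ₂) Δ₃ (cut Δ₁ (Δ₂ ++ P' ++ Δ₃)
          (T.app [] [] ι (by simp) (by simp) : Pf Q Z) π' rfl rfl) hq' hd' := S.cut_app _ π' Δ₂
    _ = _ := congrArg (fun τ => S.app _ _ τ hq' hd') (T.app_cut ι _)

/-- The block is inside the first of two exchanged blocks. -/
theorem exch_app₁ (T : BlockMap P Q) (π : Pf Θ C) (Υ₁ Υ₂ : List (Formula α))
    {hp : Θ = Λ₃ ++ P ++ Λ₄} {hc : Θ₁ = Λ₃ ++ Q ++ Λ₄}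
    {hp' : Θ₁ = Δ₁ ++ (Υ'' ++ Υ) ++ Δ₂} {hc' : Ξ = Δ₁ ++ (Υ ++ Υ'') ++ Δ₂}
    {hq : Θ = Δ₁ ++ (Υ' ++ Υ) ++ Δ₂} {hd : Θ₂ = Δ₁ ++ (Υ ++ Υ') ++ Δ₂}
    {hq' : Θ₂ = Λ₁ ++ P ++ Λ₂} {hd' : Ξ = Λ₁ ++ Q ++ Λ₂}
    (h₁ : Υ' = Υ₁ ++ P ++ Υ₂ := by simp) (h₂ : Υ'' = Υ₁ ++ Q ++ Υ₂ := by simp)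
    (h₃ : Λ₁ = Δ₁ ++ Υ ++ Υ₁ := by simp) (h₄ : Λ₂ = Υ₂ ++ Δ₂ := by simp)
    (h₅ : Λ₃ = Δ₁ ++ Υ₁ := by simp) (h₆ : Λ₄ = Υ₂ ++ Υ ++ Δ₂ := by simp) :
    left Δ₁ Δ₂ (.exch Υ'' Υ) (T.app Λ₃ Λ₄ π hp hc) hp' hc' =
      T.app Λ₁ Λ₂ (left Δ₁ Δ₂ (.exch Υ' Υ) π hq hd) hq' hd' := by
  obtain ⟨Z, ι, π', rfl⟩ := exists_factor P Λ₃ Λ₄ π hp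
  subst h₁ h₂ h₃ h₄ h₅ h₆
  calc _ = left Δ₁ Δ₂ (.exch (Υ₁ ++ Q ++ Υ₂) Υ) (cut (Δ₁ ++ Υ₁) (Υ₂ ++ Υ ++ Δ₂)
          (T.app [] [] ι (by simp) (by simp) : Pf Q Z) π' rfl hc) hp' hc' :=
        congrArg (fun τ => left _ _ _ τ hp' hc') (T.app_cut ι _).symm
    _ = cut (Δ₁ ++ Υ ++ Υ₁) (Υ₂ ++ Δ₂) (T.app [] [] ι (by simp) (by simp) : Pf Q Z)
          (left Δ₁ Δ₂ (.exch (Υ₁ ++ Z :: Υ₂) Υ) π' (by simp) rfl) (by simp) hd' :=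
        (cut_exch₁ _ π' Υ₁ Υ₂).symm
    _ = T.app (Δ₁ ++ Υ ++ Υ₁) (Υ₂ ++ Δ₂) (cut (Δ₁ ++ Υ ++ Υ₁) (Υ₂ ++ Δ₂) ι
          (left Δ₁ Δ₂ (.exch (Υ₁ ++ Z :: Υ₂) Υ) π' (by simp) rfl) (by simp) hq') hq' hd' :=
        T.app_cut ι _
    _ = _ := congrArg (fun τ => T.app _ _ τ hq' hd') (cut_exch₁ _ π' Υ₁ Υ₂)

/-- The block is inside the second of two exchanged blocks. -/
theorem exch_app₂ (T : BlockMap P Q) (π : Pf Θ C) (Υ₁ Υ₂ : List (Formula α))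
    {hp : Θ = Λ₃ ++ P ++ Λ₄} {hc : Θ₁ = Λ₃ ++ Q ++ Λ₄}
    {hp' : Θ₁ = Δ₁ ++ (Υ ++ Υ'') ++ Δ₂} {hc' : Ξ = Δ₁ ++ (Υ'' ++ Υ) ++ Δ₂}
    {hq : Θ = Δ₁ ++ (Υ ++ Υ') ++ Δ₂} {hd : Θ₂ = Δ₁ ++ (Υ' ++ Υ) ++ Δ₂}
    {hq' : Θ₂ = Λ₁ ++ P ++ Λ₂} {hd' : Ξ = Λ₁ ++ Q ++ Λ₂}
    (h₁ : Υ' = Υ₁ ++ P ++ Υ₂ := by simp) (h₂ : Υ'' = Υ₁ ++ Q ++ Υ₂ := by simp)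
    (h₃ : Λ₁ = Δ₁ ++ Υ₁ := by simp) (h₄ : Λ₂ = Υ₂ ++ Υ ++ Δ₂ := by simp)
    (h₅ : Λ₃ = Δ₁ ++ Υ ++ Υ₁ := by simp) (h₆ : Λ₄ = Υ₂ ++ Δ₂ := by simp) :
    left Δ₁ Δ₂ (.exch Υ Υ'') (T.app Λ₃ Λ₄ π hp hc) hp' hc' =
      T.app Λ₁ Λ₂ (left Δ₁ Δ₂ (.exch Υ Υ') π hq hd) hq' hd' := by
  obtain ⟨Z, ι, π', rfl⟩ := exists_factor P Λ₃ Λ₄ π hp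
  subst h₁ h₂ h₃ h₄ h₅ h₆
  calc _ = left Δ₁ Δ₂ (.exch Υ (Υ₁ ++ Q ++ Υ₂)) (cut (Δ₁ ++ Υ ++ Υ₁) (Υ₂ ++ Δ₂)
          (T.app [] [] ι (by simp) (by simp) : Pf Q Z) π' rfl hc) hp' hc' :=
        congrArg (fun τ => left _ _ _ τ hp' hc') (T.app_cut ι _).symm
    _ = cut (Δ₁ ++ Υ₁) (Υ₂ ++ Υ ++ Δ₂) (T.app [] [] ι (by simp) (by simp) : Pf Q Z)
          (left Δ₁ Δ₂ (.exch Υ (Υ₁ ++ Z :: Υ₂)) π' (by simp) rfl) (by simp) hd' :=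
        (cut_exch₂ _ π' Υ₁ Υ₂).symm
    _ = T.app (Δ₁ ++ Υ₁) (Υ₂ ++ Υ ++ Δ₂) (cut (Δ₁ ++ Υ₁) (Υ₂ ++ Υ ++ Δ₂) ι
          (left Δ₁ Δ₂ (.exch Υ (Υ₁ ++ Z :: Υ₂)) π' (by simp) rfl) (by simp) hq') hq' hd' :=
        T.app_cut ι _
    _ = _ := congrArg (fun τ => T.app _ _ τ hq' hd') (cut_exch₂ _ π' Υ₁ Υ₂)

/-- Left rules may be moved above a right introduction of `⊸`. -/
theorem app_lolliR (T : BlockMap P Q) (π : Pf Θ B) {hl : Θ = A :: Θ₁}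
    {hp : Θ₁ = Δ₁ ++ P ++ Δ₂} {hc : Ξ = Δ₁ ++ Q ++ Δ₂} {hp' : Θ = (A :: Δ₁) ++ P ++ Δ₂}
    {hc' : Θ₂ = (A :: Δ₁) ++ Q ++ Δ₂} {hl' : Θ₂ = A :: Ξ} :
    T.app Δ₁ Δ₂ (lolliR π hl) hp hc = lolliR (T.app (A :: Δ₁) Δ₂ π hp' hc') hl' := by
  obtain ⟨Z, ι, π', rfl⟩ := exists_factor P (A :: Δ₁) Δ₂ π hp'
  subst hc'
  calc _ = T.app Δ₁ Δ₂ (cut Δ₁ Δ₂ ι (lolliR π' rfl) rfl hp) hp hc :=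
        congrArg (fun τ => T.app _ _ τ hp hc) (cut_lolliR ι π').symm
    _ = cut Δ₁ Δ₂ (T.app [] [] ι (by simp) (by simp) : Pf Q Z) (lolliR π' rfl) rfl hc :=
        (T.app_cut ι _).symm
    _ = lolliR (cut (A :: Δ₁) Δ₂ (T.app [] [] ι (by simp) (by simp) : Pf Q Z) π' rfl rfl) hl' :=
        cut_lolliR _ π'
    _ = _ := congrArg (fun τ => lolliR τ hl') (T.app_cut ι _)

theorem app_congr (T : BlockMap P Q) (π : Pf Θ C) {hp : Θ = Δ₁ ++ P ++ Δ₂}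
    {hc : Ξ = Δ₁ ++ Q ++ Δ₂} {hp' : Θ = Λ₁ ++ P ++ Λ₂} {hc' : Ξ = Λ₁ ++ Q ++ Λ₂}
    (h₁ : Δ₁ = Λ₁ := by simp) (h₂ : Δ₂ = Λ₂ := by simp) :
    T.app Δ₁ Δ₂ π hp hc = T.app Λ₁ Λ₂ π hp' hc' := by
  subst h₁ h₂; rfl

theorem app_app_congr (S : BlockMap Q R) (T : BlockMap P Q) (π : Pf Θ C)
    {hp : Θ = Δ₁ ++ P ++ Δ₂} {hc : Θ₁ = Δ₁ ++ Q ++ Δ₂} {hp' : Θ₁ = Δ₁ ++ Q ++ Δ₂}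
    {hc' : Ξ = Δ₁ ++ R ++ Δ₂} {hd : Θ₂ = Δ₁ ++ Q ++ Δ₂} {hq : Θ₂ = Δ₁ ++ Q ++ Δ₂} :
    S.app Δ₁ Δ₂ (T.app Δ₁ Δ₂ π hp hc) hp' hc' = S.app Δ₁ Δ₂ (T.app Δ₁ Δ₂ π hp hd) hq hc' := by
  subst hc hd; rfl

/-- Composition of block maps. -/
def comp (S : BlockMap Q R) (T : BlockMap P Q) : BlockMap P R where
  app Δ₁ Δ₂ π hp hc := S.app Δ₁ Δ₂ (T.app Δ₁ Δ₂ π hp rfl) rfl hc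
  app_cut := by
    intro Υ₁ Υ₂ Δ₁ Δ₂ Λ₁ Λ₂ Θ Θ' Θ₁ Θ₂ Ξ A C π σ hp hc hp' hc' hd hq hd' h₁ h₂
    subst h₁ h₂
    refine (S.app_cut (hd := rfl) (hq := by simp) (hd' := hd') _ σ).trans ?_
    rw [T.app_cut (Λ₁ := Δ₁ ++ Υ₁) (Λ₂ := Υ₂ ++ Δ₂) (hd := hd) (hq := hq) (hd' := by simp)]
    exact app_app_congr _ _ _

/-- A block map acting on the left part of a block. -/
def padRight (T : BlockMap P Q) (Υ : List (Formula α)) : BlockMap (P ++ Υ) (Q ++ Υ) where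
  app Δ₁ Δ₂ π hp hc := T.app Δ₁ (Υ ++ Δ₂) π (by simp [hp]) (by simp [hc])
  app_cut π σ _ _ _ _ _ _ _ h₁ h₂ := T.app_cut π σ h₁ (by simp [h₂])

/-- A block map acting on the right part of a block. -/
def padLeft (T : BlockMap P Q) (Υ : List (Formula α)) : BlockMap (Υ ++ P) (Υ ++ Q) where
  app Δ₁ Δ₂ π hp hc := T.app (Δ₁ ++ Υ) Δ₂ π (by simp [hp]) (by simp [hc])
  app_cut π σ _ _ _ _ _ _ _ h₁ h₂ := T.app_cut π σ (by simp [h₁]) h₂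

end BlockMap

/-- A left rule commutes with an operation on a block to the right of it. -/
theorem left_app (r : LeftRule P Q) (S : BlockMap P' Q') (π : Pf Θ C)
    (Υ : List (Formula α))
    {hp : Θ = Λ₁ ++ P' ++ Δ₃} {hc : Θ₁ = Λ₁ ++ Q' ++ Δ₃} {hp' : Θ₁ = Δ₁ ++ P ++ Λ₂}
    {hc' : Ξ = Δ₁ ++ Q ++ Λ₂} {hq : Θ = Δ₁ ++ P ++ Λ₃} {hd : Θ₂ = Δ₁ ++ Q ++ Λ₃}
    {hq' : Θ₂ = Λ₄ ++ P' ++ Δ₃} {hd' : Ξ = Λ₄ ++ Q' ++ Δ₃}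
    (h₁ : Λ₁ = Δ₁ ++ P ++ Υ := by simp) (h₂ : Λ₂ = Υ ++ Q' ++ Δ₃ := by simp)
    (h₃ : Λ₃ = Υ ++ P' ++ Δ₃ := by simp) (h₄ : Λ₄ = Δ₁ ++ Q ++ Υ := by simp) :
    left Δ₁ Λ₂ r (S.app Λ₁ Δ₃ π hp hc) hp' hc' = S.app Λ₄ Δ₃ (left Δ₁ Λ₃ r π hq hd) hq' hd' :=
  (BlockMap.ofRule r).app_app S π Υ h₁ h₂ h₃ h₄

/-- Surjective pairing for `&`. -/
theorem ampR_cut (π : Pf Γ (amp A B)) :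
    ampR (cut [] [] π (left [] [] (.amp₀ A B) (ax A) rfl rfl) rfl (by simp))
      (cut [] [] π (left [] [] (.amp₁ A B) (ax B) rfl rfl) rfl (by simp)) = π := by
  rw [← cut_ampR (hp := rfl), ← eta_amp, cut_ax]

theorem cut_ampR_amp₀ (π : Pf Γ A) (ρ : Pf Γ B) {hp : [A] = [] ++ [A] ++ []}
    {hc : [amp A B] = [] ++ [amp A B] ++ []} {hp' : [amp A B] = [] ++ amp A B :: []}
    {hc' : Γ = [] ++ Γ ++ []} :
    cut [] [] (ampR π ρ) (left [] [] (.amp₀ A B) (ax A) hp hc) hp' hc' = π :=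
  (amp_amp₀ π ρ _ (hq := rfl)).trans (cut_ax _)

theorem cut_ampR_amp₁ (π : Pf Γ A) (ρ : Pf Γ B) {hp : [B] = [] ++ [B] ++ []}
    {hc : [amp A B] = [] ++ [amp A B] ++ []} {hp' : [amp A B] = [] ++ amp A B :: []}
    {hc' : Γ = [] ++ Γ ++ []} :
    cut [] [] (ampR π ρ) (left [] [] (.amp₁ A B) (ax B) hp hc) hp' hc' = ρ :=
  (amp_amp₁ π ρ _ (hq := rfl)).trans (cut_ax _)

theorem left_ampR (r : LeftRule P Q) (π : Pf Θ A) (ρ : Pf Θ B) {hp : Θ = Δ₁ ++ P ++ Δ₂}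
    {hc : Ξ = Δ₁ ++ Q ++ Δ₂} :
    left Δ₁ Δ₂ r (ampR π ρ) hp hc = ampR (left Δ₁ Δ₂ r π hp hc) (left Δ₁ Δ₂ r ρ hp hc) := by
  rw [← ampR_cut (left Δ₁ Δ₂ r (ampR π ρ) hp hc)]
  congr 1
  · exact (left_cut r _ _ (hd := by simp) (hq := hp) (hd' := hc)).trans
      (congrArg (fun τ => left _ _ r τ hp hc) (cut_ampR_amp₀ π ρ))
  · exact (left_cut r _ _ (hd := by simp) (hq := hp) (hd' := hc)).trans
      (congrArg (fun τ => left _ _ r τ hp hc) (cut_ampR_amp₁ π ρ))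

/-- Weakening is also a right unit of contraction. -/
theorem ctr_wk' (π : Pf Θ C) {hp : Θ = Λ₁ ++ [] ++ Δ₂} {hc : Θ₁ = Λ₁ ++ [bang A] ++ Δ₂}
    {hp₁ : Θ₁ = Δ₁ ++ [bang A, bang A] ++ Δ₂} {hc₁ : Θ = Δ₁ ++ [bang A] ++ Δ₂}
    (h : Λ₁ = Δ₁ ++ [bang A] := by simp) :
    left Δ₁ Δ₂ (.ctr A) (left Λ₁ Δ₂ (.wk A) π hp hc) hp₁ hc₁ = π := by
  subst h hp₁ hc₁
  -- the two weakenings differ by the exchange that contraction absorbs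
  have h₁ : left (Δ₁ ++ [bang A]) Δ₂ (.wk A) π hp hc =
      left Δ₁ Δ₂ (.exch [bang A] [bang A])
        (left Δ₁ (bang A :: Δ₂) (.wk A) π (by simp) (by simp)
          : Pf (Δ₁ ++ [bang A, bang A] ++ Δ₂) C) rfl rfl := by
    calc _ = left (Δ₁ ++ [bang A]) Δ₂ (.wk A) (left Δ₁ Δ₂ (.exch [] [bang A]) π rfl rfl) hp hc :=
          congrArg (fun τ => left _ _ _ τ hp hc) (nil_exch π).symm
      _ = _ := ((BlockMap.ofRule (.wk A)).exch_app₁ π [] []).symm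
  rw [h₁]
  exact (ctr_exch (hq := rfl) _).trans (ctr_wk π)

end Commute

/-! ### Maps with a shared hypothesis -/

section Comp

variable {H X Y Z W : Formula α}

/-- Composition of proofs of `X, !H ⊢ Y` and `Y, !H ⊢ Z` that share the hypothesis `!H`. -/
def comp (π : Pf [X, bang H] Y) (ρ : Pf [Y, bang H] Z) : Pf [X, bang H] Z :=
  left [X] [] (.ctr H) (cut [] [bang H] π ρ rfl rfl) rfl rfl

/-- A proof of `X ⊢ Y` with an unused hypothesis `!H`. -/
def weaken (H : Formula α) (π : Pf [X] Y) : Pf [X, bang H] Y := left [X] [] (.wk H) π rfl rfl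

theorem comp_weaken (π : Pf [X, bang H] Y) (ρ : Pf [Y] Z) :
    comp π (weaken H ρ) = cut [] [] π ρ rfl rfl :=
  calc _ = left [X] [] (.ctr H) (left [X, bang H] [] (.wk H) (cut [] [] π ρ rfl rfl) rfl rfl)
          rfl rfl := congrArg (fun τ => left _ _ _ τ _ _) (cut_left₁ _ π ρ [])
    _ = _ := ctr_wk' _

theorem weaken_ax_comp (π : Pf [X, bang H] Y) : comp (weaken H (ax X)) π = π :=
  calc _ = left [X] [] (.ctr H) (left [X] [bang H] (.wk H) (cut [] [bang H] (ax X) π rfl rfl)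
          rfl rfl) rfl rfl := congrArg (fun τ => left _ _ _ τ _ _) (left_cut _ _ π)
    _ = cut [] [bang H] (ax X) π rfl rfl := ctr_wk _
    _ = π := ax_cut π

theorem comp_weaken_ax (π : Pf [X, bang H] Y) : comp π (weaken H (ax Y)) = π :=
  (comp_weaken _ _).trans (cut_ax _)

theorem comp_assoc (π : Pf [X, bang H] Y) (ρ : Pf [Y, bang H] Z) (σ : Pf [Z, bang H] W) :
    comp (comp π ρ) σ = comp π (comp ρ σ) :=
  calc _ = left [X] [] (.ctr H) (left [X] [bang H] (.ctr H)
          (cut [] [bang H] (cut [] [bang H] π ρ rfl rfl) σ rfl rfl) rfl rfl) rfl rfl :=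
        congrArg (fun τ => left _ _ _ τ _ _) (left_cut _ _ σ)
    _ = left [X] [] (.ctr H) (left [X, bang H] [] (.ctr H)
          (cut [] [bang H] (cut [] [bang H] π ρ rfl rfl) σ rfl rfl) rfl rfl) rfl rfl := ctr_ctr _
    _ = left [X] [] (.ctr H) (left [X, bang H] [] (.ctr H)
          (cut [] [bang H, bang H] π (cut [] [bang H] ρ σ rfl rfl) rfl rfl) rfl rfl) rfl rfl :=
        congrArg (fun τ => left _ _ _ (left _ _ _ τ _ _) _ _) (cut_cut π ρ σ)
    _ = _ := congrArg (fun τ => left _ _ _ τ _ _) (cut_left₁ _ π _ []).symm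

theorem comp_ampR (π : Pf [X, bang H] Y) (ρ : Pf [Y, bang H] Z) (σ : Pf [Y, bang H] W) :
    comp π (ampR ρ σ) = ampR (comp π ρ) (comp π σ) :=
  (congrArg (fun τ => left _ _ _ τ _ _) (cut_ampR π ρ σ)).trans (left_ampR _ _ _)

theorem comp_cut (π : Pf [X, bang H] Y) (ρ : Pf [Y] Z) (σ : Pf [Z, bang H] W) :
    comp π (cut [] [bang H] ρ σ rfl rfl) = comp (cut [] [] π ρ rfl rfl) σ :=
  congrArg (fun τ => left [X] [] (.ctr H) τ _ _) (cut_cut π ρ σ).symm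

/-- The composite of the endomorphisms `f i`, for the digits `i` of a binary sequence. -/
def word (f : Fin 2 → Pf [X, bang H] X) : List (Fin 2) → Pf [X, bang H] X
  | [] => weaken H (ax X)
  | i :: S => comp (f i) (word f S)

theorem word_append (f : Fin 2 → Pf [X, bang H] X) (S T : List (Fin 2)) :
    word f (S ++ T) = comp (word f S) (word f T) := by
  induction S with
  | nil => exact (weaken_ax_comp _).symm
  | cons i S ih => rw [List.cons_append, word, word, ih, comp_assoc]

end Comp

/-! ### Binary integers -/

section Collect

variable {Δ₁ Δ₂ Θ Θ₁ Θ₂ Ξ Λ Λ₁ Λ₂ : List (Formula α)} {A C E X : Formula α} {k a b : ℕ}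

/-- Dereliction of `k` copies of `E` followed by their contraction to a single `!E`. -/
def collect (E : Formula α) : (k : ℕ) → BlockMap (List.replicate k E) [bang E]
  | 0 => .ofRule (.wk E)
  | k + 1 => (BlockMap.ofRule (.ctr E)).comp
      (((collect E k).padLeft [bang E]).comp
        ((BlockMap.ofRule (.der E)).padRight (List.replicate k E)))

/-- Contraction of `k` copies of `!E` to a single one. -/
def contract (E : Formula α) : (k : ℕ) → BlockMap (List.replicate k (bang E)) [bang E]
  | 0 => .ofRule (.wk E)
  | k + 1 => (BlockMap.ofRule (.ctr E)).comp ((contract E k).padLeft [bang E])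

theorem collect_succ (π : Pf Θ C) {hp : Θ = Δ₁ ++ List.replicate (k + 1) E ++ Δ₂}
    {hc : Ξ = Δ₁ ++ [bang E] ++ Δ₂} {hq : Θ = Δ₁ ++ [E] ++ Λ₂} {hd : Θ₁ = Δ₁ ++ [bang E] ++ Λ₂}
    {hq' : Θ₁ = Λ₁ ++ List.replicate k E ++ Δ₂} {hd' : Θ₂ = Λ₁ ++ [bang E] ++ Δ₂}
    {hq'' : Θ₂ = Δ₁ ++ [bang E, bang E] ++ Δ₂}
    (h₁ : Λ₁ = Δ₁ ++ [bang E] := by simp) (h₂ : Λ₂ = List.replicate k E ++ Δ₂ := by simp) :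
    (collect E (k + 1)).app Δ₁ Δ₂ π hp hc =
      left Δ₁ Δ₂ (.ctr E) ((collect E k).app Λ₁ Δ₂ (left Δ₁ Λ₂ (.der E) π hq hd) hq' hd')
        hq'' hc := by
  subst h₁ h₂ hq''
  obtain rfl : Θ₁ = Δ₁ ++ ([bang E] ++ List.replicate k E) ++ Δ₂ := by simp [hd]
  rfl

theorem contract_succ (π : Pf Θ C) {hp : Θ = Δ₁ ++ List.replicate (k + 1) (bang E) ++ Δ₂}
    {hc : Ξ = Δ₁ ++ [bang E] ++ Δ₂}
    {hq' : Θ = Λ₁ ++ List.replicate k (bang E) ++ Δ₂} {hd' : Θ₂ = Λ₁ ++ [bang E] ++ Δ₂}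
    {hq'' : Θ₂ = Δ₁ ++ [bang E, bang E] ++ Δ₂}
    (h₁ : Λ₁ = Δ₁ ++ [bang E] := by simp) :
    (contract E (k + 1)).app Δ₁ Δ₂ π hp hc =
      left Δ₁ Δ₂ (.ctr E) ((contract E k).app Λ₁ Δ₂ π hq' hd') hq'' hc := by
  subst h₁ hq''
  rfl

theorem contract_one (π : Pf Θ C) {hp : Θ = Δ₁ ++ List.replicate 1 (bang E) ++ Δ₂}
    {hc : Ξ = Δ₁ ++ [bang E] ++ Δ₂} (h : Θ = Ξ) :
    (contract E 1).app Δ₁ Δ₂ π hp hc = castCtx h π := by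
  subst h
  exact ctr_wk' π

/-- The contractions in `gather` may be performed in the opposite order. -/
theorem mk_gather (E : Formula α) : ∀ (k : ℕ) (Δ₁ Δ₂ : List (Formula α)) {Θ Ξ : List (Formula α)}
    {hp : Θ = Δ₁ ++ List.replicate k (bang E) ++ Δ₂} {hc : Ξ = Δ₁ ++ [bang E] ++ Δ₂}
    (π : Proof Θ C),
    mk (gather E Δ₁ Δ₂ k hp hc π) = (contract E k).app Δ₁ Δ₂ (mk π) hp hc
  | 0, _, _, _, _, _, _, _ => rfl
  | 1, _, _, _, _, hp, hc, π => (mk_castCtx _ π).trans (contract_one _ _).symm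
  | k + 2, Δ₁, Δ₂, Θ, Ξ, hp, hc, π => by
    subst hc
    refine (mk_gather E (k + 1) Δ₁ Δ₂ (hc := rfl) _).trans ?_
    calc _ = (contract E (k + 1)).app Δ₁ Δ₂ (left Δ₁ (List.replicate k (bang E) ++ Δ₂) (.ctr E)
            (mk π) (by simp [hp, List.replicate_succ]) (by simp [List.replicate_succ])
            : Pf (Δ₁ ++ List.replicate (k + 1) (bang E) ++ Δ₂) C) rfl rfl := rfl
      _ = left Δ₁ Δ₂ (.ctr E) ((contract E k).app (Δ₁ ++ [bang E]) Δ₂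
            (left Δ₁ (List.replicate k (bang E) ++ Δ₂) (.ctr E)
            (mk π) (by simp [hp, List.replicate_succ]) (by simp [List.replicate_succ])
            : Pf (Δ₁ ++ List.replicate (k + 1) (bang E) ++ Δ₂) C) (by simp [List.replicate_succ])
            rfl) (by simp) rfl := contract_succ _
      _ = left Δ₁ Δ₂ (.ctr E) (left Δ₁ ([bang E] ++ Δ₂) (.ctr E)
            ((contract E k).app (Δ₁ ++ [bang E, bang E]) Δ₂ (mk π)
              (by simp [hp, List.replicate_succ]) rfl) (by simp) (by simp)) (by simp) rfl :=
          congrArg (fun τ => left _ _ _ τ _ _)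
            ((BlockMap.ofRule (.ctr E)).app_app (contract E k) (mk π) [] (by simp) (by simp)).symm
      _ = left Δ₁ Δ₂ (.ctr E) (left (Δ₁ ++ [bang E]) Δ₂ (.ctr E)
            ((contract E k).app (Δ₁ ++ [bang E, bang E]) Δ₂ (mk π)
              (by simp [hp, List.replicate_succ]) rfl) (by simp) rfl) (by simp) rfl := ctr_ctr _
      _ = left Δ₁ Δ₂ (.ctr E) ((contract E (k + 1)).app (Δ₁ ++ [bang E]) Δ₂ (mk π)
              (by simp [hp, List.replicate_succ]) rfl) (by simp) rfl :=
          congrArg (fun τ => left _ _ _ τ _ _) (contract_succ _).symm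
      _ = _ := (contract_succ _).symm

/-- Dereliction of all copies of `E`, followed by contraction, is `collect`. -/
theorem contract_derAll : ∀ (a : ℕ) (Δ₁ : List (Formula α)) {Θ Θ₁ Ξ : List (Formula α)}
    {hp : Θ = Δ₁ ++ List.replicate a E} {hc : Θ₁ = Δ₁ ++ (List.replicate a E).map bang}
    {hp' : Θ₁ = Δ₁ ++ List.replicate a (bang E) ++ []} {hc' : Ξ = Δ₁ ++ [bang E] ++ []}
    {hq : Θ = Δ₁ ++ List.replicate a E ++ []} (σ : Proof Θ C),
    (contract E a).app Δ₁ [] (mk (derAll (List.replicate a E) Δ₁ hp hc σ)) hp' hc' =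
      (collect E a).app Δ₁ [] (mk σ) hq hc'
  | 0, Δ₁, Θ, Θ₁, Ξ, hp, hc, hp', hc', hq, σ => by
    obtain rfl : Θ = Θ₁ := by simp [hp, hc]
    exact congrArg (fun τ => left _ _ _ τ hp' hc') (mk_castCtx rfl σ)
  | a + 1, Δ₁, Θ, Θ₁, Ξ, hp, hc, hp', hc', hq, σ => by
    rw [contract_succ (Λ₁ := Δ₁ ++ [bang E]) (hd' := rfl)
      (hq' := by simp [hp', List.replicate_succ]) (hq'' := by simp)]
    rw [collect_succ (Λ₁ := Δ₁ ++ [bang E]) (Λ₂ := List.replicate a E) (hd' := rfl) (hd := rfl)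
      (hq := by simp [hp, List.replicate_succ]) (hq' := by simp) (hq'' := by simp)]
    refine congrArg (fun τ => left _ _ _ τ _ hc') ?_
    exact contract_derAll a (Δ₁ ++ [bang E]) (hq := by simp) _

/-- The two blocks of a binary integer: all copies are derelicted, and each block is contracted. -/
theorem contract_contract_derAll (a : ℕ) : ∀ (b : ℕ) (Δ₁ : List (Formula α))
    {Θ Θ₁ Θ₂ Θ₃ Ξ : List (Formula α)}
    {hp : Θ = Δ₁ ++ (List.replicate b E ++ List.replicate a E)}
    {hc : Θ₁ = Δ₁ ++ (List.replicate b E ++ List.replicate a E).map bang}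
    {hp' : Θ₁ = (Δ₁ ++ List.replicate b (bang E)) ++ List.replicate a (bang E) ++ []}
    {hc' : Θ₂ = (Δ₁ ++ List.replicate b (bang E)) ++ [bang E] ++ []}
    {hp₁ : Θ₂ = Δ₁ ++ List.replicate b (bang E) ++ [bang E]} {hc₁ : Ξ = Δ₁ ++ [bang E] ++ [bang E]}
    {hq : Θ = (Δ₁ ++ List.replicate b E) ++ List.replicate a E ++ []}
    {hd : Θ₃ = (Δ₁ ++ List.replicate b E) ++ [bang E] ++ []}
    {hq' : Θ₃ = Δ₁ ++ List.replicate b E ++ [bang E]}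
    (σ : Proof Θ C),
    (contract E b).app Δ₁ [bang E] ((contract E a).app (Δ₁ ++ List.replicate b (bang E)) []
      (mk (derAll (List.replicate b E ++ List.replicate a E) Δ₁ hp hc σ)) hp' hc') hp₁ hc₁ =
    (collect E b).app Δ₁ [bang E] ((collect E a).app (Δ₁ ++ List.replicate b E) [] (mk σ) hq hd)
      hq' hc₁
  | 0, Δ₁, Θ, Θ₁, Θ₂, Θ₃, Ξ, hp, hc, hp', hc', hp₁, hc₁, hq, hd, hq', σ => by
    obtain rfl : Θ₂ = Θ₃ := by simp [hp₁, hq']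
    refine congrArg (fun τ => left _ _ _ τ hp₁ hc₁) ?_
    refine (BlockMap.app_congr _ _ (Λ₁ := Δ₁) (Λ₂ := []) (hc' := by simp [hc'])
      (hp' := by simp [hp'])).trans ?_
    refine (contract_derAll a Δ₁ (hq := by simp [hq]) σ).trans (BlockMap.app_congr _ _)
  | b + 1, Δ₁, Θ, Θ₁, Θ₂, Θ₃, Ξ, hp, hc, hp', hc', hp₁, hc₁, hq, hd, hq', σ => by
    rw [contract_succ (Λ₁ := Δ₁ ++ [bang E]) (hd' := rfl)
      (hq' := by simp [hp₁, List.replicate_succ]) (hq'' := by simp)]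
    rw [collect_succ (Λ₁ := Δ₁ ++ [bang E]) (Λ₂ := List.replicate b E ++ [bang E]) (hd' := rfl)
      (hd := rfl) (hq := by simp [hq', List.replicate_succ]) (hq' := by simp) (hq'' := by simp)]
    refine congrArg (fun τ => left _ _ _ τ _ hc₁) ?_
    have key := contract_contract_derAll a b (Δ₁ ++ [bang E]) (Θ₂ := Θ₂)
      (Θ := Δ₁ ++ [bang E] ++ (List.replicate b E ++ List.replicate a E))
      (Θ₁ := Θ₁) (Ξ := Δ₁ ++ [bang E] ++ [bang E] ++ [bang E])
      (Θ₃ := Δ₁ ++ [bang E] ++ (List.replicate b E ++ [bang E]))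
      (hp := rfl) (hc := by simp [hc, List.replicate_succ, -List.replicate_append_replicate])
      (hp' := by simp [hp', List.replicate_succ, -List.replicate_append_replicate])
      (hc' := by simp [hc', List.replicate_succ])
      (hp₁ := by simp [hp₁, List.replicate_succ]) (hc₁ := rfl) (hq := by simp)
      (hd := by simp) (hq' := by simp)
      (.left Δ₁ (List.replicate b E ++ List.replicate a E) (.der E)
        (by simp [hp, List.replicate_succ, -List.replicate_append_replicate]) (by simp) σ)
    refine (congrArg (fun τ => (contract E b).app _ _ τ _ _) (BlockMap.app_congr _ _
      (by simp [List.replicate_succ]))).trans (key.trans ?_)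
    exact congrArg (fun τ => (collect E b).app _ _ τ _ _)
      ((BlockMap.ofRule (.der E)).app_app (collect E a) (mk σ) (List.replicate b E)
        (by simp [List.replicate_succ]) (by simp) (by simp) (by simp)).symm

/-- From `X, Eᵇ, Eᵃ ⊢ X` to `X, !E, !E ⊢ X`, by dereliction and contraction of each block. -/
def collect₂ (E : Formula α) (b a : ℕ) (π : Pf Θ X)
    (hp : Θ = X :: (List.replicate b E ++ List.replicate a E)) : Pf [X, bang E, bang E] X :=
  (collect E b).app [X] [bang E]
    ((collect E a).app ([X] ++ List.replicate b E) [] π (by simp [hp]) (by simp)) rfl rfl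

theorem collect₂_congr {a' b' : ℕ} (π : Pf Θ X)
    {hp : Θ = X :: (List.replicate b E ++ List.replicate a E)}
    {hp' : Θ = X :: (List.replicate b' E ++ List.replicate a' E)} (ha : a = a') (hb : b = b') :
    collect₂ E b a π hp = collect₂ E b' a' π hp' := by
  subst ha hb; rfl

/-- A copy of `E` in front of the first block: its dereliction is contracted with the first `!E`. -/
theorem collect₂_one (u : Pf [X, E] X) (π : Pf Θ X)
    (hp : Θ = X :: (List.replicate b E ++ List.replicate a E))
    {hq : Θ = [] ++ X :: (List.replicate b E ++ List.replicate a E)}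
    {hc : Θ₁ = [] ++ [X, E] ++ (List.replicate b E ++ List.replicate a E)}
    {hp' : Θ₁ = X :: (List.replicate (b + 1) E ++ List.replicate a E)} :
    collect₂ E (b + 1) a (cut [] _ u π hq hc) hp' =
      left [X] [bang E] (.ctr E) (cut [] [bang E, bang E]
        (left [X] [] (.der E) u rfl rfl) (collect₂ E b a π hp) rfl rfl) rfl rfl := by
  subst hp hc
  calc _ = left [X] [bang E] (.ctr E) ((collect E b).app [X, bang E] [bang E]
          (left [X] (List.replicate b E ++ [bang E]) (.der E)
            ((collect E a).app ([X] ++ List.replicate (b + 1) E) []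
              (cut [] (List.replicate b E ++ List.replicate a E) u π rfl rfl)
              (by simp [List.replicate_succ, -List.replicate_append_replicate]) (by simp) :
              Pf ([X] ++ List.replicate (b + 1) E ++ [bang E]) X)
            (by simp [List.replicate_succ]) (by simp)) rfl rfl) rfl rfl := collect_succ _
    _ = left [X] [bang E] (.ctr E) ((collect E b).app [X, bang E] [bang E]
          ((collect E a).app ([X, bang E] ++ List.replicate b E) []
            (left [X] (List.replicate b E ++ List.replicate a E) (.der E)
              (cut [] (List.replicate b E ++ List.replicate a E) u π rfl rfl) rfl rfl)
            (by simp) (by simp)) rfl rfl) rfl rfl :=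
        by
          refine congrArg (fun τ => left [X] [bang E] (.ctr E)
            ((collect E b).app [X, bang E] [bang E] τ _ _) _ _) ?_
          exact left_app _ (collect E a) _ (List.replicate b E) (by simp [List.replicate_succ])
    _ = left [X] [bang E] (.ctr E) ((collect E b).app [X, bang E] [bang E]
          ((collect E a).app ([X, bang E] ++ List.replicate b E) []
            (cut [] (List.replicate b E ++ List.replicate a E) (left [X] [] (.der E) u rfl rfl) π
              rfl rfl)
            (by simp) (by simp)) rfl rfl) rfl rfl :=
        congrArg (fun τ => left _ _ _ ((collect E b).app _ _ ((collect E a).app _ _ τ _ _) _ _) _ _)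
          (left_cut _ _ _).symm
    _ = left [X] [bang E] (.ctr E) ((collect E b).app [X, bang E] [bang E]
          (cut [] (List.replicate b E ++ [bang E]) (left [X] [] (.der E) u rfl rfl)
            ((collect E a).app ([X] ++ List.replicate b E) [] π (by simp) (by simp) :
              Pf ([X] ++ List.replicate b E ++ [bang E]) X)
            (by simp) (by simp)) rfl rfl) rfl rfl :=
        congrArg (fun τ => left _ _ _ ((collect E b).app _ _ τ _ _) _ _)
          ((collect E a).cut_app _ _ (List.replicate b E)).symm
    _ = _ := congrArg (fun τ => left [X] [bang E] (.ctr E) τ _ _)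
          ((collect E b).cut_app _ _ []).symm

/-- A copy of `E` moved in front of the second block: its dereliction is moved in front of the
second `!E` and contracted with it. -/
theorem collect₂_zero (u : Pf [X, E] X) (π : Pf Θ X)
    (hp : Θ = X :: (List.replicate b E ++ List.replicate a E))
    {hq : Θ = [] ++ X :: (List.replicate b E ++ List.replicate a E)}
    {hc : Θ₁ = [] ++ [X, E] ++ (List.replicate b E ++ List.replicate a E)}
    {hd : Θ₁ = [X] ++ ([E] ++ List.replicate b E) ++ List.replicate a E}
    {hd' : Θ₂ = [X] ++ (List.replicate b E ++ [E]) ++ List.replicate a E}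
    {hp' : Θ₂ = X :: (List.replicate b E ++ List.replicate (a + 1) E)} :
    collect₂ E b (a + 1) (left [X] (List.replicate a E) (.exch [E] (List.replicate b E))
      (cut [] _ u π hq hc) hd hd') hp' =
      left [X, bang E] [] (.ctr E) (left [X] [bang E] (.exch [bang E] [bang E])
        (cut [] [bang E, bang E] (left [X] [] (.der E) u rfl rfl) (collect₂ E b a π hp)
          rfl rfl) rfl rfl) rfl rfl := by
  subst hp hc hd'
  calc _ = (collect E b).app [X] [bang E] (left ([X] ++ List.replicate b E) [] (.ctr E)
          ((collect E a).app ([X] ++ List.replicate b E ++ [bang E]) []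
            (left ([X] ++ List.replicate b E) (List.replicate a E) (.der E)
              (left [X] (List.replicate a E) (.exch [E] (List.replicate b E))
                (cut [] (List.replicate b E ++ List.replicate a E) u π rfl rfl) hd rfl)
              (by simp) rfl) (by simp) (by simp)) rfl (by simp)) rfl rfl :=
        congrArg (fun τ => (collect E b).app _ _ τ _ _) (collect_succ _)
    _ = (collect E b).app [X] [bang E] (left ([X] ++ List.replicate b E) [] (.ctr E)
          ((collect E a).app ([X] ++ List.replicate b E ++ [bang E]) []
            (left [X] (List.replicate a E) (.exch [bang E] (List.replicate b E))
              (left [X] (List.replicate b E ++ List.replicate a E) (.der E)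
                (cut [] (List.replicate b E ++ List.replicate a E) u π rfl rfl) hd rfl)
              rfl (by simp)) (by simp) (by simp)) rfl (by simp)) rfl rfl :=
        congrArg (fun τ => (collect E b).app _ _ (left _ _ _ ((collect E a).app _ _ τ _ _) _ _) _ _)
          ((BlockMap.ofRule (.der E)).exch_app₁ (Υ' := [E]) _ [] []).symm
    _ = (collect E b).app [X] [bang E] (left ([X] ++ List.replicate b E) [] (.ctr E)
          ((collect E a).app ([X] ++ List.replicate b E ++ [bang E]) []
            (left [X] (List.replicate a E) (.exch [bang E] (List.replicate b E))
              (cut [] (List.replicate b E ++ List.replicate a E) (left [X] [] (.der E) u rfl rfl) π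
                rfl rfl)
              rfl (by simp)) (by simp) (by simp)) rfl (by simp)) rfl rfl :=
        congrArg (fun τ => (collect E b).app _ _ (left _ _ _ ((collect E a).app _ _
          (left _ _ _ τ _ _) _ _) _ _) _ _) (left_cut _ _ _).symm
    _ = (collect E b).app [X] [bang E] (left ([X] ++ List.replicate b E) [] (.ctr E)
            (left [X] [bang E] (.exch [bang E] (List.replicate b E))
              ((collect E a).app ([X, bang E] ++ List.replicate b E) []
                (cut [] (List.replicate b E ++ List.replicate a E)
                  (left [X] [] (.der E) u rfl rfl) π rfl rfl)
                (by simp) (by simp) : Pf ([X, bang E] ++ List.replicate b E ++ [bang E]) X)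
                (by simp) (by simp)) rfl (by simp)) rfl rfl :=
        by
          refine congrArg (fun τ => (collect E b).app [X] [bang E]
            (left ([X] ++ List.replicate b E) [] (.ctr E) τ _ _) _ _) ?_
          exact (left_app _ (collect E a) _ []).symm
    _ = (collect E b).app [X] [bang E] (left ([X] ++ List.replicate b E) [] (.ctr E)
            (left [X] [bang E] (.exch [bang E] (List.replicate b E))
              (cut [] (List.replicate b E ++ [bang E]) (left [X] [] (.der E) u rfl rfl)
                ((collect E a).app ([X] ++ List.replicate b E) [] π (by simp) (by simp) :
                  Pf ([X] ++ List.replicate b E ++ [bang E]) X)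
                (by simp) (by simp) : Pf ([X, bang E] ++ List.replicate b E ++ [bang E]) X)
                (by simp) (by simp)) rfl (by simp)) rfl rfl :=
        congrArg (fun τ => (collect E b).app _ _ (left _ _ _ (left _ _ _ τ _ _) _ _) _ _)
          ((collect E a).cut_app _ _ (List.replicate b E)).symm
    _ = left [X, bang E] [] (.ctr E) ((collect E b).app [X] [bang E, bang E]
            (left [X] [bang E] (.exch [bang E] (List.replicate b E))
              (cut [] (List.replicate b E ++ [bang E]) (left [X] [] (.der E) u rfl rfl)
                ((collect E a).app ([X] ++ List.replicate b E) [] π (by simp) (by simp) :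
                  Pf ([X] ++ List.replicate b E ++ [bang E]) X)
                (by simp) (by simp)) (by simp) (by simp) :
                Pf ([X] ++ List.replicate b E ++ [bang E, bang E] ++ []) X)
                (by simp) rfl) rfl rfl :=
        (collect E b).app_app (BlockMap.ofRule (.ctr E)) _ []
    _ = left [X, bang E] [] (.ctr E) (left [X] [bang E] (.exch [bang E] [bang E])
            ((collect E b).app [X, bang E] [bang E]
              (cut [] (List.replicate b E ++ [bang E]) (left [X] [] (.der E) u rfl rfl)
                ((collect E a).app ([X] ++ List.replicate b E) [] π (by simp) (by simp) :
                  Pf ([X] ++ List.replicate b E ++ [bang E]) X)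
                (by simp) (by simp) : Pf ([X, bang E] ++ List.replicate b E ++ [bang E]) X)
                  rfl rfl) rfl rfl) rfl rfl :=
        congrArg (fun τ => left [X, bang E] [] (.ctr E) τ _ _)
          ((collect E b).exch_app₂ _ [] []).symm
    _ = _ := congrArg (fun τ => left [X, bang E] [] (.ctr E) (left _ _ _ τ _ _) _ _)
          ((collect E b).cut_app _ _ []).symm

/-- The proof of `X, X ⊸ X ⊢ X` that applies a function to its argument. -/
def eval (X : Formula α) : Pf [X, lolli X X] X := lolliL [] [] (ax X) (ax X) rfl rfl

/-- The proof of `X, !(X ⊸ X) ⊢ X` that applies a function to its argument. -/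
def apply (X : Formula α) : Pf [X, bang (lolli X X)] X :=
  left [X] [] (.der (lolli X X)) (eval X) rfl rfl

/-- An application to a variable is a cut against `eval`. -/
theorem lolliL_eq (π : Pf Θ X) {hp : Θ = [] ++ X :: Λ} {hc : Θ₁ = [] ++ [X] ++ lolli X X :: Λ} :
    lolliL [] Λ (ax X) π hp hc = cut [] Λ (eval X) π hp hc := by
  refine ((lolliL_cut (ax X) (ax X) π (hp' := hp) (hc' := hc) (hd := hp) (hq := hp)
    (hd' := hc)).trans ?_).symm
  exact congrArg (fun τ => lolliL [] Λ (ax X) τ hp hc) (ax_cut π)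

end Collect

section Body

variable {X : Formula α}

/-- The proof of `X, !(X ⊸ X), !(X ⊸ X) ⊢ X` underlying the binary integer `S`. -/
def body (X : Formula α) (S : List (Fin 2)) :
    Pf [X, bang (lolli X X), bang (lolli X X)] X :=
  collect₂ (lolli X X) (S.count 1) (S.count 0) (mk (composeProof X S)) rfl

theorem mk_lolliR {Γ Θ : List (Formula α)} {A B : Formula α} (π : Proof Θ B) (hp : Θ = A :: Γ) :
    mk (.lolliR hp π) = lolliR (mk π) hp := rfl

/-- The binary integer `S` is `body X S` up to right introductions of `⊸`. -/
theorem mk_bintProof (S : List (Fin 2)) :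
    mk (bintProof X S) = lolliR (lolliR (lolliR (body X S) rfl) rfl) rfl := by
  refine (mk_lolliR _ _).trans (congrArg (fun τ => lolliR τ rfl) ?_)
  refine (mk_lolliR _ _).trans (congrArg (fun τ => lolliR τ rfl) ?_)
  refine (mk_gather _ _ _ _ _).trans ?_
  refine (congrArg (fun τ => (contract _ _).app _ _ τ _ _) (mk_gather _ _ _ _ _)).trans ?_
  refine (contract_contract_derAll (Θ₃ := List.replicate (S.count 1) (lolli X X) ++
    [bang (lolli X X)]) (S.count 0) (S.count 1) [] (hq := by simp) (hd := by simp) (hq' := by simp)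
    (Proof.lolliR rfl (composeProof X S))).trans ?_
  refine (congrArg (fun τ => (collect (lolli X X) (S.count 1)).app [] [bang (lolli X X)] τ rfl rfl)
    ((collect (lolli X X) (S.count 0)).app_lolliR (mk (composeProof X S)) (hl := rfl)
      (Δ₁ := List.replicate (S.count 1) (lolli X X)) (Δ₂ := []) (hp := by simp) (hc := by simp)
      (hp' := by simp)
      (hc' := (by simp : [X] ++ List.replicate (S.count 1) (lolli X X) ++ [bang (lolli X X)] = _))
      (hl' := rfl))).trans ?_
  exact (collect (lolli X X) (S.count 1)).app_lolliR _

/-- A first digit `1` applies a copy of the first `!(X ⊸ X)`. -/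
theorem body_one (S : List (Fin 2)) :
    body X (1 :: S) = left [X] [bang (lolli X X)] (.ctr _)
      (cut [] [bang (lolli X X), bang (lolli X X)] (apply X) (body X S) rfl rfl) rfl rfl := by
  refine Eq.trans ?_ (collect₂_one (eval X) (mk (composeProof X S)) rfl (hq := rfl)
    (Θ₁ := X :: (List.replicate ((1 :: S).count 1) (lolli X X) ++
      List.replicate ((1 :: S).count 0) (lolli X X))) (hc := by simp [List.replicate_succ])
    (hp' := by simp [List.replicate_succ]))
  refine Eq.trans ?_ (congrArg (fun τ => collect₂ _ _ _ τ _)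
    (lolliL_eq (hp := rfl) (hc := by simp [List.replicate_succ]) _))
  refine collect₂_congr (mk (composeProof X (1 :: S))) ?_ ?_ <;> simp

/-- A first digit `0` applies a copy of the second `!(X ⊸ X)`. -/
theorem body_zero (S : List (Fin 2)) :
    body X (0 :: S) = left [X, bang (lolli X X)] [] (.ctr _)
      (left [X] [bang (lolli X X)] (.exch [bang _] [bang _])
        (cut [] [bang (lolli X X), bang (lolli X X)] (apply X) (body X S) rfl rfl) rfl rfl)
        rfl rfl := by
  refine Eq.trans ?_ (collect₂_zero (eval X) (mk (composeProof X S)) rfl (hq := rfl) (hc := rfl)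
    (hd := by simp)
    (Θ₂ := X :: (List.replicate ((0 :: S).count 1) (lolli X X) ++
      List.replicate ((0 :: S).count 0) (lolli X X))) (hd' := by simp [List.replicate_succ])
    (hp' := by simp [List.replicate_succ]))
  refine Eq.trans ?_ (congrArg (fun τ => collect₂ _ _ _ (left _ _ _ τ _ _) _)
    (lolliL_eq (hp := rfl) (hc := rfl) _))
  refine collect₂_congr (mk (composeProof X (0 :: S))) ?_ ?_ <;> simp

end Body

/-! ### Iteration along a binary integer -/

section Iterate

variable {H X : Formula α}

theorem cut_lolliR_eval (π : Pf [X, bang H] X) :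
    cut [X] [] (lolliR π rfl : Pf [bang H] (lolli X X)) (eval X) rfl rfl = π :=
  calc _ = cut [] [] (cut [] [bang H] (ax X) π rfl rfl) (ax X) rfl rfl := lolli_lolli _ _ _
    _ = _ := (cut_ax _).trans (ax_cut _)

theorem cut_prom_apply (π : Pf [X, bang H] X) :
    cut [X] [] (prom [H] (lolliR π rfl) rfl) (apply X) rfl rfl = π :=
  (prom_der (hq := rfl) _ _).trans (cut_lolliR_eval π)

/-- The iteration of the endomorphisms `f 0` and `f 1` of `X` prescribed by a proof of
`X, !(X ⊸ X), !(X ⊸ X) ⊢ X`. -/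
def iterate (f : Fin 2 → Pf [X, bang H] X) (π : Pf [X, bang (lolli X X), bang (lolli X X)] X) :
    Pf [X, bang H] X :=
  left [X] [] (.ctr H) (cut [X] [bang H] (prom [H] (lolliR (f 1) rfl) rfl)
    (cut [X, bang (lolli X X)] [] (prom [H] (lolliR (f 0) rfl) rfl) π rfl rfl) rfl rfl) rfl rfl

theorem iterate_nil (f : Fin 2 → Pf [X, bang H] X) :
    iterate f (body X []) = weaken H (ax X) :=
  calc _ = left [X] [] (.ctr H) (cut [X] [bang H] (prom [H] (lolliR (f 1) rfl) rfl)
          (left [X] [bang H] (.wk _) (cut [X] [] (prom [H] (lolliR (f 0) rfl) rfl)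
            (left [X] [] (.wk _) (ax X) rfl rfl) rfl rfl) rfl rfl) rfl rfl) rfl rfl :=
        congrArg (fun τ => left [X] [] (.ctr H) (cut [X] [bang H] _ τ _ _) _ _)
          (cut_left₂ _ _ _ [])
    _ = left [X] [] (.ctr H) (cut [X] [bang H] (prom [H] (lolliR (f 1) rfl) rfl)
          (left [X] [bang H] (.wk _) (weaken H (ax X)) rfl rfl) rfl rfl) rfl rfl :=
        congrArg (fun τ => left [X] [] (.ctr H) (cut [X] [bang H] _ (left _ _ _ τ _ _) _ _) _ _)
          (prom_wk_singleton _ _)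
    _ = left [X] [] (.ctr H) (left [X] [bang H] (.wk H) (weaken H (ax X)) rfl rfl) rfl rfl :=
        congrArg (fun τ => left [X] [] (.ctr H) τ _ _) (prom_wk_singleton _ _)
    _ = _ := ctr_wk _

theorem ctr_ctr_cut (π : Pf [X, bang H] X) (ρ : Pf [X, bang H, bang H] X) :
    left [X] [] (.ctr H) (left [X] [bang H] (.ctr H) (cut [] [bang H, bang H] π ρ rfl rfl)
      rfl rfl) rfl rfl = comp π (left [X] [] (.ctr H) ρ rfl rfl) :=
  calc _ = left [X] [] (.ctr H) (left [X, bang H] [] (.ctr H)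
          (cut [] [bang H, bang H] π ρ rfl rfl) rfl rfl) rfl rfl := ctr_ctr _
    _ = _ := congrArg (fun τ => left [X] [] (.ctr H) τ _ _) (cut_left₁ _ π ρ []).symm

theorem iterate_one (f : Fin 2 → Pf [X, bang H] X) (S : List (Fin 2)) :
    iterate f (body X (1 :: S)) = comp (f 1) (iterate f (body X S)) := by
  rw [body_one]
  set E := lolli X X
  set π₀ : Pf [bang H] (bang E) := prom [H] (lolliR (f 0) rfl) rfl
  set π₁ : Pf [bang H] (bang E) := prom [H] (lolliR (f 1) rfl) rfl
  set β : Pf [X, bang E, bang H] X := cut [X, bang E] [] π₀ (body X S) rfl rfl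
  have e₁ : cut [X, bang E] [] π₀ (left [X] [bang E] (.ctr E)
      (cut [] [bang E, bang E] (apply X) (body X S) rfl rfl) rfl rfl) rfl rfl =
      left [X] [bang H] (.ctr E) (cut [] [bang E, bang H] (apply X) β rfl rfl) rfl rfl :=
    calc _ = left [X] [bang H] (.ctr E) (cut [X, bang E, bang E] [] π₀
            (cut [] [bang E, bang E] (apply X) (body X S) rfl rfl) rfl rfl) rfl rfl :=
          cut_left₂ _ _ _ []
      _ = _ := by
          refine congrArg (fun τ => left [X] [bang H] (.ctr E) τ _ _) ?_
          exact (cut_cut_comm (Δ₁ := []) (Δ₃ := []) (apply X) π₀ (body X S) [bang E]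
            rfl rfl rfl rfl).symm
  have e₂ : cut [X] [bang H] π₁ (left [X] [bang H] (.ctr E)
      (cut [] [bang E, bang H] (apply X) β rfl rfl) rfl rfl) rfl rfl =
      left [X] [bang H] (.ctr H) (cut [] [bang H, bang H] (f 1)
        (cut [X] [bang H] π₁ β rfl rfl) rfl rfl) rfl rfl :=
    calc _ = left [X] [bang H] (.ctr H) (cut [X, bang H] [bang H] π₁
            (cut [X] [bang E, bang H] π₁ (cut [] [bang E, bang H] (apply X) β rfl rfl)
              rfl rfl) rfl rfl) rfl rfl := prom_ctr_singleton _ _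
      _ = left [X] [bang H] (.ctr H) (cut [X, bang H] [bang H] π₁
            (cut [] [bang E, bang H] (cut [X] [] π₁ (apply X) rfl rfl) β rfl rfl)
              rfl rfl) rfl rfl :=
          congrArg (fun τ => left [X] [bang H] (.ctr H) (cut _ _ π₁ τ _ _) _ _)
            (cut_cut _ _ _).symm
      _ = left [X] [bang H] (.ctr H) (cut [X, bang H] [bang H] π₁
            (cut [] [bang E, bang H] (f 1) β rfl rfl) rfl rfl) rfl rfl :=
          congrArg (fun τ => left [X] [bang H] (.ctr H) (cut _ _ π₁ (cut _ _ τ β _ _) _ _) _ _)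
            (cut_prom_apply _)
      _ = _ := congrArg (fun τ => left [X] [bang H] (.ctr H) τ _ _)
            (cut_cut_comm _ _ _ []).symm
  exact (congrArg (fun τ => left [X] [] (.ctr H) (cut [X] [bang H] π₁ τ rfl rfl) rfl rfl)
    e₁).trans ((congrArg (fun τ => left [X] [] (.ctr H) τ rfl rfl) e₂).trans (ctr_ctr_cut _ _))

theorem iterate_zero (f : Fin 2 → Pf [X, bang H] X) (S : List (Fin 2)) :
    iterate f (body X (0 :: S)) = comp (f 0) (iterate f (body X S)) := by
  rw [body_zero]
  set E := lolli X X
  set π₀ : Pf [bang H] (bang E) := prom [H] (lolliR (f 0) rfl) rfl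
  set π₁ : Pf [bang H] (bang E) := prom [H] (lolliR (f 1) rfl) rfl
  set β : Pf [X, bang E, bang H] X := cut [X, bang E] [] π₀ (body X S) rfl rfl
  have e₁ : cut [X, bang E] [] π₀ (left [X, bang E] [] (.ctr E)
      (left [X] [bang E] (.exch [bang E] [bang E])
        (cut [] [bang E, bang E] (apply X) (body X S) rfl rfl) rfl rfl) rfl rfl) rfl rfl =
      left [X, bang E] [] (.ctr H) (left [X] [bang H] (.exch [bang H] [bang E])
        (cut [] [bang E, bang H] (f 0) β rfl rfl) rfl rfl) rfl rfl :=
    calc _ = left [X, bang E] [] (.ctr H) (cut [X, bang E, bang H] [] π₀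
            (cut [X, bang E] [bang E] π₀ (left [X] [bang E] (.exch [bang E] [bang E])
              (cut [] [bang E, bang E] (apply X) (body X S) rfl rfl) rfl rfl) rfl rfl)
              rfl rfl) rfl rfl := prom_ctr_singleton _ _
      _ = left [X, bang E] [] (.ctr H) (cut [X, bang E, bang H] [] π₀
            (left [X] [bang E] (.exch [bang H] [bang E]) (cut [X] [bang E, bang E] π₀
              (cut [] [bang E, bang E] (apply X) (body X S) rfl rfl) rfl rfl) rfl rfl)
              rfl rfl) rfl rfl :=
          congrArg (fun τ => left [X, bang E] [] (.ctr H) (cut _ _ π₀ τ _ _) _ _)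
            (cut_exch₁ _ _ [] [])
      _ = left [X, bang E] [] (.ctr H) (cut [X, bang E, bang H] [] π₀
            (left [X] [bang E] (.exch [bang H] [bang E])
              (cut [] [bang E, bang E] (cut [X] [] π₀ (apply X) rfl rfl) (body X S) rfl rfl)
              rfl rfl) rfl rfl) rfl rfl :=
          congrArg (fun τ => left [X, bang E] [] (.ctr H) (cut _ _ π₀ (left [X] [bang E]
            (.exch [bang H] [bang E]) τ _ _) _ _) _ _) (cut_cut _ _ _).symm
      _ = left [X, bang E] [] (.ctr H) (cut [X, bang E, bang H] [] π₀
            (left [X] [bang E] (.exch [bang H] [bang E])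
              (cut [] [bang E, bang E] (f 0) (body X S) rfl rfl) rfl rfl) rfl rfl) rfl rfl :=
          congrArg (fun τ => left [X, bang E] [] (.ctr H) (cut _ _ π₀ (left [X] [bang E]
            (.exch [bang H] [bang E]) (cut _ _ τ _ _ _) _ _) _ _) _ _) (cut_prom_apply _)
      _ = left [X, bang E] [] (.ctr H) (left [X] [bang H] (.exch [bang H] [bang E])
            (cut [X, bang H, bang E] [] π₀
              (cut [] [bang E, bang E] (f 0) (body X S) rfl rfl) rfl rfl) rfl rfl) rfl rfl :=
          congrArg (fun τ => left [X, bang E] [] (.ctr H) τ _ _) (cut_left₂ _ _ _ [])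
      _ = _ := congrArg (fun τ => left [X, bang E] [] (.ctr H) (left [X] [bang H]
            (.exch [bang H] [bang E]) τ _ _) _ _) (cut_cut_comm _ _ _ [bang E]).symm
  have e₂ : cut [X] [bang H] π₁ (left [X, bang E] [] (.ctr H)
      (left [X] [bang H] (.exch [bang H] [bang E])
        (cut [] [bang E, bang H] (f 0) β rfl rfl) rfl rfl) rfl rfl) rfl rfl =
      left [X, bang H] [] (.ctr H) (left [X] [bang H] (.exch [bang H] [bang H])
        (cut [] [bang H, bang H] (f 0) (cut [X] [bang H] π₁ β rfl rfl) rfl rfl) rfl rfl)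
        rfl rfl :=
    calc _ = left [X, bang H] [] (.ctr H) (cut [X] [bang H, bang H] π₁
            (left [X] [bang H] (.exch [bang H] [bang E])
              (cut [] [bang E, bang H] (f 0) β rfl rfl) rfl rfl) rfl rfl) rfl rfl :=
          cut_left₁ _ _ _ []
      _ = left [X, bang H] [] (.ctr H) (left [X] [bang H] (.exch [bang H] [bang H])
            (cut [X, bang H] [bang H] π₁
              (cut [] [bang E, bang H] (f 0) β rfl rfl) rfl rfl) rfl rfl) rfl rfl :=
          congrArg (fun τ => left [X, bang H] [] (.ctr H) τ _ _) (cut_exch₂ _ _ [] [])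
      _ = _ := congrArg (fun τ => left [X, bang H] [] (.ctr H) (left [X] [bang H]
            (.exch [bang H] [bang H]) τ _ _) _ _) (cut_cut_comm _ _ _ []).symm
  refine (congrArg (fun τ => left [X] [] (.ctr H) (cut [X] [bang H] π₁ τ rfl rfl) rfl rfl)
    e₁).trans ((congrArg (fun τ => left [X] [] (.ctr H) τ rfl rfl) e₂).trans ?_)
  -- by associativity, the exchanged hypotheses are contracted first, which absorbs the exchange
  calc _ = left [X] [] (.ctr H) (left [X] [bang H] (.ctr H) (left [X] [bang H]
          (.exch [bang H] [bang H]) (cut [] [bang H, bang H] (f 0)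
            (cut [X] [bang H] π₁ β rfl rfl) rfl rfl) rfl rfl) rfl rfl) rfl rfl := (ctr_ctr _).symm
    _ = left [X] [] (.ctr H) (left [X] [bang H] (.ctr H) (cut [] [bang H, bang H] (f 0)
            (cut [X] [bang H] π₁ β rfl rfl) rfl rfl) rfl rfl) rfl rfl :=
        congrArg (fun τ => left [X] [] (.ctr H) τ _ _) (ctr_exch _)
    _ = _ := ctr_ctr_cut _ _

/-- Cutting the promotions of `f 0` and `f 1` into a binary integer gives the word in `f 0` and
`f 1` that it spells. -/
theorem iterate_body (f : Fin 2 → Pf [X, bang H] X) (S : List (Fin 2)) :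
    iterate f (body X S) = word f S := by
  induction S with
  | nil => exact iterate_nil f
  | cons i S ih =>
    rw [word, ← ih]
    match i with
    | 0 => exact iterate_zero f S
    | 1 => exact iterate_one f S

end Iterate

/-! ### Binary integers as words in two letters -/

section Pairing

variable {P Q X : Formula α}

/-- The proof of `!P, !Q ⊢ !(P & Q)`. -/
def pairing (P Q : Formula α) : Pf [bang P, bang Q] (bang (amp P Q)) :=
  prom [P, Q] (ampR (left [bang P] [] (.wk Q) (left [] [] (.der P) (ax P) rfl rfl) rfl rfl)
    (left [] [bang Q] (.wk P) (left [] [] (.der Q) (ax Q) rfl rfl) rfl rfl)) rfl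

theorem cut_prom_der_ax {A : Formula α} (π : Pf [] A) :
    cut [] [] (prom [] π rfl) (left [] [] (.der A) (ax A) rfl rfl) rfl rfl = π :=
  (prom_der (hq := rfl) _ _).trans (cut_ax _)

/-- Cutting two closed promotions against `pairing` gives the promotion of the pair. -/
theorem cut_cut_pairing (π : Pf [] P) (ρ : Pf [] Q) :
    cut [] [] (prom [] π rfl) (cut [bang P] [] (prom [] ρ rfl) (pairing P Q) rfl rfl) rfl rfl =
      prom [] (ampR π ρ) rfl := by
  refine (congrArg (fun τ => cut [] [] (prom [] π rfl) τ rfl rfl)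
    (prom_prom (Λ' := [P]) (hq := rfl) ρ _ [P] [])).trans ?_
  refine (prom_prom (Λ' := []) (hq := rfl) π _ [] []).trans ?_
  refine congrArg (fun τ => prom [] τ rfl) ?_
  refine (congrArg (fun τ => cut [] [] (prom [] π rfl) τ rfl rfl) (cut_ampR _ _ _)).trans ?_
  refine (cut_ampR _ _ _).trans (congrArg₂ ampR ?_ ?_)
  · exact (congrArg (fun τ => cut [] [] (prom [] π rfl) τ rfl rfl) (prom_wk_nil ρ _)).trans
      (cut_prom_der_ax π)
  · refine (congrArg (fun τ => cut [] [] (prom [] π rfl) τ rfl rfl)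
      (cut_left₂ (hq := rfl) (hd := rfl) (hq' := rfl) (hd' := rfl) _ _ _ [])).trans ?_
    exact (prom_wk_nil π _).trans (cut_prom_der_ax ρ)

/-- The endomorphisms of `X` given by the two components of `!((X ⊸ X) & (X ⊸ X))`; the first
component belongs to the digit `1`. -/
def letter (X : Formula α) : Fin 2 → Pf [X, bang (amp (lolli X X) (lolli X X))] X :=
  ![left [X] [] (.der _) (left [X] [] (.amp₁ _ _) (eval X) rfl rfl) rfl rfl,
    left [X] [] (.der _) (left [X] [] (.amp₀ _ _) (eval X) rfl rfl) rfl rfl]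

theorem cut_der_eval : cut [X] [] (left [] [] (.der (lolli X X)) (ax _) rfl rfl) (eval X) rfl rfl =
    apply X :=
  (left_cut (hd := rfl) (hq := rfl) (hd' := rfl) _ _ _).trans
    (congrArg (fun τ => left [X] [] (.der (lolli X X)) τ rfl rfl) (ax_cut _))

theorem pairing_letter_one : cut [X] [] (pairing _ _) (letter X 1) rfl rfl =
    left [X, bang (lolli X X)] [] (.wk _) (apply X) rfl rfl :=
  calc _ = cut [X] [] _ (left [X] [] (.amp₀ _ _) (eval X) rfl rfl) rfl rfl := prom_der _ _
    _ = cut [X] [] (left [bang (lolli X X)] [] (.wk (lolli X X))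
          (left [] [] (.der (lolli X X)) (ax _) rfl rfl) rfl rfl) (eval X) rfl rfl := amp_amp₀ _ _ _
    _ = left [X, bang (lolli X X)] [] (.wk _) (cut [X] []
          (left [] [] (.der (lolli X X)) (ax _) rfl rfl) (eval X) rfl rfl) rfl rfl := left_cut _ _ _
    _ = _ := congrArg (fun τ => left [X, bang (lolli X X)] [] (.wk _) τ rfl rfl) cut_der_eval

theorem pairing_letter_zero : cut [X] [] (pairing _ _) (letter X 0) rfl rfl =
    left [X] [bang (lolli X X)] (.wk _) (apply X) rfl rfl :=
  calc _ = cut [X] [] _ (left [X] [] (.amp₁ _ _) (eval X) rfl rfl) rfl rfl := prom_der _ _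
    _ = cut [X] [] (left [] [bang (lolli X X)] (.wk (lolli X X))
          (left [] [] (.der (lolli X X)) (ax _) rfl rfl) rfl rfl) (eval X) rfl rfl := amp_amp₁ _ _ _
    _ = left [X] [bang (lolli X X)] (.wk _) (cut [X] []
          (left [] [] (.der (lolli X X)) (ax _) rfl rfl) (eval X) rfl rfl) rfl rfl := left_cut _ _ _
    _ = _ := congrArg (fun τ => left [X] [bang (lolli X X)] (.wk _) τ rfl rfl) cut_der_eval

/-- Substituting a pair into a composite: the contraction of `!(P & Q)` becomes contractions of
`!P` and of `!Q`. -/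
theorem pairing_comp {Y Z : Formula α} (π : Pf [X, bang (amp P Q)] Y)
    (ρ : Pf [Y, bang (amp P Q)] Z) :
    cut [X] [] (pairing P Q) (comp π ρ) rfl rfl =
      left [X, bang P] [] (.ctr Q) (left [X] [bang Q, bang Q] (.ctr P)
        (left [X, bang P] [bang Q] (.exch [bang Q] [bang P])
          (cut [] [bang P, bang Q] (cut [X] [] (pairing P Q) π rfl rfl)
            (cut [Y] [] (pairing P Q) ρ rfl rfl) rfl rfl) rfl rfl) rfl rfl) rfl rfl := by
  refine (prom_ctr_pair (hq := rfl) (hd := rfl) (hq' := rfl) (hd' := rfl) _ _).trans ?_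
  refine congrArg (fun τ => left [X, bang P] [] (.ctr Q) (left [X] [bang Q, bang Q] (.ctr P)
        (left [X, bang P] [bang Q] (.exch [bang Q] [bang P]) τ rfl rfl) rfl rfl) rfl rfl) ?_
  calc _ = cut [X, bang P, bang Q] [] (pairing P Q) (cut [] [bang (amp P Q)]
          (cut [X] [] (pairing P Q) π rfl rfl) ρ rfl rfl) rfl rfl :=
        congrArg (fun τ => cut [X, bang P, bang Q] [] (pairing P Q) τ rfl rfl)
          (cut_cut _ π ρ).symm
    _ = _ := (cut_cut_comm _ _ _ []).symm

/-- The word in the two components of `!((X ⊸ X) & (X ⊸ X))` spelled by `S` is the proof underlying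
the binary integer `S`. -/
theorem pairing_word (S : List (Fin 2)) :
    cut [X] [] (pairing _ _) (word (letter X) S) rfl rfl = body X S := by
  set E := lolli X X
  have key (i : Fin 2) (S : List (Fin 2))
      (ih : cut [X] [] (pairing _ _) (word (letter X) S) rfl rfl = body X S) :
      cut [X] [] (pairing E E) (word (letter X) (i :: S)) rfl rfl =
        left [X, bang E] [] (.ctr E) (left [X] [bang E, bang E] (.ctr E)
          (left [X, bang E] [bang E] (.exch [bang E] [bang E])
            (cut [] [bang E, bang E] (cut [X] [] (pairing E E) (letter X i) rfl rfl)
              (body X S) rfl rfl) rfl rfl) rfl rfl) rfl rfl := by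
    rw [← ih]
    exact pairing_comp _ _
  induction S with
  | nil => exact prom_wk_pair (Δ₁ := [X]) (Δ₂ := []) _ (ax X)
  | cons i S ih =>
    refine (key i S ih).trans ?_
    match i with
    | 0 =>
      -- the contraction of the first `!E` is undone by the weakening of `letter X 0`
      refine Eq.trans ?_ (body_zero S).symm
      refine congrArg (fun τ => left [X, bang E] [] (.ctr E) τ rfl rfl) ?_
      calc _ = left [X] [bang E, bang E] (.ctr E)
              (left [X, bang E] [bang E] (.exch [bang E] [bang E])
                (cut [] [bang E, bang E] (left [X] [bang E] (.wk E) (apply X) rfl rfl)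
                  (body X S) rfl rfl) rfl rfl) rfl rfl :=
            congrArg (fun τ => left [X] [bang E, bang E] (.ctr E)
              (left [X, bang E] [bang E] (.exch [bang E] [bang E])
                (cut [] [bang E, bang E] τ (body X S) rfl rfl) rfl rfl) rfl rfl) pairing_letter_zero
        _ = left [X] [bang E, bang E] (.ctr E)
              (left [X, bang E] [bang E] (.exch [bang E] [bang E])
                (left [X] [bang E, bang E, bang E] (.wk E) (cut [] [bang E, bang E] (apply X)
                  (body X S) rfl rfl) rfl rfl) rfl rfl) rfl rfl :=
            congrArg (fun τ => left [X] [bang E, bang E] (.ctr E)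
              (left [X, bang E] [bang E] (.exch [bang E] [bang E]) τ rfl rfl) rfl rfl)
              (left_cut _ _ _)
        _ = left [X] [bang E, bang E] (.ctr E)
              (left [X] [bang E, bang E, bang E] (.wk E)
                (left [X] [bang E] (.exch [bang E] [bang E]) (cut [] [bang E, bang E] (apply X)
                  (body X S) rfl rfl) rfl rfl) rfl rfl) rfl rfl :=
            congrArg (fun τ => left [X] [bang E, bang E] (.ctr E) τ rfl rfl)
              (left_app (.wk E) (.ofRule (.exch [bang E] [bang E])) _ []).symm
        _ = _ := ctr_wk _
    | 1 =>
      -- the contraction of the second `!E` is undone by the weakening of `letter X 1`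
      refine Eq.trans ?_ (body_one S).symm
      calc _ = left [X, bang E] [] (.ctr E) (left [X] [bang E, bang E] (.ctr E)
              (left [X, bang E] [bang E] (.exch [bang E] [bang E])
                (cut [] [bang E, bang E] (left [X, bang E] [] (.wk E) (apply X) rfl rfl)
                  (body X S) rfl rfl) rfl rfl) rfl rfl) rfl rfl :=
            congrArg (fun τ => left [X, bang E] [] (.ctr E) (left [X] [bang E, bang E] (.ctr E)
              (left [X, bang E] [bang E] (.exch [bang E] [bang E])
                (cut [] [bang E, bang E] τ (body X S) rfl rfl) rfl rfl) rfl rfl) rfl rfl)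
              pairing_letter_one
        _ = left [X, bang E] [] (.ctr E) (left [X] [bang E, bang E] (.ctr E)
              (left [X, bang E] [bang E] (.exch [bang E] [bang E])
                (left [X, bang E] [bang E, bang E] (.wk E) (cut [] [bang E, bang E] (apply X)
                  (body X S) rfl rfl) rfl rfl) rfl rfl) rfl rfl) rfl rfl :=
            congrArg (fun τ => left [X, bang E] [] (.ctr E) (left [X] [bang E, bang E] (.ctr E)
              (left [X, bang E] [bang E] (.exch [bang E] [bang E]) τ rfl rfl) rfl rfl) rfl rfl)
              (left_cut _ _ _)
        _ = left [X, bang E] [] (.ctr E) (left [X] [bang E, bang E] (.ctr E)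
              (left [X, bang E, bang E] [bang E] (.wk E)
                (left [X, bang E] [bang E] (.exch [] [bang E])
                  (cut [] [bang E, bang E] (apply X)
                  (body X S) rfl rfl) rfl rfl) rfl rfl) rfl rfl) rfl rfl :=
            congrArg (fun τ => left [X, bang E] [] (.ctr E) (left [X] [bang E, bang E] (.ctr E)
              τ rfl rfl) rfl rfl)
              ((BlockMap.ofRule (.wk E)).exch_app₁ _ [] [])
        _ = left [X, bang E] [] (.ctr E) (left [X] [bang E, bang E] (.ctr E)
              (left [X, bang E, bang E] [bang E] (.wk E)
                (cut [] [bang E, bang E] (apply X) (body X S) rfl rfl) rfl rfl) rfl rfl) rfl rfl :=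
            congrArg (fun τ => left [X, bang E] [] (.ctr E) (left [X] [bang E, bang E] (.ctr E)
              (left [X, bang E, bang E] [bang E] (.wk E) τ rfl rfl) rfl rfl) rfl rfl) (nil_exch _)
        _ = left [X, bang E] [] (.ctr E) (left [X, bang E] [bang E] (.wk E)
              (left [X] [bang E] (.ctr E)
                (cut [] [bang E, bang E] (apply X) (body X S) rfl rfl) rfl rfl) rfl rfl) rfl rfl :=
            congrArg (fun τ => left [X, bang E] [] (.ctr E) τ rfl rfl)
              (left_app (.ctr E) (.ofRule (.wk E)) _ [])
        _ = _ := ctr_wk _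

end Pairing

/-! ### Definable families of proofs -/

section Definable

variable {ι : Type*} {B : Formula α} {x : ι → Pf [] B}
  {P Q Γ Θ Ξ Δ₁ Δ₂ : List (Formula α)} {A C : Formula α}

/-- A family of proofs of `Γ ⊢ C` is definable from a family `x` of proofs of `⊢ B` if it is
obtained from the promotions of the proofs `x i` by cuts against a single proof of `Γ, !B ⊢ C`. -/
def Definable (x : ι → Pf [] B) (F : ι → Pf Γ C) : Prop :=
  ∃ π : Pf (Γ ++ [bang B]) C, ∀ i, cut Γ [] (prom [] (x i) rfl) π rfl (by simp) = F i

namespace Definable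

theorem congr {F G : ι → Pf Γ C} (h : Definable x F) (e : ∀ i, F i = G i) : Definable x G :=
  funext e ▸ h

/-- The promotion of `x i` is erased by a weakening. -/
theorem const (σ : Pf Γ C) : Definable x fun _ => σ :=
  ⟨left Γ [] (.wk B) σ (by simp) (by simp), fun _ => prom_wk_nil _ _⟩

/-- Both families use the same hypothesis `!B`, by contraction. -/
protected theorem cut {F : ι → Pf Γ A} {G : ι → Pf Θ C} (hF : Definable x F) (hG : Definable x G)
    (hp : Θ = Δ₁ ++ A :: Δ₂) (hc : Ξ = Δ₁ ++ Γ ++ Δ₂) :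
    Definable x fun i => cut Δ₁ Δ₂ (F i) (G i) hp hc := by
  obtain ⟨π, hπ⟩ := hF
  obtain ⟨ρ, hρ⟩ := hG
  subst hp hc
  refine ⟨left (Δ₁ ++ Γ ++ Δ₂) [] (.ctr B) (left (Δ₁ ++ Γ) [bang B] (.exch [bang B] Δ₂)
    (cut Δ₁ (Δ₂ ++ [bang B]) π ρ (by simp) rfl) (by simp) rfl) (by simp) (by simp), fun i => ?_⟩
  simp only [← hπ, ← hρ]
  set p : Pf [] (bang B) := prom [] (x i) rfl
  calc _ = cut (Δ₁ ++ Γ ++ Δ₂) [] p (cut (Δ₁ ++ Γ ++ Δ₂) [bang B] p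
          (left (Δ₁ ++ Γ) [bang B] (.exch [bang B] Δ₂)
            (cut Δ₁ (Δ₂ ++ [bang B]) π ρ (by simp) rfl) (by simp) rfl) (by simp) (by simp)
              : Pf (Δ₁ ++ Γ ++ Δ₂ ++ [bang B]) C) (by simp) (by simp) := prom_ctr_nil _ _
    _ = cut (Δ₁ ++ Γ ++ Δ₂) [] p (left (Δ₁ ++ Γ) [bang B] (.exch [] Δ₂)
          (cut (Δ₁ ++ Γ) (Δ₂ ++ [bang B]) p
            (cut Δ₁ (Δ₂ ++ [bang B]) π ρ (by simp) rfl) (by simp) (by simp)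
              : Pf (Δ₁ ++ Γ ++ Δ₂ ++ [bang B]) C) (by simp) (by simp)
              : Pf (Δ₁ ++ Γ ++ Δ₂ ++ [bang B]) C) (by simp) (by simp) :=
        by
        refine congrArg (fun τ => cut (Δ₁ ++ Γ ++ Δ₂) [] p τ _ _) ?_
        exact cut_exch₁ _ _ [] []
    _ = cut (Δ₁ ++ Γ ++ Δ₂) [] p
          (cut (Δ₁ ++ Γ) (Δ₂ ++ [bang B]) p
            (cut Δ₁ (Δ₂ ++ [bang B]) π ρ (by simp) rfl) (by simp) (by simp)
              : Pf (Δ₁ ++ Γ ++ Δ₂ ++ [bang B]) C) (by simp) (by simp) := by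
        refine congrArg (fun τ => cut (Δ₁ ++ Γ ++ Δ₂) [] p τ _ _) ?_
        exact nil_exch _
    _ = cut (Δ₁ ++ Γ ++ Δ₂) [] p
          (cut Δ₁ (Δ₂ ++ [bang B]) (cut Γ [] p π rfl (by simp)) ρ (by simp) (by simp)
              : Pf (Δ₁ ++ Γ ++ Δ₂ ++ [bang B]) C) (by simp) (by simp) := by
        refine congrArg (fun τ => cut (Δ₁ ++ Γ ++ Δ₂) [] p τ _ _) ?_
        exact (cut_cut p π ρ).symm
    _ = _ := (cut_cut_comm _ _ _ Δ₂).symm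

protected theorem left {F : ι → Pf Θ C} (hF : Definable x F) (r : LeftRule P Q)
    (hp : Θ = Δ₁ ++ P ++ Δ₂) (hc : Ξ = Δ₁ ++ Q ++ Δ₂) :
    Definable x fun i => left Δ₁ Δ₂ r (F i) hp hc := by
  obtain ⟨π, hπ⟩ := hF
  subst hp hc
  refine ⟨left Δ₁ (Δ₂ ++ [bang B]) r π (by simp) (by simp), fun i => ?_⟩
  simp only [← hπ]
  exact cut_left₂ _ _ _ Δ₂

protected theorem ampR {F : ι → Pf Γ A} {G : ι → Pf Γ C} (hF : Definable x F)
    (hG : Definable x G) : Definable x fun i => ampR (F i) (G i) := by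
  obtain ⟨π, hπ⟩ := hF
  obtain ⟨ρ, hρ⟩ := hG
  refine ⟨ampR π ρ, fun i => ?_⟩
  simp only [← hπ, ← hρ]
  exact cut_ampR _ _ _

protected theorem lolliR {F : ι → Pf Θ C} (hF : Definable x F) (hp : Θ = A :: Γ) :
    Definable x fun i => lolliR (F i) hp := by
  obtain ⟨π, hπ⟩ := hF
  subst hp
  refine ⟨lolliR π rfl, fun i => ?_⟩
  simp only [← hπ]
  exact cut_lolliR _ _

protected theorem prom {F : ι → Pf [] C} (hF : Definable x F) :
    Definable x fun i => prom [] (F i) rfl := by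
  obtain ⟨π, hπ⟩ := hF
  refine ⟨prom [B] π rfl, fun i => ?_⟩
  simp only [← hπ]
  exact prom_prom _ _ [] []

protected theorem tensR {F : ι → Pf [] A} {G : ι → Pf [] C} (hF : Definable x F)
    (hG : Definable x G) : Definable x fun i => tensR (F i) (G i) rfl := by
  -- a tensor product of proofs is obtained by cuts from the one of axioms
  have h : ∀ i, cut [] [] (F i) (cut [A] [] (G i) (tensR (ax A) (ax C) rfl) rfl rfl) rfl rfl =
      tensR (F i) (G i) rfl := fun i => by
    rw [cut_tensR₂ (Δ₁ := []) (hq := rfl) (hd := rfl) (ht' := rfl), cut_ax,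
      cut_tensR₁ (Δ₂ := []) (hq := rfl) (hd := rfl) (ht' := rfl), cut_ax]
  simp only [← h]
  exact hF.cut (Δ₁ := []) (Δ₂ := []) (hG.cut (Δ₁ := [A]) (Δ₂ := []) (const _) rfl rfl) rfl rfl

end Definable

/-- By dereliction, the family `x` is definable from itself. -/
theorem definable_self : Definable x x :=
  ⟨left [] [] (.der B) (ax B) rfl rfl, fun i => cut_prom_der_ax (x i)⟩

end Definable

/-! ### Selection, and removal of the last digit -/

section Projections

variable {Γ : List (Formula α)} {A B C D H X : Formula α}

/-- Composition of a proof with a proof that has a single hypothesis. -/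
def seq (π : Pf Γ A) (ρ : Pf [A] B) : Pf Γ B := cut [] [] π ρ rfl (by simp)

theorem seq_assoc (π : Pf Γ A) (ρ : Pf [A] B) (σ : Pf [B] C) :
    seq (seq π ρ) σ = seq π (seq ρ σ) :=
  cut_cut _ _ _

theorem seq_ax (π : Pf Γ A) : seq π (ax A) = π := cut_ax _

theorem seq_ampR (π : Pf Γ A) (ρ : Pf [A] B) (σ : Pf [A] C) :
    seq π (ampR ρ σ) = ampR (seq π ρ) (seq π σ) :=
  cut_ampR _ _ _

/-- The first projection. -/
def fst (A B : Formula α) : Pf [amp A B] A := left [] [] (.amp₀ A B) (ax A) rfl rfl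

/-- The second projection. -/
def snd (A B : Formula α) : Pf [amp A B] B := left [] [] (.amp₁ A B) (ax B) rfl rfl

theorem ampR_seq_fst (π : Pf Γ A) (ρ : Pf Γ B) : seq (ampR π ρ) (fst A B) = π :=
  cut_ampR_amp₀ π ρ

theorem ampR_seq_snd (π : Pf Γ A) (ρ : Pf Γ B) : seq (ampR π ρ) (snd A B) = ρ :=
  cut_ampR_amp₁ π ρ

/-- The second of three components. -/
def mid (A B C : Formula α) : Pf [amp A (amp B C)] B := seq (snd A (amp B C)) (fst B C)

/-- The third of three components. -/
def trd (A B C : Formula α) : Pf [amp A (amp B C)] C := seq (snd A (amp B C)) (snd B C)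

theorem ampR_seq_mid (π : Pf Γ A) (ρ : Pf Γ B) (σ : Pf Γ C) :
    seq (ampR π (ampR ρ σ)) (mid A B C) = ρ := by
  rw [mid, ← seq_assoc, ampR_seq_snd, ampR_seq_fst]

theorem ampR_seq_trd (π : Pf Γ A) (ρ : Pf Γ B) (σ : Pf Γ C) :
    seq (ampR π (ampR ρ σ)) (trd A B C) = σ := by
  rw [trd, ← seq_assoc, ampR_seq_snd, ampR_seq_snd]

/-- The composite of the closed endomorphisms `h i`, for the digits `i` of a binary sequence. -/
def closedWord (h : Fin 2 → Pf [X] X) : List (Fin 2) → Pf [X] X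
  | [] => ax X
  | i :: S => seq (h i) (closedWord h S)

theorem word_weaken (h : Fin 2 → Pf [X] X) (S : List (Fin 2)) :
    word (fun i => weaken H (h i)) S = weaken H (closedWord h S) := by
  induction S with
  | nil => rfl
  | cons i S ih =>
    rw [word, ih, comp_weaken]
    exact left_cut (Υ₁ := [X]) (Υ₂ := []) (Δ₁ := []) (Δ₂ := [])
      (Λ₁ := [X]) (Λ₂ := []) (hd := rfl) (hq := rfl)
      (hd' := rfl) _ _ _

theorem word_concat (f : Fin 2 → Pf [X, bang H] X) (S : List (Fin 2)) (i : Fin 2) :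
    word f (S ++ [i]) = comp (word f S) (f i) := by
  rw [word_append, word, word, comp_weaken_ax]

/-- The endomorphism of `A³` that keeps the first two components and replaces the third one by the
component of index `i`. -/
def choose (A : Formula α) (i : Fin 2) : Pf [amp A (amp A A)] (amp A (amp A A)) :=
  ampR (fst _ _) (ampR (mid _ _ _) (![fst _ _, mid _ _ _] i))

theorem seq_choose (F : Fin 2 → Pf Γ A) (π : Pf Γ A) (i : Fin 2) :
    seq (ampR (F 0) (ampR (F 1) π)) (choose A i) = ampR (F 0) (ampR (F 1) (F i)) := by
  rw [choose, seq_ampR, seq_ampR, ampR_seq_fst, ampR_seq_mid]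
  match i with
  | 0 => exact congrArg (fun τ => ampR _ (ampR _ τ)) (ampR_seq_fst _ _)
  | 1 => exact congrArg (fun τ => ampR _ (ampR _ τ)) (ampR_seq_mid _ _ _)

/-- Reading the digits of `S` one after the other, the third component remembers the last digit. -/
theorem seq_closedWord_choose (F : Fin 2 → Pf Γ A) (S : List (Fin 2)) (d : Fin 2) :
    seq (ampR (F 0) (ampR (F 1) (F d))) (closedWord (choose A) S) =
      ampR (F 0) (ampR (F 1) (F (S.getLastD d))) := by
  induction S generalizing d with
  | nil => exact seq_ax _
  | cons i S ih => rw [closedWord, ← seq_assoc, seq_choose, ih, List.getLastD_cons]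

/-- The endomorphism of `A³` that replaces components `⟨u, v, w⟩` by `⟨v, v · f i, v · f i⟩`. The
third component is not used. -/
def shift (f : Fin 2 → Pf [A, bang H] A) (i : Fin 2) :
    Pf [amp A (amp A A), bang H] (amp A (amp A A)) :=
  ampR (weaken H (mid _ _ _)) (ampR (cut [] [bang H] (mid _ _ _) (f i) rfl rfl)
    (cut [] [bang H] (mid _ _ _) (f i) rfl rfl))

theorem comp_shift (f : Fin 2 → Pf [A, bang H] A) (i : Fin 2)
    (π : Pf [X, bang H] (amp A (amp A A))) :
    comp π (shift f i) = ampR (seq π (mid _ _ _))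
      (ampR (comp (seq π (mid _ _ _)) (f i)) (comp (seq π (mid _ _ _)) (f i))) := by
  rw [shift, comp_ampR, comp_ampR, comp_weaken, comp_cut]
  rfl

/-- Reading the digits of `S` one after the other, the first component lags behind by one digit. -/
theorem comp_word_shift (f : Fin 2 → Pf [A, bang H] A) (S : List (Fin 2)) :
    comp (weaken H (ampR (ax A) (ampR (ax A) (ax A)))) (word (shift f) S) =
      ampR (word f S.dropLast) (ampR (word f S) (word f S)) := by
  induction S using List.reverseRecOn with
  | nil =>
    refine (comp_weaken_ax _).trans ((left_ampR _ _ _).trans ?_)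
    exact congrArg (ampR _) (left_ampR _ _ _)
  | append_singleton S i ih =>
    rw [word_concat, ← comp_assoc, ih, comp_shift, ampR_seq_mid, word_concat,
      List.dropLast_concat]

/-- The proof of `Γ ⊢ A ^ n` with the components `F 0, …, F (n - 1)`, for `n ≥ 1`. -/
def tuple : (m : ℕ) → (Fin (m + 1) → Pf Γ A) → Pf Γ (A.pow (m + 1))
  | 0, F => F 0
  | m + 1, F => ampR (F 0) (tuple m fun j => F j.succ)

theorem seq_tuple_proj : ∀ (m : ℕ) (F : Fin (m + 1) → Pf Γ A) (j : Fin (m + 1)),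
    seq (tuple m F) (mk (projProof A (m + 1) j)) = F j
  | 0, F, j => by
    obtain rfl : j = 0 := Subsingleton.elim (α := Fin 1) _ _
    exact seq_ax _
  | m + 1, F, j => by
    cases j using Fin.cases with
    | zero => exact cut_ampR_amp₀ _ _
    | succ j => exact (amp_amp₁ (hq := rfl) _ _ _).trans (seq_tuple_proj m _ j)

end Projections

section Data

variable {ι : Type*} {B A H X : Formula α} {x : ι → Pf [] B} {Γ : List (Formula α)}
  {S : ι → List (Fin 2)}

/-- The proof that applies a binary integer to two functions and an argument. The function for the
digit `0` is the first argument of the binary integer, but the second function in the context. -/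
def applyBint (X : Formula α) : Pf [X, bang (lolli X X), bang (lolli X X), bint X] X :=
  lolliL (B := lolli (bang (lolli X X)) (lolli X X)) [X, bang (lolli X X)] []
    (ax (bang (lolli X X)))
    (lolliL (B := lolli X X) [X] [] (ax (bang (lolli X X))) (eval X) rfl rfl) rfl rfl

/-- The right introductions of `⊸` in a binary integer are undone by applying it to variables. -/
theorem bint_applyBint (S : List (Fin 2)) :
    cut [X, bang (lolli X X), bang (lolli X X)] [] (mk (bintProof X S)) (applyBint X) rfl rfl =
      body X S := by
  rw [mk_bintProof]
  refine (lolli_lolli (Δ₁ := [X, bang (lolli X X)]) (Δ₂ := []) (he := rfl) (hf := rfl) (hg := rfl)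
    _ _ _).trans ?_
  refine (congrArg (fun τ => cut [X, bang (lolli X X)] [] τ _ rfl rfl) (ax_cut _)).trans ?_
  refine (lolli_lolli (Δ₁ := [X]) (Δ₂ := []) (he := rfl) (hf := rfl) (hg := rfl)
    _ _ _).trans ?_
  refine (congrArg (fun τ => cut [X] [] τ _ rfl rfl) (ax_cut _)).trans ?_
  refine (lolli_lolli (Δ₁ := []) (Δ₂ := []) (he := rfl) (hf := rfl) (hg := rfl)
    _ _ _).trans ?_
  exact (cut_ax _).trans (ax_cut _)

theorem nbool_apply {n : ℕ} (q : Fin n) :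
    cut [X.pow n] [] (mk (nboolProof X n q))
      (lolliL [] [] (ax (X.pow n)) (ax X) rfl rfl : Pf [X.pow n, nbool n X] X) rfl rfl =
      mk (projProof X n q) := by
  refine (lolli_lolli (Δ₁ := []) (Δ₂ := []) (Δ := [X.pow n])
    (Λ₁ := [X.pow n]) (he := rfl) (hf := rfl)
    (hg := rfl) (hp := rfl) (mk (projProof X n q)) (ax _) (ax _)).trans ?_
  exact (cut_ax _).trans (ax_cut _)

namespace Definable

theorem seq {A C : Formula α} {F : ι → Pf Γ A} {G : ι → Pf [A] C} (hF : Definable x F)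
    (hG : Definable x G) : Definable x fun i => Pf.seq (F i) (G i) :=
  hF.cut hG rfl (by simp)

theorem body (h : Definable x fun i => mk (bintProof X (S i))) :
    Definable x fun i => body X (S i) :=
  (h.cut (const _) rfl rfl).congr fun i => bint_applyBint (S i)

theorem word (h : Definable x fun i => mk (bintProof X (S i))) (f : Fin 2 → Pf [X, bang H] X) :
    Definable x fun i => word f (S i) := by
  simp only [← iterate_body]
  exact ((const _).cut (Δ₁ := [X]) (Δ₂ := [bang H]) ((const _).cut (Δ₁ := [X, bang (lolli X X)])
    (Δ₂ := []) h.body rfl rfl) rfl rfl).left (Δ₁ := [X]) (Δ₂ := []) _ rfl rfl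

theorem closedWord (h : Definable x fun i => mk (bintProof X (S i))) (f : Fin 2 → Pf [X] X) :
    Definable x fun i => closedWord f (S i) := by
  -- the unused hypothesis is eliminated with the identity of `X`
  have e (i : ι) : Pf.cut [X] [] (Pf.prom [] (Pf.lolliR (ax X) rfl : Pf [] (lolli X X)) rfl)
      (Pf.word (fun j => weaken (lolli X X) (f j)) (S i)) rfl rfl = Pf.closedWord f (S i) := by
    rw [word_weaken]
    exact prom_wk_nil _ _
  simp only [← e]
  exact (const _).cut (Δ₁ := [X]) (Δ₂ := []) (h.word _) rfl rfl

/-- Selection by the last digit of a binary integer. The digit is `0` if there is none, since the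
automaton starts with the third component `F 0`. -/
theorem last (h : Definable x fun i => mk (bintProof (amp A (amp A A)) (S i)))
    {F : Fin 2 → ι → Pf Γ A} (hF : ∀ d, Definable x (F d)) :
    Definable x fun i => F ((S i).getLastD 0) i := by
  refine ((((hF 0).ampR ((hF 1).ampR (hF 0))).seq (h.closedWord (choose A))).seq
    (const (trd A A A))).congr fun i => ?_
  rw [seq_closedWord_choose fun d => F d i, ampR_seq_trd]

/-- The word of a binary integer without its last digit is the first component of the state that
`comp_word_shift` computes. -/
theorem dropLast (h : Definable x fun i => mk (bintProof (amp A (amp A A)) (S i)))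
    (f : Fin 2 → Pf [A, bang H] A) : Definable x fun i => Pf.word f (S i).dropLast := by
  refine ((((const (weaken H (ampR (ax A) (ampR (ax A) (ax A))))).cut (Δ₁ := [])
    (Δ₂ := [bang H]) (h.word (shift f)) rfl rfl).left (Δ₁ := [A]) (Δ₂ := []) (.ctr H) rfl rfl).seq
    (const (fst A (amp A A)))).congr fun i => ?_
  exact (congrArg (fun τ => Pf.seq τ (fst A (amp A A))) (comp_word_shift f (S i))).trans
    (ampR_seq_fst _ _)

theorem projection {n : ℕ} {q : ι → Fin n} (h : Definable x fun i => mk (nboolProof X n (q i))) :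
    Definable x fun i => mk (projProof X n (q i)) :=
  (h.cut (const _) rfl rfl).congr fun i => nbool_apply (q i)

/-- Selection by an `n`-boolean on `A³`. It projects from tuples of formulas `A³`, so every `F j` is
tripled first. -/
theorem state {m : ℕ} {q : ι → Fin (m + 1)}
    (h : Definable x fun i => mk (nboolProof (amp A (amp A A)) (m + 1) (q i)))
    (F : Fin (m + 1) → Pf Γ A) : Definable x fun i => F (q i) := by
  refine (((const (tuple m fun j => ampR (F j) (ampR (F j) (F j)))).seq h.projection).seq
    (const (fst A (amp A A)))).congr fun i => ?_
  rw [seq_tuple_proj, ampR_seq_fst]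

end Definable

end Data

/-! ### The step of a machine -/

section Machine

variable {ι : Type*} {n : ℕ} {A C P Q R : Formula α}

/-- A family of proofs that is definable from triples of closed proofs is obtained by cuts against
a single proof from the tensor products of the promotions of the components. -/
theorem Definable.exists_cut_tensR {S : ι → Pf [] P} {T : ι → Pf [] Q} {U : ι → Pf [] R}
    {F : ι → Pf [] C} (h : Definable (fun i => ampR (S i) (ampR (T i) (U i))) F) :
    ∃ π : Pf [tens (tens (bang P) (bang Q)) (bang R)] C, ∀ i,
      cut [] [] (tensR (tensR (prom [] (S i) rfl) (prom [] (T i) rfl) rfl)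
        (prom [] (U i) rfl) rfl) π rfl rfl = F i := by
  obtain ⟨π, hπ⟩ := h
  set J : Pf [bang P, bang Q, bang R] (bang (amp P (amp Q R))) :=
    cut [bang P] [] (pairing Q R) (pairing P (amp Q R)) rfl rfl
  refine ⟨left [] [] (.tens _ _) (left [] [bang R] (.tens _ _) (cut [] [] J π rfl rfl) rfl rfl)
    rfl rfl, fun i => ?_⟩
  rw [← hπ]
  set s : Pf [] (bang P) := prom [] (S i) rfl
  set t : Pf [] (bang Q) := prom [] (T i) rfl
  set u : Pf [] (bang R) := prom [] (U i) rfl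
  have hJ : cut [] [] s (cut [bang P] [] t (cut [bang P, bang Q] [] u J rfl rfl) rfl rfl) rfl rfl =
      prom [] (ampR (S i) (ampR (T i) (U i))) rfl :=
    calc _ = cut [] [] s (cut [bang P] [] t (cut [bang P] [] (cut [bang Q] [] u (pairing Q R)
            rfl rfl) (pairing P (amp Q R)) rfl rfl) rfl rfl) rfl rfl :=
          congrArg (fun τ => cut [] [] s (cut [bang P] [] t τ rfl rfl) rfl rfl)
            (cut_cut _ _ _).symm
      _ = cut [] [] s (cut [bang P] [] (cut [] [] t (cut [bang Q] [] u (pairing Q R)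
            rfl rfl) rfl rfl) (pairing P (amp Q R)) rfl rfl) rfl rfl :=
          congrArg (fun τ => cut [] [] s τ rfl rfl) (cut_cut _ _ _).symm
      _ = cut [] [] s (cut [bang P] [] (prom [] (ampR (T i) (U i)) rfl)
            (pairing P (amp Q R)) rfl rfl) rfl rfl :=
          congrArg (fun τ => cut [] [] s (cut [bang P] [] τ _ rfl rfl) rfl rfl)
            (cut_cut_pairing _ _)
      _ = _ := cut_cut_pairing _ _
  calc _ = cut [] [] (tensR s t rfl) (cut [tens (bang P) (bang Q)] [] u (left [] [bang R]
          (.tens _ _) (cut [] [] J π rfl rfl) rfl rfl) rfl rfl) rfl rfl := tens_tens _ _ _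
    _ = cut [] [] (tensR s t rfl) (left [] [] (.tens _ _) (cut [bang P, bang Q] [] u
          (cut [] [] J π rfl rfl) rfl rfl) rfl rfl) rfl rfl :=
        congrArg (fun τ => cut [] [] (tensR s t rfl) τ rfl rfl) (cut_left₂ _ _ _ [])
    _ = cut [] [] s (cut [bang P] [] t (cut [bang P, bang Q] [] u
          (cut [] [] J π rfl rfl) rfl rfl) rfl rfl) rfl rfl := tens_tens _ _ _
    _ = cut [] [] s (cut [bang P] [] t (cut [] [] (cut [bang P, bang Q] [] u J rfl rfl) π
          rfl rfl) rfl rfl) rfl rfl :=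
        congrArg (fun τ => cut [] [] s (cut [bang P] [] t τ rfl rfl) rfl rfl) (cut_cut _ _ _).symm
    _ = cut [] [] s (cut [] [] (cut [bang P] [] t (cut [bang P, bang Q] [] u J rfl rfl)
          rfl rfl) π rfl rfl) rfl rfl :=
        congrArg (fun τ => cut [] [] s τ rfl rfl) (cut_cut _ _ _).symm
    _ = cut [] [] (cut [] [] s (cut [bang P] [] t (cut [bang P, bang Q] [] u J rfl rfl)
          rfl rfl) rfl rfl) π rfl rfl := (cut_cut _ _ _).symm
    _ = _ := congrArg (fun τ => cut [] [] τ π rfl rfl) hJ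

/-- The last digit of a binary integer may be replaced by any digits whose words are definable. -/
theorem Definable.bint {B : Formula α} {x : ι → Pf [] B} {S W : ι → List (Fin 2)}
    (hS : Definable x fun i => mk (bintProof (amp A (amp A A)) (S i)))
    (hW : ∀ f : Fin 2 → Pf [A, bang (amp (lolli A A) (lolli A A))] A,
      Definable x fun i => Pf.word f (W i)) :
    Definable x fun i => mk (bintProof A ((S i).dropLast ++ W i)) := by
  simp only [mk_bintProof, ← pairing_word, word_append]
  exact ((((const _).cut (Δ₁ := [A]) (Δ₂ := [])
    (((hS.dropLast _).cut (Δ₁ := []) (Δ₂ := [bang _]) (hW _) rfl rfl).left (Δ₁ := [A]) (Δ₂ := [])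
      _ rfl rfl) rfl rfl).lolliR rfl).lolliR rfl).lolliR rfl

/-- The triple of the encodings on `X` of the components of a configuration. -/
def components (X : Formula α) (c : Config n) : Pf [] (amp (bint X) (amp (bint X) (nbool n X))) :=
  ampR (mk (bintProof X c.S)) (ampR (mk (bintProof X c.T)) (mk (nboolProof X n c.q)))

theorem definable_S (X : Formula α) :
    Definable (components X) fun c : Config n => mk (bintProof X c.S) :=
  (definable_self.seq (.const _)).congr fun _ => ampR_seq_fst _ _

theorem definable_T (X : Formula α) :
    Definable (components X) fun c : Config n => mk (bintProof X c.T) :=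
  (definable_self.seq (.const _)).congr fun _ => ampR_seq_mid _ _ _

theorem definable_q (X : Formula α) :
    Definable (components X) fun c : Config n => mk (nboolProof X n c.q) :=
  (definable_self.seq (.const _)).congr fun _ => ampR_seq_trd _ _ _

/-- Proofs may be selected by the scanned symbol, the symbol next to it and the state. -/
theorem definable_select {m : ℕ} {Γ : List (Formula α)}
    (F : Fin 2 → Fin 2 → Fin (m + 1) → Pf Γ A) :
    Definable (components (amp A (amp A A))) fun c : Config (m + 1) =>
      F (c.S.getLastD 0) (c.T.getLastD 0) c.q :=
  (definable_S _).last (F := fun σ c => F σ (c.T.getLastD 0) c.q) fun σ =>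
    (definable_T _).last (F := fun τ c => F σ τ c.q) fun τ => (definable_q _).state (F σ τ)

end Machine
end Pf

/-- The symbols that a transition appends to the left part of the tape, if `τ` is the symbol to the
right of the head. -/
def pushS {n : ℕ} (τ : Fin 2) : Fin 2 × Fin n × Dir → List (Fin 2)
  | (_, _, .left) => []
  | (σ', _, .right) => [σ', τ]

/-- The symbols that a transition appends to the reversed right part of the tape, if `τ` is the
symbol to the right of the head. -/
def pushT {n : ℕ} (τ : Fin 2) : Fin 2 × Fin n × Dir → List (Fin 2)
  | (σ', _, .left) => [τ, σ']
  | (_, _, .right) => []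

theorem Config.step_eq {n : ℕ} (δ : Transition n) (c : Config n) :
    c.step δ = ⟨c.S.dropLast ++ pushS (c.T.getLastD 0) (δ (c.S.getLastD 0, c.q)),
      c.T.dropLast ++ pushT (c.T.getLastD 0) (δ (c.S.getLastD 0, c.q)),
      (δ (c.S.getLastD 0, c.q)).2.1⟩ := by
  rw [Config.step]
  rcases δ (c.S.getLastD 0, c.q) with ⟨σ', q', d⟩
  cases d <;> simp [pushS, pushT]

/-- The encoding on `A` of the next configuration is definable from the encodings on `A³` of the
components of a configuration. -/
theorem definable_step {m : ℕ} (δ : Transition (m + 1)) (A : Formula α) :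
    Pf.Definable (Pf.components (amp A (amp A A)))
      fun c : Config (m + 1) => Pf.mk (configProof A (c.step δ)) := by
  have hq : Pf.Definable (Pf.components (amp A (amp A A)))
      fun c : Config (m + 1) => Pf.mk (nboolProof A (m + 1) (δ (c.S.getLastD 0, c.q)).2.1) :=
    (Pf.definable_select fun σ _ q => Pf.mk (projProof A (m + 1) (δ (σ, q)).2.1)).lolliR rfl
  simp only [Config.step_eq]
  exact (((Pf.definable_S _).bint fun f => Pf.definable_select fun σ τ q =>
    Pf.word f (pushS τ (δ (σ, q)))).prom.tensR ((Pf.definable_T _).bint fun f =>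
      Pf.definable_select fun σ τ q => Pf.word f (pushT τ (δ (σ, q)))).prom).tensR hq.prom

end ILL

theorem mainTheorem1 {α : Type u} (n : ℕ) (hn : 0 < n) (δ : ILL.Transition n)
    (A : ILL.Formula α) :
    ∃ step : ILL.Proof [ILL.Tur n (A.pow 3)] (ILL.Tur n A),
      ILL.EncodesStep δ (A.pow 3) A step := by
  -- `A.pow 3` is `amp A (amp A A)` by definition
  obtain ⟨m, rfl⟩ := Nat.exists_eq_succ_of_ne_zero hn.ne'
  obtain ⟨π, hπ⟩ := (ILL.definable_step δ A).exists_cut_tensR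
  induction π with
  | h π => exact ⟨π, fun c => ILL.Pf.exact (hπ c)⟩
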